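/- **Theorem 2 (semi-discrete entropy stability for the compressible Navier–Stokes equations).** *Gas.* Let $1\le d\le 3$, $m=d+2$, $u=(\rho,\rho V,\rho E)\in\mathbb{R}^m$, $\gamma=c_p/c_v>1$, $c_v>0$, $p=(\gamma-1)(\rho E-\rho\|V\|^2/2)$, $T=p/(\rho(c_p-c_v))$, and let $X_u=\{\rho>0,\ p>0\}$ be the set of physical states. Let $F(u)\in\mathbb{R}^{m\times d}$ be the inviscid Euler fluxes, with columns $F_j=(\rho V_j,\ \rho V_iV_j+\delta_{ij}p,\ V_j(\rho E+p))$, and let $G(u,\nabla u)$ be the viscous fluxes, with columns $G_j=-(0,\ \tau_{ij},\ \sum_i V_i\tau_{ij}-f_j)$, where $$\tau_{ij}=\mu\big(\partial_jV_i+\partial_iV_j-\tfrac23(\nabla\cdot V)\delta_{ij}\big)+\beta(\nabla\cdot V)\delta_{ij},\qquad f_j=-\kappa\,\partial_jT,\qquad \kappa=c_p\mu/Pr,\ Pr>0,$$ and the viscosities $\mu,\beta\ge0$ may depend continuously on the state $u\in X_u$. Put $s=\log(p/\rho^\gamma)-s_0$, $H=-\rho s$, let $v(u)=\partial H/\partial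 u$ be the entropy variables, $$v(u)=(\gamma-1)\Big(\tfrac{-s}{\gamma-1}+\tfrac{\gamma+1}{\gamma-1}-\tfrac{\rho E}{p},\ \tfrac{\rho V}{p},\ -\tfrac{\rho}{p}\Big),$$ let $X_v=v(X_u)$, let $u(v)$ be the inverse map, $\tilde A_0=\partial u/\partial v$, $\tilde A_n=\big(\partial (F\cdot n)/\partial u\big)\tilde A_0$, and write $F(v)=F(u(v))$, $G(v,q)=G(u(v),\tilde A_0(v)\,q)$. *Mesh and spaces.* Let $\mathcal T_h$ be a finite non-curved mesh with periodic boundaries in $\mathbb{R}^d$: the elements $K$ are images of one reference convex polytope under invertible affine maps, and for some lattice $\Lambda$ of rank $d$ the translates $a+K$ ($a\in\Lambda$) tile $\mathbb{R}^d$, so that the meshed domain $\Omega$ (the interior of the union of the elements) is a period cell. Faces are the intersections, of nonzero $(d-1)$-dimensional measure, of the boundaries of two tiles, and are identified modulo $\Lambda$; $\mathcal E_h$ is the set of faces, all of which are interior. For $k\ge0$ let $\mathcal Q_h^k$ and $\mathcal V_h^k$ be the spaces of $\mathbb{R}^{m\times d}$- and $\mathbb{R}^m$-valued functions that are polynomials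 of degree at most $k$ on each element, without continuity between elements. For $\mathcal E_h^E\subseteq\mathcal E_h$ let $\mathcal M_h^k$ be the space of $\mathbb{R}^m$-valued functions that are polynomials of degree at most $k$ on each face and continuous on the union of the faces in $\mathcal E_h^E$. Inner products are $(a,b)_{\mathcal T_h}=\sum_K\int_K a\cdot b$ and $\langle a,b\rangle_{\partial\mathcal T_h}=\sum_K\int_{\partial K}a\cdot b$; $n$ is the unit normal pointing outwards from $K$. *Scheme.* For $t\in(0,t_f)$, $(q_h(t),v_h(t),\widehat v_h(t))\in\mathcal Q_h^k\times\mathcal V_h^k\times\mathcal M_h^k$ satisfies $$(q_h,r)_{\mathcal T_h}+(v_h,\nabla\cdot r)_{\mathcal T_h}-\langle\widehat v_h,r\cdot n\rangle_{\partial\mathcal T_h}=0,$$ $$\big(\partial_t u(v_h),w\big)_{\mathcal T_h}-\big(F(v_h)+G(v_h,q_h),\nabla w\big)_{\mathcal T_h}+\langle\widehat f_h+\widehat g_h,w\rangle_{\partial\mathcal T_h}=0,\qquad \langle\widehat f_h+\widehat g_h,\mu\rangle_{\partial\mathcal T_h}=0$$ for all $(r,w,\mu)\in\mathcal Q_h^k\times\mathcal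 V_h^k\times\mathcal M_h^k$, and $(v_h|_{t=0}-v(u_0),w)_{\mathcal T_h}=0$ for all $w\in\mathcal V_h^k$, where $u_0$ takes values in $X_u$, $v(u_0)\in L^2(\Omega)$, and $$\widehat f_h=\tfrac12\big(F(\widehat v_h)+F(v_h)\big)\cdot n+\tfrac12\,\sigma(\widehat v_h,v_h;n)(v_h-\widehat v_h).$$ It is assumed that $v_h$ is continuous in time on $[0,t_f]$ and differentiable on $(0,t_f)$, that $\widehat f_h+\widehat g_h$ is integrable on faces, and that the numerical solution is physical, that is, $v_h$ (on the closed elements, for $0\le t\le t_f$) and $\widehat v_h$ (on the closed faces, for $0<t<t_f$) take values in $X_v$. *Assumptions on the fluxes.* (i) The stabilization matrix is entropy stable: for all $v_1,v_2\in X_v$ and $\|n\|=1$, $(v_2-v_1)^t\sigma(v_1,v_2;n)(v_2-v_1)\ge(v_2-v_1)^t\Sigma(v_1,v_2;n)(v_2-v_1)$, where $$\Sigma(v_1,v_2;n)=\int_0^1(1-\theta)\Big(\tilde A_n\big(v_1+\theta(v_2-v_1)\big)-\tilde A_n\big(v_2+\theta(v_1-v_2)\big)\Big)\,d\theta.$$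 (ii) The viscous numerical flux $\widehat g_h$, a function on $\partial\mathcal T_h$ that may depend in a non-local way on $(q_h,v_h,\widehat v_h)$, is entropy stable: for all physical $(q_h,v_h,\widehat v_h)\in\mathcal Q_h^k\times\mathcal V_h^k\times\mathcal M_h^k$, on every face of every element, $(v_h-\widehat v_h)^t\,\widehat g_h\ge(v_h-\widehat v_h)^t\big(\Pi_{\mathcal Q_h^k}[G(v_h,q_h)]\cdot n\big)$, where $\Pi_{\mathcal Q_h^k}$ is the $L^2$ projection onto $\mathcal Q_h^k$. *Conclusion.* The total generalized entropy $t\mapsto\int_{\mathcal T_h}H(u(v_h(t)))$ is differentiable with $$\frac{d}{dt}\int_{\mathcal T_h}H(u(v_h(t)))\le0\qquad(0<t<t_f),$$ it is non-increasing on $[0,t_f]$, and for all $t\in[0,t_f]$, with $v_{h,0}=v_h|_{t=0}$, $$\int_{\mathcal T_h}H\big(u^*(v_{h,0})\big)\le\int_{\mathcal T_h}H(u(v_h(t)))\le\int_{\mathcal T_h}H(u(v_{h,0})),\qquad u^*(v_h)=\frac1{|\Omega|}\int_{\mathcal T_h}u(v_h).$$ -/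

import Mathlib

open MeasureTheory Set Matrix
open scoped Pointwise

noncomputable section

namespace EntropyHDG

/-! ## Points, states and gradients -/

/-- Points of physical space `ℝᵈ`. -/
abbrev Pt (d : ℕ) := EuclideanSpace ℝ (Fin d)

/-- The `m = d + 2` components of a state: mass, the `d` momenta, energy. -/
abbrev Comp (d : ℕ) := Unit ⊕ Fin d ⊕ Unit

/-- Index of the mass component. -/
abbrev cMass {d : ℕ} : Comp d := Sum.inl ()
/-- Index of the `i`-th momentum component. -/
abbrev cMom {d : ℕ} (i : Fin d) : Comp d := Sum.inr (Sum.inl i)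
/-- Index of the energy component. -/
abbrev cEnergy {d : ℕ} : Comp d := Sum.inr (Sum.inr ())

/-- State vectors in `ℝᵐ`, in conservation variables `(ρ, ρV, ρE)` or in entropy variables. -/
abbrev State (d : ℕ) := Comp d → ℝ

/-- `m × d` matrices: fluxes, gradients of states. -/
abbrev Grad (d : ℕ) := Matrix (Comp d) (Fin d) ℝ

/-- The Jacobian matrix of a map between state vectors. -/
def jacobian {d : ℕ} (f : State d → State d) (x : State d) : Matrix (Comp d) (Comp d) ℝ :=
  LinearMap.toMatrix' (fderiv ℝ f x : State d →ₗ[ℝ] State d)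

/-! ## Thermodynamics of a calorically perfect gas -/

/-- Velocity `V = ρV / ρ`. -/
def velocity {d : ℕ} (u : State d) (i : Fin d) : ℝ := u (cMom i) / u cMass

/-- Pressure `p = (γ - 1) (ρE - ρ ‖V‖² / 2)`. -/
def pressure {d : ℕ} (γ : ℝ) (u : State d) : ℝ :=
  (γ - 1) * (u cEnergy - u cMass * (∑ i, velocity u i ^ 2) / 2)

/-- The set `X_u` of physical states: positive density and pressure. -/
def physicalStates (d : ℕ) (γ : ℝ) : Set (State d) := {u | 0 < u cMass ∧ 0 < pressure γ u}

/-- Thermodynamic entropy `s = log (p / ρ^γ) - s₀`. -/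
def thermoEntropy {d : ℕ} (γ s₀ : ℝ) (u : State d) : ℝ :=
  Real.log (pressure γ u / u cMass ^ γ) - s₀

/-- Generalized entropy `H = -ρ s`. -/
def genEntropy {d : ℕ} (γ s₀ : ℝ) (u : State d) : ℝ := -(u cMass * thermoEntropy γ s₀ u)

/-- The entropy variables `v = v(u)`. -/
def entropyVars {d : ℕ} (γ s₀ : ℝ) (u : State d) : State d
  | Sum.inl _ => (γ - 1) *
      (-thermoEntropy γ s₀ u / (γ - 1) + (γ + 1) / (γ - 1) - u cEnergy / pressure γ u)
  | Sum.inr (Sum.inl i) => (γ - 1) * (u cMass * velocity u i / pressure γ u)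
  | Sum.inr (Sum.inr _) => (γ - 1) * (-(u cMass / pressure γ u))

/-- The set `X_v = v(X_u)` of physical states in entropy variables. -/
def physicalEntropyStates (d : ℕ) (γ s₀ : ℝ) : Set (State d) :=
  entropyVars γ s₀ '' physicalStates d γ

/-- Velocity as a function of the entropy variables. -/
def velocityOfEntropyVars {d : ℕ} (v : State d) (i : Fin d) : ℝ := -(v (cMom i) / v cEnergy)

/-- Thermodynamic entropy as a function of the entropy variables. -/
def thermoEntropyOfEntropyVars {d : ℕ} (γ : ℝ) (v : State d) : ℝ :=
  γ - v cMass + v cEnergy * (∑ i, velocityOfEntropyVars v i ^ 2) / 2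

/-- Density as a function of the entropy variables. -/
def densityOfEntropyVars {d : ℕ} (γ s₀ : ℝ) (v : State d) : ℝ :=
  ((γ - 1) / (-v cEnergy) / Real.exp (thermoEntropyOfEntropyVars γ v + s₀)) ^ (1 / (γ - 1))

/-- The inverse mapping `u = u(v)`, see `consVars_entropyVars`. -/
def consVars {d : ℕ} (γ s₀ : ℝ) (v : State d) : State d
  | Sum.inl _ => densityOfEntropyVars γ s₀ v
  | Sum.inr (Sum.inl i) => densityOfEntropyVars γ s₀ v * velocityOfEntropyVars v i
  | Sum.inr (Sum.inr _) => densityOfEntropyVars γ s₀ v / (-v cEnergy) +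
      densityOfEntropyVars γ s₀ v * (∑ i, velocityOfEntropyVars v i ^ 2) / 2

/-- `consVars` inverts `entropyVars` on physical states. -/
theorem consVars_entropyVars {d : ℕ} {γ : ℝ} (hγ : 1 < γ) (s₀ : ℝ) {u : State d}
    (hu : u ∈ physicalStates d γ) : consVars γ s₀ (entropyVars γ s₀ u) = u := by
  obtain ⟨hρ, hp⟩ := hu
  have hg : 0 < γ - 1 := by linarith
  have hV : ∀ i, velocityOfEntropyVars (entropyVars γ s₀ u) i = velocity u i := by
    intro i
    simp only [velocityOfEntropyVars, entropyVars]
    field_simp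
  have hE : u cEnergy = pressure γ u / (γ - 1) + u cMass * (∑ i, velocity u i ^ 2) / 2 := by
    simp only [pressure]
    field_simp
    ring
  have hs : thermoEntropyOfEntropyVars γ (entropyVars γ s₀ u) = thermoEntropy γ s₀ u := by
    simp only [thermoEntropyOfEntropyVars, hV]
    simp only [entropyVars]
    rw [hE]
    field_simp
    ring
  have hd : densityOfEntropyVars γ s₀ (entropyVars γ s₀ u) = u cMass := by
    have h1 : (0 : ℝ) < pressure γ u / u cMass ^ γ := by positivity
    have h2 : (γ - 1) / (-(entropyVars γ s₀ u) cEnergy) = pressure γ u / u cMass := by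
      simp only [entropyVars]
      field_simp
    have h3 : thermoEntropy γ s₀ u + s₀ = Real.log (pressure γ u / u cMass ^ γ) := by
      simp [thermoEntropy]
    have h4 : pressure γ u / u cMass / (pressure γ u / u cMass ^ γ) = u cMass ^ (γ - 1) := by
      rw [Real.rpow_sub_one hρ.ne']
      field_simp
    simp only [densityOfEntropyVars]
    rw [hs, h3, Real.exp_log h1, h2, h4, ← Real.rpow_mul hρ.le, mul_one_div_cancel hg.ne',
      Real.rpow_one]
  funext c
  rcases c with c | i | c
  · exact hd
  · simp only [consVars, hd, hV, velocity]
    field_simp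
  · simp only [consVars, hd, hV]
    rw [show u (Sum.inr (Sum.inr c)) = u cEnergy from rfl, hE]
    simp only [entropyVars]
    field_simp

/-! ## Inviscid and viscous fluxes -/

/-- The inviscid fluxes `F(u)`. -/
def inviscidFlux {d : ℕ} (γ : ℝ) (u : State d) : Grad d :=
  Matrix.of fun c j => match c with
    | Sum.inl _ => u cMass * velocity u j
    | Sum.inr (Sum.inl i) =>
        u cMass * velocity u i * velocity u j + if i = j then pressure γ u else 0
    | Sum.inr (Sum.inr _) => velocity u j * (u cEnergy + pressure γ u)

/-- Data of a viscous, heat-conducting, calorically perfect gas in `d` space dimensions. The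
viscosities may depend on the state. -/
structure Gas (d : ℕ) where
  /-- specific heat at constant pressure -/
  cp : ℝ
  /-- specific heat at constant volume -/
  cv : ℝ
  /-- Prandtl number -/
  Pr : ℝ
  /-- baseline entropy level -/
  s₀ : ℝ
  /-- dynamic (shear) viscosity, as a function of the conservation variables -/
  shearVisc : State d → ℝ
  /-- bulk viscosity, as a function of the conservation variables -/
  bulkVisc : State d → ℝ
  cv_pos : 0 < cv
  cv_lt_cp : cv < cp
  Pr_pos : 0 < Pr
  shearVisc_nonneg : ∀ u ∈ physicalStates d (cp / cv), 0 ≤ shearVisc u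
  bulkVisc_nonneg : ∀ u ∈ physicalStates d (cp / cv), 0 ≤ bulkVisc u
  shearVisc_cont : ContinuousOn shearVisc (physicalStates d (cp / cv))
  bulkVisc_cont : ContinuousOn bulkVisc (physicalStates d (cp / cv))

namespace Gas

variable {d : ℕ} (g : Gas d)

/-- Ratio of specific heats `γ = c_p / c_v`. -/
def γ : ℝ := g.cp / g.cv

/-- Temperature, from `p = ρ (c_p - c_v) T`. -/
def temperature (u : State d) : ℝ := pressure g.γ u / (u cMass * (g.cp - g.cv))

/-- Thermal conductivity `κ = c_p μ / Pr`. -/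
def conductivity (u : State d) : ℝ := g.cp * g.shearVisc u / g.Pr

/-- `∂V_i/∂x_j` at the state `u` with state gradient `du`, by the chain rule. -/
def velocityGrad (u : State d) (du : Grad d) (i j : Fin d) : ℝ :=
  fderiv ℝ (fun w : State d => velocity w i) u (fun c => du c j)

/-- `∂T/∂x_j` at the state `u` with state gradient `du`, by the chain rule. -/
def temperatureGrad (u : State d) (du : Grad d) (j : Fin d) : ℝ :=
  fderiv ℝ g.temperature u (fun c => du c j)

/-- Newtonian viscous stress tensor. -/
def stress (u : State d) (du : Grad d) (i j : Fin d) : ℝ :=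
  g.shearVisc u * (velocityGrad u du i j + velocityGrad u du j i
      - if i = j then 2 / 3 * ∑ k, velocityGrad u du k k else 0)
    + if i = j then g.bulkVisc u * ∑ k, velocityGrad u du k k else 0

/-- Fourier heat flux. -/
def heatFlux (u : State d) (du : Grad d) (j : Fin d) : ℝ :=
  -(g.conductivity u * g.temperatureGrad u du j)

/-- The viscous fluxes `G(u, ∇u)`. -/
def viscousFlux (u : State d) (du : Grad d) : Grad d :=
  Matrix.of fun c j => match c with
    | Sum.inl _ => 0
    | Sum.inr (Sum.inl i) => -g.stress u du i j
    | Sum.inr (Sum.inr _) => -((∑ i, velocity u i * g.stress u du i j) - g.heatFlux u du j)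

/-! ### The same quantities in entropy variables -/

/-- `X_u` -/
def Xu : Set (State d) := physicalStates d g.γ

/-- `X_v` -/
def Xv : Set (State d) := physicalEntropyStates d g.γ g.s₀

/-- `H(u)` -/
def H (u : State d) : ℝ := genEntropy g.γ g.s₀ u

/-- `v(u)` -/
def vOf (u : State d) : State d := entropyVars g.γ g.s₀ u

/-- `u(v)` -/
def uOf (v : State d) : State d := consVars g.γ g.s₀ v

/-- `F(v) = F(u(v))` -/
def F (v : State d) : Grad d := inviscidFlux g.γ (g.uOf v)

/-- The Riemannian metric tensor `Ã₀(v) = ∂u/∂v`. -/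
def A0 (v : State d) : Matrix (Comp d) (Comp d) ℝ := jacobian g.uOf v

/-- `G(v, q) = G(u(v), ∇u(v, q))` with `∇u(v, q) = (∂u/∂v) q`. -/
def G (v : State d) (q : Grad d) : Grad d := g.viscousFlux (g.uOf v) (g.A0 v * q)

/-- `A_n(v)`: Jacobian of `F · n` with respect to the conservation variables, at `u(v)`. -/
def An (v : State d) (n : Pt d) : Matrix (Comp d) (Comp d) ℝ :=
  jacobian (fun u => inviscidFlux g.γ u *ᵥ n.ofLp) (g.uOf v)

/-- `Ã_n = A_n Ã₀`. -/
def AnTilde (v : State d) (n : Pt d) : Matrix (Comp d) (Comp d) ℝ := g.An v n * g.A0 v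

/-- The matrix `Σ(v₁, v₂; n)`, with the straight path
`ṽ(θ; v₁, v₂) = v₁ + θ (v₂ - v₁)` in entropy variables. -/
def Sig (v₁ v₂ : State d) (n : Pt d) : Matrix (Comp d) (Comp d) ℝ :=
  Matrix.of fun a b => ∫ θ in (0 : ℝ)..1, (1 - θ) *
    (g.AnTilde (AffineMap.lineMap v₁ v₂ θ) n a b - g.AnTilde (AffineMap.lineMap v₂ v₁ θ) n a b)

/-- Entropy-stable stabilization matrices. -/
def EntropyStableStab (σ : State d → State d → Pt d → Matrix (Comp d) (Comp d) ℝ) : Prop :=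
  ∀ v₁ ∈ g.Xv, ∀ v₂ ∈ g.Xv, ∀ n : Pt d, ‖n‖ = 1 →
    (v₂ - v₁) ⬝ᵥ (g.Sig v₁ v₂ n *ᵥ (v₂ - v₁)) ≤ (v₂ - v₁) ⬝ᵥ (σ v₁ v₂ n *ᵥ (v₂ - v₁))

/-- The inviscid numerical flux
`f̂ = (F(v̂) + F(v)) · n / 2 + σ(v̂, v; n) (v - v̂) / 2`. -/
def inviscidNumFlux (σ : State d → State d → Pt d → Matrix (Comp d) (Comp d) ℝ)
    (vhat v : State d) (n : Pt d) : State d :=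
  (1 / 2 : ℝ) • ((g.F vhat + g.F v) *ᵥ n.ofLp) + (1 / 2 : ℝ) • (σ vhat v n *ᵥ (v - vhat))

end Gas

/-! ## Non-curved periodic meshes -/

/-- Non-degenerate convex polytopes: bounded, with nonempty interior, and cut out by finitely many
closed half-spaces. -/
def IsPolytope {d : ℕ} (K : Set (Pt d)) : Prop :=
  Bornology.IsBounded K ∧ (interior K).Nonempty ∧
    ∃ S : Finset (Pt d × ℝ), K = {x | ∀ h ∈ S, inner ℝ h.1 x ≤ h.2}

/-- One side of a face: the element `elem` seen with its neighbour `nbr` translated by the period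
`shift` (zero across faces that need no periodic identification). -/
structure Side (ι : Type*) (d : ℕ) where
  elem : ι
  nbr : ι
  shift : Pt d

/-- The same face, seen from the neighbour. -/
def Side.swap {ι : Type*} {d : ℕ} (s : Side ι d) : Side ι d := ⟨s.nbr, s.elem, -s.shift⟩

/-- A finite non-curved (affine) mesh with periodic boundaries: the elements are images of one
reference element under invertible affine maps, and the meshed domain is a period cell of a lattice
of full rank, that is, the translates of the elements by the periods tile `ℝᵈ`. Hanging nodes are
allowed. -/
structure PeriodicMesh (ι : Type*) (d : ℕ) where
  /-- the reference element -/
  refElem : Set (Pt d)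
  /-- the parametric mappings of degree one -/
  ψ : ι → (Pt d ≃ᵃ[ℝ] Pt d)
  /-- the lattice of periods -/
  lattice : AddSubgroup (Pt d)
  refElem_polytope : IsPolytope refElem
  lattice_discrete : DiscreteTopology lattice
  lattice_span : Submodule.span ℝ (lattice : Set (Pt d)) = ⊤
  disjoint_interiors : ∀ i j, ∀ a ∈ lattice, ¬ (j = i ∧ a = 0) →
    Disjoint (interior (ψ i '' refElem)) (a +ᵥ interior (ψ j '' refElem))
  covers : ∀ x : Pt d, ∃ i, ∃ a ∈ lattice, x ∈ a +ᵥ (ψ i '' refElem)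

/-- Real polynomial functions of degree at most `k` on `ℝᵈ`. -/
def IsPolyFun {d : ℕ} (k : ℕ) (f : Pt d → ℝ) : Prop :=
  ∃ P : MvPolynomial (Fin d) ℝ, P.totalDegree ≤ k ∧ ∀ x, f x = MvPolynomial.eval x.ofLp P

/-- Spatial gradient of a state-valued function. -/
def gradient {d : ℕ} (w : Pt d → State d) (x : Pt d) : Grad d :=
  Matrix.of fun c j => fderiv ℝ (fun y => w y c) x (EuclideanSpace.single j 1)

/-- Row-wise divergence of a matrix-valued function. -/
def divergence {d : ℕ} (r : Pt d → Grad d) (x : Pt d) : State d :=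
  fun c => ∑ j, fderiv ℝ (fun y => r y c j) x (EuclideanSpace.single j 1)

namespace PeriodicMesh

variable {ι : Type*} {d : ℕ} (M : PeriodicMesh ι d)

/-- The (closed) elements. -/
def K (i : ι) : Set (Pt d) := M.ψ i '' M.refElem

/-- The domain `Ω` partitioned by the mesh. -/
def domain : Set (Pt d) := interior (⋃ i, M.K i)

/-- The closed face behind a side, located on the boundary of `s.elem`. -/
def face (s : Side ι d) : Set (Pt d) :=
  frontier (M.K s.elem) ∩ (s.shift +ᵥ frontier (M.K s.nbr))

/-- The sides of the mesh, that is, the faces counted once for each of the two adjacent elements.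
A face has nonzero `(d-1)`-dimensional measure. Faces on the boundary of the domain are identified
with their translate by a period, so that all faces have two sides. -/
def sides : Set (Side ι d) :=
  {s | s.shift ∈ M.lattice ∧ ¬ (s.nbr = s.elem ∧ s.shift = 0) ∧ μHE[d - 1] (M.face s) ≠ 0}

/-- `n` is the unit normal to the face of `s` that points outwards from `s.elem`. -/
def IsOutwardNormal (s : Side ι d) (n : Pt d) : Prop :=
  ‖n‖ = 1 ∧ ∀ x ∈ M.face s, ∀ y ∈ M.K s.elem, inner ℝ n (y - x) ≤ 0

open Classical in
/-- The outward unit normal of a side. -/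
def normal (s : Side ι d) : Pt d :=
  if h : ∃ n, M.IsOutwardNormal s n then h.choose else 0

/-! ### Inner products -/

/-- `(a, b)_{𝒯_h}` for state-valued broken functions. -/
def ip [Fintype ι] (a b : ι → Pt d → State d) : ℝ := ∑ i, ∫ x in M.K i, a i x ⬝ᵥ b i x

/-- `(A, B)_{𝒯_h}` for matrix-valued broken functions. -/
def ipGrad [Fintype ι] (A B : ι → Pt d → Grad d) : ℝ :=
  ∑ i, ∫ x in M.K i, ((A i x)ᵀ * B i x).trace

/-- `⟨a, b⟩_{∂𝒯_h}`: the boundaries of all elements are the unions of their sides. -/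
def ipBdry (a b : Side ι d → Pt d → State d) : ℝ :=
  ∑ᶠ s ∈ M.sides, ∫ x in M.face s, a s x ⬝ᵥ b s x ∂μHE[d - 1]

/-! ### Finite element spaces

An element of a broken space is a family of functions indexed by the elements of the mesh, and a
polynomial on an element is identified with its extension to `ℝᵈ`. Its trace from the element
`s.elem` on the face of `s` is the restriction. -/

/-- The space `𝒬_h^k`. -/
def Q (k : ℕ) : Set (ι → Pt d → Grad d) :=
  {r | ∀ i c j, IsPolyFun k (fun y => r i (M.ψ i y) c j)}

/-- The space `𝒱_h^k`. -/
def V (k : ℕ) : Set (ι → Pt d → State d) :=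
  {w | ∀ i c, IsPolyFun k (fun y => w i (M.ψ i y) c)}

/-- The space `ℳ_h^k` of functions on the mesh skeleton: polynomial on every face, single valued
(the two sides of a face carry the same function, up to the translation by a period), and
continuous on the union of the faces in `EE` (the faces are closed and finite in number, so that
continuity means agreement at common points; points that differ by a period are the same point of
the periodic skeleton). `EE = ∅` is HDG, `EE = univ` is EDG. The value of `μ s x` matters only for
`s ∈ M.sides` and `x ∈ M.face s`. -/
def Mspace (k : ℕ) (EE : Set (Side ι d)) : Set (Side ι d → Pt d → State d) :=
  {μ | (∀ s ∈ M.sides, ∀ c, ∃ f, IsPolyFun k f ∧ ∀ x ∈ M.face s, μ s x c = f x) ∧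
    (∀ s ∈ M.sides, ∀ x ∈ M.face s, μ s x = μ s.swap (x - s.shift)) ∧
    (∀ s ∈ M.sides ∩ EE, ∀ s' ∈ M.sides ∩ EE, ∀ x ∈ M.face s, ∀ x' ∈ M.face s',
      x - x' ∈ M.lattice → μ s x = μ s' x')}

/-- `P` is the `L²` projection of `A` onto `𝒬_h^k`. -/
def IsProjQ [Fintype ι] (k : ℕ) (A P : ι → Pt d → Grad d) : Prop :=
  P ∈ M.Q k ∧ ∀ r ∈ M.Q k, M.ipGrad P r = M.ipGrad A r

/-! ### The scheme -/

/-- Physical broken functions: positive density and pressure at every point of every element. -/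
def PhysV (g : Gas d) (v : ι → Pt d → State d) : Prop := ∀ i, ∀ x ∈ M.K i, v i x ∈ g.Xv

/-- Physical skeleton functions. -/
def PhysM (g : Gas d) (vhat : Side ι d → Pt d → State d) : Prop :=
  ∀ s ∈ M.sides, ∀ x ∈ M.face s, vhat s x ∈ g.Xv

/-- Viscous numerical fluxes: functions on the sides that may depend on `(q_h, v_h, v̂_h)` in a
non-local way. -/
abbrev ViscNumFlux (ι : Type*) (d : ℕ) :=
  (ι → Pt d → Grad d) → (ι → Pt d → State d) → (Side ι d → Pt d → State d) →
    Side ι d → Pt d → State d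

/-- Entropy-stable viscous numerical fluxes. -/
def EntropyStableVisc [Fintype ι] (g : Gas d) (k : ℕ) (EE : Set (Side ι d))
    (ghat : ViscNumFlux ι d) : Prop :=
  ∀ q ∈ M.Q k, ∀ v ∈ M.V k, ∀ vhat ∈ M.Mspace k EE, M.PhysV g v → M.PhysM g vhat →
    ∀ P, M.IsProjQ k (fun i x => g.G (v i x) (q i x)) P →
      ∀ s ∈ M.sides, ∀ x ∈ M.face s,
        (v s.elem x - vhat s x) ⬝ᵥ (P s.elem x *ᵥ (M.normal s).ofLp)
          ≤ (v s.elem x - vhat s x) ⬝ᵥ ghat q v vhat s x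

/-- The total numerical flux `f̂_h + ĝ_h` on the sides. -/
def numFlux (g : Gas d) (σ : State d → State d → Pt d → Matrix (Comp d) (Comp d) ℝ)
    (ghat : ViscNumFlux ι d) (q : ι → Pt d → Grad d) (v : ι → Pt d → State d)
    (vhat : Side ι d → Pt d → State d) (s : Side ι d) (x : Pt d) : State d :=
  g.inviscidNumFlux σ (vhat s x) (v s.elem x) (M.normal s) + ghat q v vhat s x

/-- `(q_h, v_h, v̂_h)` solves, on the time interval `[0, tf]`, the entropy-variable hybridized
discontinuous Galerkin discretization of the compressible Navier-Stokes equations on a mesh with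
periodic boundaries (there is no boundary term) with initial condition `u₀`. The numerical fluxes
are integrable, so that the face terms make sense. -/
structure IsSolution [Fintype ι] (g : Gas d) (k : ℕ) (EE : Set (Side ι d))
    (σ : State d → State d → Pt d → Matrix (Comp d) (Comp d) ℝ) (ghat : ViscNumFlux ι d)
    (u₀ : Pt d → State d) (tf : ℝ) (q : ℝ → ι → Pt d → Grad d) (v : ℝ → ι → Pt d → State d)
    (vhat : ℝ → Side ι d → Pt d → State d) : Prop where
  q_mem : ∀ t ∈ Ioo 0 tf, q t ∈ M.Q k
  v_mem : ∀ t ∈ Icc 0 tf, v t ∈ M.V k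
  vhat_mem : ∀ t ∈ Ioo 0 tf, vhat t ∈ M.Mspace k EE
  v_cont : ∀ i, ∀ x ∈ M.K i, ContinuousOn (fun t => v t i x) (Icc 0 tf)
  v_diff : ∀ i, ∀ x ∈ M.K i, ∀ t ∈ Ioo 0 tf, DifferentiableAt ℝ (fun t' => v t' i x) t
  flux_integrable : ∀ t ∈ Ioo 0 tf, ∀ s ∈ M.sides,
    IntegrableOn (M.numFlux g σ ghat (q t) (v t) (vhat t) s) (M.face s) μHE[d - 1]
  eq_gradient : ∀ t ∈ Ioo 0 tf, ∀ r ∈ M.Q k,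
    M.ipGrad (q t) r + M.ip (v t) (fun i => divergence (r i))
      - M.ipBdry (vhat t) (fun s x => r s.elem x *ᵥ (M.normal s).ofLp) = 0
  eq_conservation : ∀ t ∈ Ioo 0 tf, ∀ w ∈ M.V k,
    M.ip (fun i x => deriv (fun t' => g.uOf (v t' i x)) t) w
      - M.ipGrad (fun i x => g.F (v t i x) + g.G (v t i x) (q t i x)) (fun i => gradient (w i))
      + M.ipBdry (M.numFlux g σ ghat (q t) (v t) (vhat t)) (fun s => w s.elem) = 0
  eq_flux : ∀ t ∈ Ioo 0 tf, ∀ μ ∈ M.Mspace k EE,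
    M.ipBdry (M.numFlux g σ ghat (q t) (v t) (vhat t)) μ = 0
  eq_initial : ∀ w ∈ M.V k, M.ip (fun i x => v 0 i x - g.vOf (u₀ x)) w = 0

/-- Total generalized entropy `∫_{𝒯_h} H(u(v))`. -/
def totalEntropy [Fintype ι] (g : Gas d) (v : ι → Pt d → State d) : ℝ :=
  ∑ i, ∫ x in M.K i, g.H (g.uOf (v i x))

/-- The minimum total entropy state `u*(v) = μ_L(Ω)⁻¹ ∫_{𝒯_h} u(v)`. -/
def meanState [Fintype ι] (g : Gas d) (v : ι → Pt d → State d) : State d :=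
  fun c => (volume.real M.domain)⁻¹ * ∑ i, ∫ x in M.K i, g.uOf (v i x) c

end PeriodicMesh

end EntropyHDG

end

/-! In entropy variables everything is a gradient. The entropy H and the potential (γ - 1)ρ are
Legendre duals, so that the v-gradient of (γ - 1)ρ is u (`hasDerivAt_densityOfEntropyVars`) and dH =
v · du (`Gas.hasDerivAt_H_uOf`). Likewise the v-gradient of ψ_j = (γ - 1)ρV_j is the inviscid flux
F_j (`Gas.hasDerivAt_fluxPotential`). The physical set becomes the half-space where the energy
component is negative, which is open and convex.

Testing the conservation law with w = v_h gives d/dt ∫H = (F + G, ∇v_h) - ⟨f̂ + ĝ, v_h⟩. The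
inviscid volume term is the integral of div ψ(v_h), hence the boundary integral of ψ(v_h) · n. The
trace v̂_h is single valued and normals are opposite on the two sides of a face, so ψ(v̂_h) · n sums
to zero; v̂_h is itself a test function of the flux equation, so (f̂ + ĝ) · v̂_h sums to zero as
well. It remains to compare jumps pointwise on each side. For the inviscid part, the quadratic form
of Σ is twice the error of the trapezoidal rule for ψ · n along the segment from v̂ to v
(`Gas.quadratic_Sig`), so the assumption on σ says exactly that (v - v̂) · f̂ dominates the jump of
ψ · n. For the viscous part, let P be the projection of G. Integration by parts and the gradient
equation tested with P give (G, ∇v_h) = ⟨v_h - v̂_h, P n⟩ + (q_h, G). The last term is nonpositive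
because viscous stress and heat conduction dissipate (`Gas.trace_transpose_mul_G_nonpos`), and the
assumption on ĝ controls the other.

Two analytic tools support this: the divergence theorem on a polytope with Hausdorff area on its
faces, obtained from Fubini on coordinate lines (`PeriodicMesh.integral_fderiv_eq_sum_faces`), and
differentiation under the integral in time (`hasDerivAt_integral_field`), where pointwise
differentiability suffices because v_h moves in a finite dimensional space.

For the lower bound, constant test functions show that the mean of u is conserved. The mean is
physical since the pressure is an infimum of affine functions on positive densities, and Jensen's
inequality follows by integrating the tangent plane inequality at the mean. -/

namespace EntropyHDG

/-! ### Entropy variables, Legendre duality and convexity of the entropy -/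

section GasDynamics

variable {d : ℕ}

theorem sum_comp (f : Comp d → ℝ) :
    ∑ c, f c = f cMass + (∑ i, f (cMom i) + f cEnergy) := by
  simp [Fintype.sum_sum_type]

theorem dotProduct_comp (a b : State d) :
    a ⬝ᵥ b = a cMass * b cMass + (∑ i, a (cMom i) * b (cMom i) + a cEnergy * b cEnergy) := by
  simp [dotProduct, Fintype.sum_sum_type]

/-- The real power turns into the exponential of an expression in logarithms and rational functions
of v, from which smoothness, derivatives and logarithms of ρ can be read off. -/
theorem densityOfEntropyVars_eq_exp {γ : ℝ} (hγ : 1 < γ) (s₀ : ℝ) {v : State d}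
    (hv : v cEnergy < 0) :
    densityOfEntropyVars γ s₀ v = Real.exp (1 / (γ - 1) * (Real.log (γ - 1) -
      Real.log (-v cEnergy) - (thermoEntropyOfEntropyVars γ v + s₀))) := by
  have hg : 0 < γ - 1 := by linarith
  have hv' : 0 < -v cEnergy := by linarith
  have h1 : 0 < (γ - 1) / (-v cEnergy) := by positivity
  rw [densityOfEntropyVars, Real.rpow_def_of_pos (by positivity),
    Real.log_div h1.ne' (Real.exp_pos _).ne', Real.log_div hg.ne' hv'.ne', Real.log_exp, mul_comm]

theorem densityOfEntropyVars_pos {γ : ℝ} (hγ : 1 < γ) (s₀ : ℝ) {v : State d}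
    (hv : v cEnergy < 0) : 0 < densityOfEntropyVars γ s₀ v := by
  rw [densityOfEntropyVars_eq_exp hγ s₀ hv]
  exact Real.exp_pos _

theorem velocity_consVars {γ : ℝ} (hγ : 1 < γ) (s₀ : ℝ) {v : State d}
    (hv : v cEnergy < 0) (i : Fin d) :
    velocity (consVars γ s₀ v) i = velocityOfEntropyVars v i := by
  have := (densityOfEntropyVars_pos hγ s₀ hv).ne'
  simp only [velocity, consVars]
  field_simp

theorem pressure_consVars {γ : ℝ} (hγ : 1 < γ) (s₀ : ℝ) {v : State d}
    (hv : v cEnergy < 0) :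
    pressure γ (consVars γ s₀ v) = (γ - 1) * (densityOfEntropyVars γ s₀ v / (-v cEnergy)) := by
  simp only [pressure, velocity_consVars hγ s₀ hv]
  simp only [consVars]
  ring

theorem consVars_mem {γ : ℝ} (hγ : 1 < γ) (s₀ : ℝ) {v : State d}
    (hv : v cEnergy < 0) : consVars γ s₀ v ∈ physicalStates d γ := by
  have h := densityOfEntropyVars_pos hγ s₀ hv
  refine ⟨h, ?_⟩
  rw [pressure_consVars hγ s₀ hv]
  have hg : 0 < γ - 1 := by linarith
  have hv' : 0 < -v cEnergy := by linarith
  positivity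

theorem thermoEntropy_consVars {γ : ℝ} (hγ : 1 < γ) (s₀ : ℝ) {v : State d}
    (hv : v cEnergy < 0) :
    thermoEntropy γ s₀ (consVars γ s₀ v) = thermoEntropyOfEntropyVars γ v := by
  have h := densityOfEntropyVars_pos hγ s₀ hv
  have hg : 0 < γ - 1 := by linarith
  have hv' : 0 < -v cEnergy := by linarith
  rw [thermoEntropy, pressure_consVars hγ s₀ hv,
    show consVars γ s₀ v cMass = densityOfEntropyVars γ s₀ v from rfl,
    Real.log_div (by positivity) (by positivity), Real.log_rpow h,
    Real.log_mul hg.ne' (by positivity), Real.log_div h.ne' hv'.ne',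
    densityOfEntropyVars_eq_exp hγ s₀ hv, Real.log_exp]
  field_simp
  ring

/-- The converse of `consVars_entropyVars`. It needs no physical state to start from, only the sign
of the energy component, and therefore determines the image of the physical states. -/
theorem entropyVars_consVars {γ : ℝ} (hγ : 1 < γ) (s₀ : ℝ) {v : State d}
    (hv : v cEnergy < 0) : entropyVars γ s₀ (consVars γ s₀ v) = v := by
  have h := densityOfEntropyVars_pos hγ s₀ hv
  have hg : 0 < γ - 1 := by linarith
  have hv' : v cEnergy ≠ 0 := hv.ne
  funext c
  rcases c with c | i | c
  · simp only [entropyVars, thermoEntropy_consVars hγ s₀ hv, pressure_consVars hγ s₀ hv]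
    simp only [consVars, thermoEntropyOfEntropyVars]
    rw [show (Sum.inl c : Comp d) = cMass from rfl]
    field_simp
    ring
  · simp only [entropyVars, velocity_consVars hγ s₀ hv, pressure_consVars hγ s₀ hv]
    simp only [consVars, velocityOfEntropyVars]
    field_simp
  · simp only [entropyVars, pressure_consVars hγ s₀ hv]
    simp only [consVars]
    rw [show (Sum.inr (Sum.inr c) : Comp d) = cEnergy from rfl]
    field_simp

/-- Openness and convexity of the physical set are immediate from this form: the first is needed to
differentiate, the second to keep the straight paths in Σ physical. -/
theorem physicalEntropyStates_eq {γ : ℝ} (hγ : 1 < γ) (s₀ : ℝ) :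
    physicalEntropyStates d γ s₀ = {v | v cEnergy < 0} := by
  ext v
  constructor
  · rintro ⟨u, ⟨h1, h2⟩, rfl⟩
    have hg : 0 < γ - 1 := by linarith
    have : 0 < (γ - 1) * (u cMass / pressure γ u) := by positivity
    simp only [mem_ofPred_eq, entropyVars]
    linarith
  · intro hv
    exact ⟨_, consVars_mem hγ s₀ hv, entropyVars_consVars hγ s₀ hv⟩

/-- The generalized entropy is the Legendre transform of the potential `(γ - 1) ρ`. -/
theorem genEntropy_eq_legendre {γ : ℝ} (hγ : 1 < γ) (s₀ : ℝ) {u : State d}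
    (hu : u ∈ physicalStates d γ) :
    genEntropy γ s₀ u = entropyVars γ s₀ u ⬝ᵥ u - (γ - 1) * u cMass := by
  obtain ⟨hρ, hp⟩ := hu
  have hg : 0 < γ - 1 := by linarith
  have hm : ∀ i, entropyVars γ s₀ u (cMom i) * u (cMom i) =
      (γ - 1) * u cMass ^ 2 / pressure γ u * velocity u i ^ 2 := by
    intro i
    simp only [entropyVars, velocity]
    field_simp
  have hE : u cEnergy = pressure γ u / (γ - 1) + u cMass * (∑ i, velocity u i ^ 2) / 2 := by
    simp only [pressure]
    field_simp
    ring
  rw [dotProduct_comp, Finset.sum_congr rfl fun i _ => hm i, ← Finset.mul_sum]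
  simp only [entropyVars, genEntropy]
  rw [hE]
  field_simp
  ring

/-- The tangent plane inequality for the convex generalized entropy. -/
theorem genEntropy_tangent_le {γ : ℝ} (hγ : 1 < γ) (s₀ : ℝ) {u w : State d}
    (hu : u ∈ physicalStates d γ) (hw : w ∈ physicalStates d γ) :
    genEntropy γ s₀ w + entropyVars γ s₀ w ⬝ᵥ (u - w) ≤ genEntropy γ s₀ u := by
  obtain ⟨hρ, hp⟩ := hu
  obtain ⟨hρ', hp'⟩ := hw
  have hg : 0 < γ - 1 := by linarith
  rw [dotProduct_sub, genEntropy_eq_legendre hγ s₀ ⟨hρ', hp'⟩]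
  have hm : ∑ i, entropyVars γ s₀ w (cMom i) * u (cMom i) =
      (γ - 1) * (w cMass / pressure γ w) * u cMass * ∑ i, velocity w i * velocity u i := by
    rw [Finset.mul_sum]
    refine Finset.sum_congr rfl fun i _ => ?_
    simp only [entropyVars, velocity]
    field_simp
  have hE : ∀ {z : State d}, z cEnergy =
      pressure γ z / (γ - 1) + z cMass * (∑ i, velocity z i ^ 2) / 2 := by
    intro z
    simp only [pressure]
    field_simp
    ring
  have hsq : 0 ≤ ∑ i, velocity w i ^ 2 + ∑ i, velocity u i ^ 2 -
      2 * ∑ i, velocity w i * velocity u i := by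
    rw [Finset.mul_sum, ← Finset.sum_add_distrib, ← Finset.sum_sub_distrib]
    refine Finset.sum_nonneg fun i _ => ?_
    nlinarith [sq_nonneg (velocity w i - velocity u i)]
  -- The entropy gap is a sum of two logarithms, one of the temperature ratio and one of the density
  -- ratio. Bounding each by log x ≤ x - 1 and keeping the kinetic square `hsq` accounts for the
  -- whole slack in the inequality.
  have hs : thermoEntropy γ s₀ u - thermoEntropy γ s₀ w =
      Real.log ((pressure γ u / pressure γ w) * (w cMass / u cMass)) +
        (γ - 1) * Real.log (w cMass / u cMass) := by
    simp only [thermoEntropy]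
    rw [Real.log_div (by positivity) (by positivity), Real.log_div (by positivity) (by positivity),
      Real.log_mul (by positivity) (by positivity), Real.log_div (by positivity) (by positivity),
      Real.log_div (by positivity) (by positivity), Real.log_rpow hρ, Real.log_rpow hρ']
    ring
  have ha := Real.log_le_sub_one_of_pos (x := (pressure γ u / pressure γ w) * (w cMass / u cMass))
    (by positivity)
  have hb := Real.log_le_sub_one_of_pos (x := w cMass / u cMass) (by positivity)
  have hb' := mul_le_mul_of_nonneg_left hb hg.le
  have key : u cMass * (thermoEntropy γ s₀ u - thermoEntropy γ s₀ w) ≤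
      u cMass * ((pressure γ u / pressure γ w) * (w cMass / u cMass) - 1 +
        (γ - 1) * (w cMass / u cMass - 1)) := by
    rw [hs]
    exact mul_le_mul_of_nonneg_left (by linarith) hρ.le
  have key2 : u cMass * ((pressure γ u / pressure γ w) * (w cMass / u cMass) - 1 +
        (γ - 1) * (w cMass / u cMass - 1)) =
      pressure γ u / pressure γ w * w cMass + (γ - 1) * w cMass - γ * u cMass := by
    field_simp
    ring
  have hpos : 0 ≤ (γ - 1) * (w cMass / pressure γ w) * u cMass / 2 *
      (∑ i, velocity w i ^ 2 + ∑ i, velocity u i ^ 2 -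
      2 * ∑ i, velocity w i * velocity u i) := by positivity
  rw [dotProduct_comp (entropyVars γ s₀ w) u, hm]
  have e1 : entropyVars γ s₀ w cMass = -thermoEntropy γ s₀ w + γ -
      (γ - 1) * (w cMass / pressure γ w) * (∑ i, velocity w i ^ 2) / 2 := by
    simp only [entropyVars]
    rw [hE (z := w)]
    field_simp
    ring
  have e2 : entropyVars γ s₀ w cEnergy * u cEnergy = - (w cMass / pressure γ w * pressure γ u) -
      (γ - 1) * (w cMass / pressure γ w) * u cMass * (∑ i, velocity u i ^ 2) / 2 := by
    simp only [entropyVars]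
    rw [hE (z := u)]
    field_simp
    ring
  rw [e1, e2]
  rw [key2] at key
  simp only [genEntropy]
  have e3 : w cMass / pressure γ w * pressure γ u = pressure γ u / pressure γ w * w cMass := by
    ring
  nlinarith [key, hpos, e3]

/-- The pressure is bounded by an affine function of the state, for every choice of `W`. -/
theorem pressure_le_affine {γ : ℝ} (hγ : 1 < γ) {u : State d} (hρ : 0 < u cMass)
    (W : Fin d → ℝ) :
    pressure γ u ≤ (γ - 1) * (u cEnergy - ∑ i, W i * u (cMom i) + u cMass * (∑ i, W i ^ 2) / 2) := by
  have hg : 0 < γ - 1 := by linarith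
  rw [pressure]
  refine mul_le_mul_of_nonneg_left ?_ hg.le
  have h : ∑ i, W i * u (cMom i) = u cMass * ∑ i, W i * velocity u i := by
    rw [Finset.mul_sum]
    refine Finset.sum_congr rfl fun i _ => ?_
    simp only [velocity]
    field_simp
  have hsq : 0 ≤ ∑ i, W i ^ 2 + ∑ i, velocity u i ^ 2 - 2 * ∑ i, W i * velocity u i := by
    rw [Finset.mul_sum, ← Finset.sum_add_distrib, ← Finset.sum_sub_distrib]
    refine Finset.sum_nonneg fun i _ => ?_
    nlinarith [sq_nonneg (W i - velocity u i)]
  rw [h]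
  nlinarith [mul_nonneg hρ.le hsq]

/-- The bound `pressure_le_affine` is attained at W = V. So the pressure is an infimum of affine
functions, hence concave, which is what makes averages of physical states physical. -/
theorem pressure_eq_affine {γ : ℝ} {u : State d} (hρ : 0 < u cMass) :
    pressure γ u = (γ - 1) * (u cEnergy - ∑ i, velocity u i * u (cMom i) +
      u cMass * (∑ i, velocity u i ^ 2) / 2) := by
  have h : ∑ i, velocity u i * u (cMom i) = u cMass * ∑ i, velocity u i ^ 2 := by
    rw [Finset.mul_sum]
    refine Finset.sum_congr rfl fun i _ => ?_
    simp only [velocity]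
    field_simp
  rw [h, pressure]
  ring

/-! ### Derivatives along curves of entropy variables -/

theorem hasDerivAt_velocityOfEntropyVars {c : ℝ → State d} {c' : State d} {t : ℝ}
    (hc : HasDerivAt c c' t) (hv : c t cEnergy < 0) (i : Fin d) :
    HasDerivAt (fun t => velocityOfEntropyVars (c t) i)
      (-(c' (cMom i) + velocityOfEntropyVars (c t) i * c' cEnergy) / c t cEnergy) t := by
  rw [hasDerivAt_pi] at hc
  have h := ((hc (cMom i)).div (hc cEnergy) hv.ne).neg
  refine h.congr_deriv ?_
  have := hv.ne
  simp only [velocityOfEntropyVars]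
  field_simp
  ring

/-- The potential dual to H has gradient u, as Legendre duality predicts. It is stated along curves,
the form in which it is used in time and along segments. -/
theorem hasDerivAt_densityOfEntropyVars {γ : ℝ} (hγ : 1 < γ) (s₀ : ℝ) {c : ℝ → State d}
    {c' : State d} {t : ℝ} (hc : HasDerivAt c c' t) (hv : c t cEnergy < 0) :
    HasDerivAt (fun t => (γ - 1) * densityOfEntropyVars γ s₀ (c t))
      (consVars γ s₀ (c t) ⬝ᵥ c') t := by
  have hg : 0 < γ - 1 := by linarith
  have hV := fun i => hasDerivAt_velocityOfEntropyVars hc hv i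
  have hc0 := hc
  rw [hasDerivAt_pi] at hc
  have hE := hc cEnergy
  have hsum : HasDerivAt (fun t => ∑ i, velocityOfEntropyVars (c t) i ^ 2)
      (∑ i, 2 * velocityOfEntropyVars (c t) i *
        (-(c' (cMom i) + velocityOfEntropyVars (c t) i * c' cEnergy) / c t cEnergy)) t := by
    refine HasDerivAt.fun_sum fun i _ => ?_
    simpa using (hV i).fun_pow 2
  have hs : HasDerivAt (fun t => thermoEntropyOfEntropyVars γ (c t)) _ t :=
    (((hc cMass).const_sub γ).fun_add ((hE.fun_mul hsum).div_const 2))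
  have hL : HasDerivAt (fun t => 1 / (γ - 1) * (Real.log (γ - 1) -
      Real.log (-c t cEnergy) - (thermoEntropyOfEntropyVars γ (c t) + s₀))) _ t :=
    (((hE.fun_neg.log (by simpa using hv.ne)).const_sub (Real.log (γ - 1))).fun_sub
      (hs.add_const s₀)).const_mul (1 / (γ - 1))
  have hev : ∀ᶠ t' in nhds t, c t' cEnergy < 0 := hE.continuousAt.eventually_lt_const hv
  have hexp := (hL.exp.const_mul (γ - 1)).congr_of_eventuallyEq
    (f₁ := fun t => (γ - 1) * densityOfEntropyVars γ s₀ (c t))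
    (hev.mono fun t' ht' => by
      simp only
      rw [densityOfEntropyVars_eq_exp hγ s₀ ht'])
  refine hexp.congr_deriv ?_
  rw [← densityOfEntropyVars_eq_exp hγ s₀ hv, dotProduct_comp]
  simp only [consVars]
  have h1 : ∑ i, 2 * velocityOfEntropyVars (c t) i *
        (-(c' (cMom i) + velocityOfEntropyVars (c t) i * c' cEnergy) / c t cEnergy) =
      -2 / c t cEnergy * (∑ i, velocityOfEntropyVars (c t) i * c' (cMom i) +
        c' cEnergy * ∑ i, velocityOfEntropyVars (c t) i ^ 2) := by
    rw [Finset.mul_sum, ← Finset.sum_add_distrib, Finset.mul_sum]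
    exact Finset.sum_congr rfl fun i _ => by ring
  have h2 : ∑ i, densityOfEntropyVars γ s₀ (c t) * velocityOfEntropyVars (c t) i * c' (cMom i) =
      densityOfEntropyVars γ s₀ (c t) * ∑ i, velocityOfEntropyVars (c t) i * c' (cMom i) := by
    rw [Finset.mul_sum]
    exact Finset.sum_congr rfl fun i _ => by ring
  rw [h1, h2]
  have := hv.ne
  field_simp
  ring

end GasDynamics

end EntropyHDG

/-! ### Smoothness in entropy variables, flux potential and viscous dissipation -/

namespace EntropyHDG

namespace Gas

variable {d : ℕ} (g : Gas d)

theorem one_lt_γ : 1 < g.γ := (one_lt_div g.cv_pos).2 g.cv_lt_cp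

theorem Xv_eq : g.Xv = {v | v cEnergy < 0} := physicalEntropyStates_eq g.one_lt_γ g.s₀

theorem mem_Xv {v : State d} : v ∈ g.Xv ↔ v cEnergy < 0 := by
  rw [Xv_eq]
  rfl

theorem isOpen_Xv : IsOpen g.Xv := by
  rw [Xv_eq]
  exact isOpen_lt (continuous_apply _) continuous_const

theorem convex_Xv : Convex ℝ g.Xv := by
  rw [Xv_eq]
  exact convex_halfSpace_lt (LinearMap.proj (R := ℝ) (φ := fun _ : Comp d => ℝ) cEnergy).isLinear 0

theorem uOf_mem {v : State d} (hv : v ∈ g.Xv) : g.uOf v ∈ g.Xu :=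
  consVars_mem g.one_lt_γ g.s₀ (g.mem_Xv.1 hv)

theorem vOf_uOf {v : State d} (hv : v ∈ g.Xv) : g.vOf (g.uOf v) = v :=
  entropyVars_consVars g.one_lt_γ g.s₀ (g.mem_Xv.1 hv)

theorem contDiffAt_velocityOfEntropyVars {v : State d} (hv : v cEnergy < 0) (i : Fin d) :
    ContDiffAt ℝ 1 (fun v : State d => velocityOfEntropyVars v i) v := by
  unfold velocityOfEntropyVars
  exact ((contDiff_apply ℝ ℝ _).contDiffAt.div (contDiff_apply ℝ ℝ _).contDiffAt hv.ne).neg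

theorem contDiffAt_densityOfEntropyVars {v : State d} (hv : v cEnergy < 0) :
    ContDiffAt ℝ 1 (fun v : State d => densityOfEntropyVars g.γ g.s₀ v) v := by
  have hE : ContDiffAt ℝ 1 (fun v : State d => v cEnergy) v := (contDiff_apply ℝ ℝ _).contDiffAt
  have h1 : ContDiffAt ℝ 1 (fun v : State d => v cMass) v := (contDiff_apply ℝ ℝ _).contDiffAt
  have hs : ContDiffAt ℝ 1 (fun v : State d => thermoEntropyOfEntropyVars g.γ v) v := by
    unfold thermoEntropyOfEntropyVars
    exact (contDiffAt_const.sub h1).add ((hE.mul (ContDiffAt.sum fun i _ =>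
      (contDiffAt_velocityOfEntropyVars hv i).pow 2)).div_const 2)
  have hL := ((contDiffAt_const (c := 1 / (g.γ - 1))).mul (((contDiffAt_const
    (c := Real.log (g.γ - 1))).sub (hE.neg.log (by simpa using hv.ne))).sub
      (hs.add (contDiffAt_const (c := g.s₀))))).exp
  refine hL.congr_of_eventuallyEq ?_
  have hev : ∀ᶠ v' in nhds v, v' cEnergy < 0 := hE.continuousAt.eventually_lt_const hv
  exact hev.mono fun v' hv' => densityOfEntropyVars_eq_exp g.one_lt_γ g.s₀ hv'

theorem contDiffAt_uOf {v : State d} (hv : v ∈ g.Xv) : ContDiffAt ℝ 1 g.uOf v := by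
  rw [mem_Xv] at hv
  have hE : ContDiffAt ℝ 1 (fun v : State d => v cEnergy) v := (contDiff_apply ℝ ℝ _).contDiffAt
  have hd := g.contDiffAt_densityOfEntropyVars hv
  rw [contDiffAt_pi]
  intro c
  rcases c with c | i | c
  · exact hd
  · exact hd.mul (contDiffAt_velocityOfEntropyVars hv i)
  · exact (hd.div hE.neg (by simpa using hv.ne)).add ((hd.mul (ContDiffAt.sum fun i _ =>
      (contDiffAt_velocityOfEntropyVars hv i).pow 2)).div_const 2)

theorem contDiffAt_velocity {u : State d} (hu : u ∈ g.Xu) (i : Fin d) :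
    ContDiffAt ℝ 1 (fun u : State d => velocity u i) u :=
  (contDiff_apply ℝ ℝ _).contDiffAt.div (contDiff_apply ℝ ℝ _).contDiffAt hu.1.ne'

theorem contDiffAt_pressure {u : State d} (hu : u ∈ g.Xu) :
    ContDiffAt ℝ 1 (pressure g.γ : State d → ℝ) u :=
  contDiffAt_const.mul ((contDiff_apply ℝ ℝ _).contDiffAt.sub
    (((contDiff_apply ℝ ℝ _).contDiffAt.mul (ContDiffAt.sum fun i _ =>
      (g.contDiffAt_velocity hu i).pow 2)).div_const 2))

theorem contDiffAt_temperature {u : State d} (hu : u ∈ g.Xu) :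
    ContDiffAt ℝ 1 g.temperature u :=
  (g.contDiffAt_pressure hu).div ((contDiff_apply ℝ ℝ _).contDiffAt.mul contDiffAt_const)
    (mul_pos hu.1 (sub_pos.2 g.cv_lt_cp)).ne'

theorem contDiffAt_inviscidFlux {u : State d} (hu : u ∈ g.Xu) (c : Comp d) (j : Fin d) :
    ContDiffAt ℝ 1 (fun u => inviscidFlux g.γ u c j) u := by
  have hV := g.contDiffAt_velocity hu
  have hp := g.contDiffAt_pressure hu
  have h1 : ContDiffAt ℝ 1 (fun v : State d => v cMass) u := (contDiff_apply ℝ ℝ _).contDiffAt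
  have hE : ContDiffAt ℝ 1 (fun v : State d => v cEnergy) u := (contDiff_apply ℝ ℝ _).contDiffAt
  rcases c with c | i | c
  · exact h1.mul (hV j)
  · simp only [inviscidFlux, of_apply]
    refine ((h1.mul (hV i)).mul (hV j)).add ?_
    split_ifs
    · exact hp
    · exact contDiffAt_const
  · exact (hV j).mul (hE.add hp)

theorem contDiffAt_F {v : State d} (hv : v ∈ g.Xv) (c : Comp d) (j : Fin d) :
    ContDiffAt ℝ 1 (fun v => g.F v c j) v :=
  ContDiffAt.comp v (g := fun u => inviscidFlux g.γ u c j)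
    (g.contDiffAt_inviscidFlux (g.uOf_mem hv) c j) (g.contDiffAt_uOf hv)

/-- The entropy flux potential `ψ_j = (γ - 1) ρ V_j`, as a function of the entropy variables. -/
noncomputable def fluxPotential (v : State d) (j : Fin d) : ℝ :=
  (g.γ - 1) * densityOfEntropyVars g.γ g.s₀ v * velocityOfEntropyVars v j

theorem contDiffAt_fluxPotential {v : State d} (hv : v ∈ g.Xv) (j : Fin d) :
    ContDiffAt ℝ 1 (fun v => g.fluxPotential v j) v :=
  (contDiffAt_const.mul (g.contDiffAt_densityOfEntropyVars (g.mem_Xv.1 hv))).mul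
    (contDiffAt_velocityOfEntropyVars (g.mem_Xv.1 hv) j)

/-- The potential `ψ_j` is a primitive of the inviscid flux in the entropy variables. -/
theorem hasDerivAt_fluxPotential {c : ℝ → State d} {c' : State d} {t : ℝ}
    (hc : HasDerivAt c c' t) (hv : c t ∈ g.Xv) (j : Fin d) :
    HasDerivAt (fun t => g.fluxPotential (c t) j) (∑ a, c' a * g.F (c t) a j) t := by
  rw [mem_Xv] at hv
  -- Product rule for ((γ - 1)ρ) V_j. The first factor contributes V_j u · c', the convective part
  -- of the flux. Since p = (γ - 1)ρ / (-v_E), the derivative of V_j contributes exactly the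
  -- pressure terms in the momentum and energy rows.
  have h := (hasDerivAt_densityOfEntropyVars g.one_lt_γ g.s₀ hc hv).fun_mul
    (hasDerivAt_velocityOfEntropyVars hc hv j)
  refine h.congr_deriv ?_
  rw [dotProduct_comp, sum_comp]
  simp only [F, inviscidFlux, of_apply, uOf, velocity_consVars g.one_lt_γ _ hv,
    pressure_consVars g.one_lt_γ _ hv, mul_add, Finset.sum_add_distrib, mul_ite, mul_zero,
    Finset.sum_ite_eq', Finset.mem_univ, if_true]
  simp only [consVars]
  have hne := hv.ne
  have h2 : ∑ i, c' (cMom i) * (densityOfEntropyVars g.γ g.s₀ (c t) *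
      velocityOfEntropyVars (c t) i * velocityOfEntropyVars (c t) j) =
      velocityOfEntropyVars (c t) j * ∑ i, densityOfEntropyVars g.γ g.s₀ (c t) *
        velocityOfEntropyVars (c t) i * c' (cMom i) := by
    rw [Finset.mul_sum]
    exact Finset.sum_congr rfl fun i _ => by ring
  rw [h2]
  field_simp
  ring

theorem H_uOf {v : State d} (hv : v ∈ g.Xv) :
    g.H (g.uOf v) = v ⬝ᵥ g.uOf v - (g.γ - 1) * densityOfEntropyVars g.γ g.s₀ v := by
  have h := genEntropy_eq_legendre g.one_lt_γ g.s₀ (g.uOf_mem hv)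
  have h2 : entropyVars g.γ g.s₀ (g.uOf v) = v := g.vOf_uOf hv
  rw [h2] at h
  exact h

theorem contDiffAt_H_uOf {v : State d} (hv : v ∈ g.Xv) :
    ContDiffAt ℝ 1 (fun v => g.H (g.uOf v)) v := by
  have hu := contDiffAt_pi.1 (g.contDiffAt_uOf hv)
  have h : ContDiffAt ℝ 1 (fun v => v ⬝ᵥ g.uOf v -
      (g.γ - 1) * densityOfEntropyVars g.γ g.s₀ v) v :=
    (ContDiffAt.sum fun i _ => (contDiff_apply ℝ ℝ i).contDiffAt.mul (hu i)).sub
      (contDiffAt_const.mul (g.contDiffAt_densityOfEntropyVars (g.mem_Xv.1 hv)))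
  refine h.congr_of_eventuallyEq ?_
  exact (g.isOpen_Xv.eventually_mem hv).mono fun v' hv' => g.H_uOf hv'

/-- `dH = v · du` in the entropy variables. -/
theorem hasDerivAt_H_uOf {c : ℝ → State d} {c' : State d} {t : ℝ}
    (hc : HasDerivAt c c' t) (hv : c t ∈ g.Xv) :
    HasDerivAt (fun t => g.H (g.uOf (c t))) (deriv (fun t => g.uOf (c t)) t ⬝ᵥ c t) t := by
  have hu : HasDerivAt (fun t => g.uOf (c t)) (deriv (fun t => g.uOf (c t)) t) t :=
    DifferentiableAt.hasDerivAt (DifferentiableAt.comp t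
      ((g.contDiffAt_uOf hv).differentiableAt one_ne_zero) hc.differentiableAt)
  have hu' := hasDerivAt_pi.1 hu
  have hc' := hasDerivAt_pi.1 hc
  -- In the Legendre form of H the term c' · u from the product rule is cancelled by the derivative
  -- of the potential, which leaves c · u'.
  have h : HasDerivAt (fun t => c t ⬝ᵥ g.uOf (c t) -
      (g.γ - 1) * densityOfEntropyVars g.γ g.s₀ (c t)) _ t :=
    (HasDerivAt.fun_sum fun i _ => (hc' i).fun_mul (hu' i)).fun_sub
      (hasDerivAt_densityOfEntropyVars g.one_lt_γ g.s₀ hc (g.mem_Xv.1 hv))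
  refine (h.congr_of_eventuallyEq ?_).congr_deriv ?_
  · have := hc.continuousAt.eventually (g.isOpen_Xv.eventually_mem hv)
    exact this.mono fun t' ht' => g.H_uOf ht'
  · simp only [dotProduct, Finset.sum_add_distrib, uOf]
    simp only [mul_comm]
    ring

/-! ### Viscous dissipation -/

/-- With S = D + Dᵀ one has D : S = |S|²/2 ≥ 2 ∑ D_jj² ≥ (2/d) tr², by dropping off-diagonal entries
and Cauchy-Schwarz. This beats the factor 2/3 when d ≤ 3, and it is the only use of the bound on the
dimension. -/
theorem stress_power_nonneg (hd : d ≤ 3) {m b : ℝ} (hm : 0 ≤ m) (hb : 0 ≤ b)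
    (D : Fin d → Fin d → ℝ) :
    0 ≤ ∑ j, ∑ i, D i j * (m * (D i j + D j i - if i = j then 2 / 3 * ∑ k, D k k else 0)
      + if i = j then b * ∑ k, D k k else 0) := by
  set tr := ∑ k, D k k with htr
  have h1 : ∑ j, ∑ i, D i j * (m * (D i j + D j i - if i = j then 2 / 3 * tr else 0)
      + if i = j then b * tr else 0) =
      m * ((∑ j, ∑ i, D i j * (D i j + D j i)) - 2 / 3 * tr ^ 2) + b * tr ^ 2 := by
    have : ∀ i j, D i j * (m * (D i j + D j i - if i = j then 2 / 3 * tr else 0)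
      + if i = j then b * tr else 0) = m * (D i j * (D i j + D j i)) +
        (if i = j then D j j * (b * tr - m * (2 / 3 * tr)) else 0) := by
      intro i j
      split_ifs with h
      · subst h
        ring
      · ring
    simp only [this, Finset.sum_add_distrib, Finset.sum_ite_eq', Finset.mem_univ, if_true,
      ← Finset.mul_sum, ← Finset.sum_mul]
    rw [← htr]
    ring
  have h2 : ∑ j, ∑ i, D i j * (D i j + D j i) =
      ∑ j, ∑ i, (D i j + D j i) ^ 2 / 2 := by
    have hsw : ∑ j, ∑ i, D i j * (D i j + D j i) = ∑ j, ∑ i, D j i * (D i j + D j i) := by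
      rw [Finset.sum_comm]
      exact Finset.sum_congr rfl fun i _ => Finset.sum_congr rfl fun j _ => by ring
    have hadd : ∑ j, ∑ i, (D i j + D j i) ^ 2 / 2 = (∑ j, ∑ i, D i j * (D i j + D j i) +
        ∑ j, ∑ i, D j i * (D i j + D j i)) / 2 := by
      rw [← Finset.sum_add_distrib, Finset.sum_div]
      refine Finset.sum_congr rfl fun j _ => ?_
      rw [← Finset.sum_add_distrib, Finset.sum_div]
      exact Finset.sum_congr rfl fun i _ => by ring
    rw [hadd, ← hsw]
    ring
  have h3 : ∑ j, 2 * D j j ^ 2 ≤ ∑ j, ∑ i, (D i j + D j i) ^ 2 / 2 := by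
    refine Finset.sum_le_sum fun j _ => ?_
    refine le_trans (le_of_eq ?_) (Finset.single_le_sum (f := fun i => (D i j + D j i) ^ 2 / 2)
      (fun i _ => by positivity) (Finset.mem_univ j))
    ring
  have h4 : tr ^ 2 ≤ d * ∑ j, D j j ^ 2 := by
    simpa using sq_sum_le_card_mul_sum_sq (s := Finset.univ) (f := fun k => D k k)
  have h5 : (d : ℝ) * ∑ j, D j j ^ 2 ≤ 3 * ∑ j, D j j ^ 2 :=
    mul_le_mul_of_nonneg_right (by exact_mod_cast hd) (Finset.sum_nonneg fun i _ => sq_nonneg _)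
  rw [← Finset.mul_sum] at h3
  rw [h1, h2]
  have h6 : 0 ≤ (∑ j, ∑ i, (D i j + D j i) ^ 2 / 2) - 2 / 3 * tr ^ 2 := by linarith
  positivity

theorem A0_mul_col (v : State d) (q : Grad d) (j : Fin d) :
    (fun c => (g.A0 v * q) c j) = fderiv ℝ g.uOf v (fun c => q c j) := by
  have h : (fun c => (g.A0 v * q) c j) = g.A0 v *ᵥ (fun c => q c j) := by
    funext c
    simp [Matrix.mul_apply, mulVec, dotProduct]
  rw [h, A0, jacobian, ← Matrix.toLin'_apply, Matrix.toLin'_toMatrix']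
  rfl

theorem hasDerivAt_line (v w : State d) : HasDerivAt (fun t : ℝ => v + t • w) w 0 := by
  simpa using ((hasDerivAt_id (0 : ℝ)).smul_const w).const_add v

/-- Gradients in G are taken through the Jacobian of u(v). Reading them as derivatives along the
line v + t w avoids that Jacobian: velocity and temperature have simple closed forms in v. -/
theorem fderiv_comp_uOf {f : State d → ℝ} {v w : State d} (hv : v ∈ g.Xv)
    (hf : DifferentiableAt ℝ f (g.uOf v)) {f' : ℝ}
    (h : HasDerivAt (fun t : ℝ => f (g.uOf (v + t • w))) f' 0) :
    fderiv ℝ f (g.uOf v) (fderiv ℝ g.uOf v w) = f' := by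
  have h1 : HasFDerivAt g.uOf (fderiv ℝ g.uOf v) (v + (0 : ℝ) • w) := by
    simpa using ((g.contDiffAt_uOf hv).differentiableAt one_ne_zero).hasFDerivAt
  have h2 := h1.comp_hasDerivAt (0 : ℝ) (hasDerivAt_line v w)
  have h3 : HasFDerivAt f (fderiv ℝ f (g.uOf v)) (g.uOf (v + (0 : ℝ) • w)) := by
    simpa using hf.hasFDerivAt
  exact (h3.comp_hasDerivAt (0 : ℝ) h2).unique h

theorem eventually_line_mem {v : State d} (hv : v ∈ g.Xv) (w : State d) :
    ∀ᶠ t : ℝ in nhds 0, v + t • w ∈ g.Xv := by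
  have h := (hasDerivAt_line v w).continuousAt.eventually
    (g.isOpen_Xv.eventually_mem (by simpa using hv))
  exact h

theorem velocityGrad_A0 {v : State d} (hv : v ∈ g.Xv) (q : Grad d) (i j : Fin d) :
    velocityGrad (g.uOf v) (g.A0 v * q) i j =
      -(q (cMom i) j + velocity (g.uOf v) i * q cEnergy j) / v cEnergy := by
  rw [velocityGrad, A0_mul_col]
  refine g.fderiv_comp_uOf hv
    ((g.contDiffAt_velocity (g.uOf_mem hv) i).differentiableAt one_ne_zero) ?_
  have h := hasDerivAt_velocityOfEntropyVars (hasDerivAt_line v (fun c => q c j))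
    (by simpa using g.mem_Xv.1 hv) i
  refine (h.congr_of_eventuallyEq ?_).congr_deriv ?_
  · exact (g.eventually_line_mem hv _).mono fun t ht =>
      velocity_consVars g.one_lt_γ g.s₀ (g.mem_Xv.1 ht) i
  · simp [uOf, velocity_consVars g.one_lt_γ g.s₀ (g.mem_Xv.1 hv) i]

/-- The temperature depends on the energy component alone, so the heat flux involves only the energy
row of q. -/
theorem temperature_uOf {v : State d} (hv : v ∈ g.Xv) :
    g.temperature (g.uOf v) = (g.cv * -v cEnergy)⁻¹ := by
  rw [mem_Xv] at hv
  have h := densityOfEntropyVars_pos g.one_lt_γ g.s₀ hv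
  have h1 : g.γ - 1 = (g.cp - g.cv) / g.cv := by
    rw [γ]
    have := g.cv_pos.ne'
    field_simp
  have h2 : g.cp - g.cv ≠ 0 := (sub_pos.2 g.cv_lt_cp).ne'
  have h3 := g.cv_pos.ne'
  rw [temperature, uOf, pressure_consVars g.one_lt_γ g.s₀ hv, h1]
  simp only [consVars]
  have := hv.ne
  field_simp

theorem temperatureGrad_A0 {v : State d} (hv : v ∈ g.Xv) (q : Grad d) (j : Fin d) :
    g.cv * v cEnergy ^ 2 * g.temperatureGrad (g.uOf v) (g.A0 v * q) j = q cEnergy j := by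
  have hE := g.mem_Xv.1 hv
  have hcv := g.cv_pos
  suffices h : g.temperatureGrad (g.uOf v) (g.A0 v * q) j =
      q cEnergy j / (g.cv * v cEnergy ^ 2) by
    rw [h]
    have := hE.ne
    field_simp
  rw [temperatureGrad, A0_mul_col]
  refine g.fderiv_comp_uOf hv
    ((g.contDiffAt_temperature (g.uOf_mem hv)).differentiableAt one_ne_zero) ?_
  have h := (((hasDerivAt_pi.1 (hasDerivAt_line v (fun c => q c j)) cEnergy).fun_neg).const_mul
    g.cv).fun_inv (by simpa using ⟨hcv.ne', hE.ne⟩)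
  refine (h.congr_of_eventuallyEq ?_).congr_deriv ?_
  · exact (g.eventually_line_mem hv _).mono fun t ht => g.temperature_uOf ht
  · have := hE.ne
    have := hcv.ne'
    simp only [zero_smul, add_zero]
    field_simp

/-- The viscous fluxes dissipate entropy. -/
theorem trace_transpose_mul_G_nonpos (hd : d ≤ 3) {v : State d} (hv : v ∈ g.Xv) (q : Grad d) :
    (qᵀ * g.G v q).trace ≤ 0 := by
  have hE := g.mem_Xv.1 hv
  have hu := g.uOf_mem hv
  set u := g.uOf v with hudef
  set du := g.A0 v * q with hdu
  -- The formula for the velocity gradient is solved for the momentum rows of q, to express the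
  -- power in physical gradients.
  have hmom : ∀ i j, q (cMom i) j =
      -(v cEnergy * velocityGrad u du i j) - velocity u i * q cEnergy j := by
    intro i j
    rw [hudef, hdu, g.velocityGrad_A0 hv]
    have := hE.ne
    field_simp
    ring
  have htemp := g.temperatureGrad_A0 hv q
  -- The work V · τ in the energy flux cancels against the V-dependent part of the momentum rows.
  -- What remains is v_E (∇V : τ), nonpositive as v_E < 0, minus a nonnegative multiple of the
  -- squared temperature gradient.
  have hcol : ∀ j, ∑ c, q c j * g.G v q c j =
      v cEnergy * (∑ i, velocityGrad u du i j * g.stress u du i j) -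
        g.conductivity u * (g.cv * v cEnergy ^ 2) * g.temperatureGrad u du j ^ 2 := by
    intro j
    rw [sum_comp]
    simp only [G, viscousFlux, of_apply, ← hudef, ← hdu, heatFlux]
    have h1 : ∑ i, q (cMom i) j * -g.stress u du i j =
        v cEnergy * (∑ i, velocityGrad u du i j * g.stress u du i j) +
          q cEnergy j * ∑ i, velocity u i * g.stress u du i j := by
      rw [Finset.mul_sum, Finset.mul_sum, ← Finset.sum_add_distrib]
      refine Finset.sum_congr rfl fun i _ => ?_
      rw [hmom]
      ring
    rw [h1, ← htemp j]
    ring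
  have htr : (qᵀ * g.G v q).trace = ∑ j, ∑ c, q c j * g.G v q c j := by
    simp [Matrix.trace, Matrix.mul_apply]
  rw [htr, Finset.sum_congr rfl fun j _ => hcol j, Finset.sum_sub_distrib, ← Finset.mul_sum,
    ← Finset.mul_sum]
  have hS := stress_power_nonneg hd (g.shearVisc_nonneg u hu) (g.bulkVisc_nonneg u hu)
    (velocityGrad u du)
  have hκ : 0 ≤ g.conductivity u * (g.cv * v cEnergy ^ 2) := by
    have := g.shearVisc_nonneg u hu
    have := g.cv_pos
    have := g.cv_lt_cp
    have := g.Pr_pos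
    have : 0 < g.cp := by linarith
    unfold conductivity
    positivity
  have hT : 0 ≤ ∑ j, g.temperatureGrad u du j ^ 2 := Finset.sum_nonneg fun i _ => sq_nonneg _
  have h1 := mul_nonpos_of_nonpos_of_nonneg hE.le hS
  have h2 := mul_nonneg hκ hT
  simp only [stress]
  linarith

end Gas

end EntropyHDG

/-! ### Entropy stability of the inviscid numerical flux -/

namespace EntropyHDG

namespace Gas

variable {d : ℕ} (g : Gas d)

/-! ### Inviscid fluxes in a direction -/

theorem jacobian_apply (f : State d → State d) (x : State d) (a b : Comp d) :
    jacobian f x a b = fderiv ℝ f x (Pi.single b 1) a := by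
  rw [jacobian, LinearMap.toMatrix'_apply]
  congr 2

theorem jacobian_mulVec (f : State d → State d) (x w : State d) :
    jacobian f x *ᵥ w = fderiv ℝ f x w := by
  rw [jacobian, ← Matrix.toLin'_apply, Matrix.toLin'_toMatrix']
  rfl

theorem contDiffAt_inviscidFlux_mulVec {u : State d} (hu : u ∈ g.Xu) (n : Fin d → ℝ) :
    ContDiffAt ℝ 1 (fun u => inviscidFlux g.γ u *ᵥ n) u :=
  contDiffAt_pi.2 fun c => by
    simp only [mulVec, dotProduct]
    exact ContDiffAt.sum fun j _ => (g.contDiffAt_inviscidFlux hu c j).mul contDiffAt_const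

theorem contDiffAt_F_mulVec {v : State d} (hv : v ∈ g.Xv) (n : Fin d → ℝ) :
    ContDiffAt ℝ 1 (fun v => g.F v *ᵥ n) v :=
  contDiffAt_pi.2 fun c => by
    simp only [mulVec, dotProduct]
    exact ContDiffAt.sum fun j _ => (g.contDiffAt_F hv c j).mul contDiffAt_const

/-- Chain rule: Ã_n differentiates v ↦ F(v) · n, and F · n is the gradient of ψ · n. Hence the
quadratic form of Ã_n is the second derivative of ψ · n along a segment. -/
theorem AnTilde_eq_jacobian {v : State d} (hv : v ∈ g.Xv) (n : Pt d) :
    g.AnTilde v n = jacobian (fun v => g.F v *ᵥ n.ofLp) v := by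
  have h : fderiv ℝ (fun v => g.F v *ᵥ n.ofLp) v =
      (fderiv ℝ (fun u => inviscidFlux g.γ u *ᵥ n.ofLp) (g.uOf v)).comp (fderiv ℝ g.uOf v) :=
    fderiv_comp v (g := fun u => inviscidFlux g.γ u *ᵥ n.ofLp)
      ((g.contDiffAt_inviscidFlux_mulVec (g.uOf_mem hv) n.ofLp).differentiableAt one_ne_zero)
      ((g.contDiffAt_uOf hv).differentiableAt one_ne_zero)
  rw [AnTilde, An, A0, jacobian, jacobian, jacobian, h, ← LinearMap.toMatrix'_comp]
  rfl

theorem lineMap_mem {v w : State d} (hv : v ∈ g.Xv) (hw : w ∈ g.Xv) {θ : ℝ}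
    (hθ : θ ∈ Icc (0 : ℝ) 1) : AffineMap.lineMap v w θ ∈ g.Xv :=
  g.convex_Xv.lineMap_mem hv hw hθ

theorem continuousOn_AnTilde_lineMap {v w : State d} (hv : v ∈ g.Xv) (hw : w ∈ g.Xv) (n : Pt d)
    (a b : Comp d) :
    ContinuousOn (fun θ : ℝ => g.AnTilde (AffineMap.lineMap v w θ) n a b) (Icc 0 1) := by
  have h1 : ∀ θ ∈ Icc (0 : ℝ) 1, g.AnTilde (AffineMap.lineMap v w θ) n a b =
      fderiv ℝ (fun v => g.F v *ᵥ n.ofLp) (AffineMap.lineMap v w θ) (Pi.single b 1) a := by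
    intro θ hθ
    rw [g.AnTilde_eq_jacobian (g.lineMap_mem hv hw hθ), jacobian_apply]
  refine ContinuousOn.congr ?_ h1
  intro θ hθ
  have h2 : ContinuousAt (fderiv ℝ (fun v => g.F v *ᵥ n.ofLp)) (AffineMap.lineMap v w θ) :=
    (g.contDiffAt_F_mulVec (g.lineMap_mem hv hw hθ) n.ofLp).continuousAt_fderiv one_ne_zero
  have h3 : ContinuousAt (fun θ : ℝ => fderiv ℝ (fun v => g.F v *ᵥ n.ofLp)
      (AffineMap.lineMap v w θ)) θ :=
    ContinuousAt.comp (f := fun θ : ℝ => (AffineMap.lineMap v w θ : State d)) h2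
      AffineMap.lineMap_continuous.continuousAt
  exact (((continuous_apply a).continuousAt.comp
    (h3.clm_apply continuousAt_const))).continuousWithinAt

/-- Taylor's formula with integral remainder for ψ · n on the segment from v to w, whose first
derivative is (w - v) · F n. -/
theorem integral_AnTilde_quadratic {v w : State d} (hv : v ∈ g.Xv) (hw : w ∈ g.Xv) (n : Pt d) :
    ∫ θ in (0 : ℝ)..1, (1 - θ) *
      ((w - v) ⬝ᵥ (g.AnTilde (AffineMap.lineMap v w θ) n *ᵥ (w - v))) =
    g.fluxPotential w ⬝ᵥ n.ofLp - g.fluxPotential v ⬝ᵥ n.ofLp - (w - v) ⬝ᵥ (g.F v *ᵥ n.ofLp) := by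
  set l : ℝ → State d := fun θ => AffineMap.lineMap v w θ with hl
  have hld : ∀ θ, HasDerivAt l (w - v) θ := fun θ => AffineMap.hasDerivAt_lineMap
  have hlm : ∀ θ ∈ Icc (0 : ℝ) 1, l θ ∈ g.Xv := fun θ hθ => g.lineMap_mem hv hw hθ
  have hφ : ∀ θ ∈ Icc (0 : ℝ) 1, HasDerivAt (fun θ => (w - v) ⬝ᵥ (g.F (l θ) *ᵥ n.ofLp))
      ((w - v) ⬝ᵥ (g.AnTilde (l θ) n *ᵥ (w - v))) θ := by
    intro θ hθ
    rw [g.AnTilde_eq_jacobian (hlm θ hθ), jacobian_mulVec]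
    have h := ((g.contDiffAt_F_mulVec (hlm θ hθ) n.ofLp).differentiableAt
      one_ne_zero).hasFDerivAt.comp_hasDerivAt θ (hld θ)
    exact HasDerivAt.fun_sum fun c _ => (hasDerivAt_pi.1 h c).const_mul _
  have hP : ∀ θ ∈ Icc (0 : ℝ) 1, HasDerivAt (fun θ => g.fluxPotential (l θ) ⬝ᵥ n.ofLp)
      ((w - v) ⬝ᵥ (g.F (l θ) *ᵥ n.ofLp)) θ := by
    intro θ hθ
    have h : HasDerivAt (fun θ => g.fluxPotential (l θ) ⬝ᵥ n.ofLp) _ θ :=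
      HasDerivAt.fun_sum fun j (_ : j ∈ Finset.univ) =>
        (g.hasDerivAt_fluxPotential (hld θ) (hlm θ hθ) j).mul_const (n.ofLp j)
    refine h.congr_deriv ?_
    simp only [dotProduct, mulVec, Finset.mul_sum, Finset.sum_mul]
    rw [Finset.sum_comm]
    exact Finset.sum_congr rfl fun i _ => Finset.sum_congr rfl fun j _ => by ring
  -- An antiderivative of (1 - θ)φ'' is φ + (1 - θ)φ', with φ the restriction of ψ · n to the
  -- segment.
  have hN : ∀ θ ∈ uIcc (0 : ℝ) 1, HasDerivAt (fun θ => g.fluxPotential (l θ) ⬝ᵥ n.ofLp +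
      (1 - θ) * ((w - v) ⬝ᵥ (g.F (l θ) *ᵥ n.ofLp)))
      ((1 - θ) * ((w - v) ⬝ᵥ (g.AnTilde (l θ) n *ᵥ (w - v)))) θ := by
    intro θ hθ
    rw [uIcc_of_le zero_le_one] at hθ
    refine ((hP θ hθ).fun_add (((hasDerivAt_id' θ).const_sub 1).fun_mul (hφ θ hθ))).congr_deriv ?_
    ring
  have hint : ContinuousOn (fun θ : ℝ => (1 - θ) *
      ((w - v) ⬝ᵥ (g.AnTilde (l θ) n *ᵥ (w - v)))) (uIcc 0 1) := by
    rw [uIcc_of_le zero_le_one]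
    refine (by fun_prop : ContinuousOn (fun θ : ℝ => 1 - θ) _).mul ?_
    simp only [mulVec, dotProduct]
    exact continuousOn_finsetSum _ fun a _ => continuousOn_const.mul
      (continuousOn_finsetSum _ fun b _ =>
        (g.continuousOn_AnTilde_lineMap hv hw n a b).mul continuousOn_const)
  rw [intervalIntegral.integral_eq_sub_of_hasDerivAt hN hint.intervalIntegrable]
  simp [hl]
  ring

/-- The difference of the Taylor expansions from the two endpoints. Reversing the segment changes
the sign of v₂ - v₁ but not the quadratic form, so the result is twice the exact integral of F · n
minus the sum of its endpoint values. -/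
theorem quadratic_Sig {v₁ v₂ : State d} (h₁ : v₁ ∈ g.Xv) (h₂ : v₂ ∈ g.Xv) (n : Pt d) :
    (v₂ - v₁) ⬝ᵥ (g.Sig v₁ v₂ n *ᵥ (v₂ - v₁)) =
      2 * (g.fluxPotential v₂ ⬝ᵥ n.ofLp - g.fluxPotential v₁ ⬝ᵥ n.ofLp) -
        (v₂ - v₁) ⬝ᵥ ((g.F v₁ + g.F v₂) *ᵥ n.ofLp) := by
  have hc : ∀ a b, ContinuousOn (fun θ : ℝ => (1 - θ) *
      (g.AnTilde (AffineMap.lineMap v₁ v₂ θ) n a b -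
        g.AnTilde (AffineMap.lineMap v₂ v₁ θ) n a b)) (uIcc 0 1) := by
    intro a b
    rw [uIcc_of_le zero_le_one]
    exact (by fun_prop : ContinuousOn (fun θ : ℝ => 1 - θ) _).mul
      ((g.continuousOn_AnTilde_lineMap h₁ h₂ n a b).sub
        (g.continuousOn_AnTilde_lineMap h₂ h₁ n a b))
  have hq : ∀ v ∈ g.Xv, ∀ w ∈ g.Xv, IntervalIntegrable (fun θ : ℝ => (1 - θ) *
      ((w - v) ⬝ᵥ (g.AnTilde (AffineMap.lineMap v w θ) n *ᵥ (w - v)))) volume 0 1 := by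
    intro v hv w hw
    refine ContinuousOn.intervalIntegrable ?_
    rw [uIcc_of_le zero_le_one]
    refine (by fun_prop : ContinuousOn (fun θ : ℝ => 1 - θ) _).mul ?_
    simp only [mulVec, dotProduct]
    exact continuousOn_finsetSum _ fun a _ => continuousOn_const.mul
      (continuousOn_finsetSum _ fun b _ =>
        (g.continuousOn_AnTilde_lineMap hv hw n a b).mul continuousOn_const)
  have e1 : (v₂ - v₁) ⬝ᵥ (g.Sig v₁ v₂ n *ᵥ (v₂ - v₁)) =
      ∫ θ in (0 : ℝ)..1, ∑ a, (v₂ - v₁) a * ∑ b, (1 - θ) *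
      (g.AnTilde (AffineMap.lineMap v₁ v₂ θ) n a b -
        g.AnTilde (AffineMap.lineMap v₂ v₁ θ) n a b) * (v₂ - v₁) b := by
    rw [intervalIntegral.integral_finsetSum]
    · refine Finset.sum_congr rfl fun a _ => ?_
      rw [intervalIntegral.integral_const_mul, intervalIntegral.integral_finsetSum]
      · simp only [mulVec, dotProduct, Sig, of_apply, intervalIntegral.integral_mul_const]
      · exact fun b _ => ((hc a b).mul continuousOn_const).intervalIntegrable
    · exact fun a _ => (continuousOn_const.mul (continuousOn_finsetSum _ fun b _ =>
        (hc a b).mul continuousOn_const)).intervalIntegrable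
  have e2 : (v₂ - v₁) ⬝ᵥ (g.Sig v₁ v₂ n *ᵥ (v₂ - v₁)) =
      (∫ θ in (0 : ℝ)..1, (1 - θ) *
        ((v₂ - v₁) ⬝ᵥ (g.AnTilde (AffineMap.lineMap v₁ v₂ θ) n *ᵥ (v₂ - v₁)))) -
      ∫ θ in (0 : ℝ)..1, (1 - θ) *
        ((v₁ - v₂) ⬝ᵥ (g.AnTilde (AffineMap.lineMap v₂ v₁ θ) n *ᵥ (v₁ - v₂))) := by
    rw [e1, ← intervalIntegral.integral_sub (hq v₁ h₁ v₂ h₂) (hq v₂ h₂ v₁ h₁)]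
    refine intervalIntegral.integral_congr fun θ _ => ?_
    simp only [mulVec, dotProduct, Pi.sub_apply, Finset.mul_sum]
    rw [← Finset.sum_sub_distrib]
    refine Finset.sum_congr rfl fun a _ => ?_
    rw [← Finset.sum_sub_distrib]
    exact Finset.sum_congr rfl fun b _ => by ring
  rw [e2, g.integral_AnTilde_quadratic h₁ h₂, g.integral_AnTilde_quadratic h₂ h₁,
    ← neg_sub v₂ v₁, neg_dotProduct, add_mulVec, dotProduct_add]
  ring

/-- Entropy stability of the inviscid numerical flux. -/
theorem fluxPotential_sub_le
    {σ : State d → State d → Pt d → Matrix (Comp d) (Comp d) ℝ} (hσ : g.EntropyStableStab σ)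
    {v₁ v₂ : State d} (h₁ : v₁ ∈ g.Xv) (h₂ : v₂ ∈ g.Xv) {n : Pt d} (hn : ‖n‖ = 1) :
    g.fluxPotential v₂ ⬝ᵥ n.ofLp - g.fluxPotential v₁ ⬝ᵥ n.ofLp ≤
      (v₂ - v₁) ⬝ᵥ g.inviscidNumFlux σ v₁ v₂ n := by
  -- The trapezoidal part of `quadratic_Sig` is the central part of the numerical flux, so only the
  -- stabilization term is left to compare.
  have h := hσ v₁ h₁ v₂ h₂ n hn
  rw [g.quadratic_Sig h₁ h₂] at h
  rw [inviscidNumFlux, dotProduct_add, dotProduct_smul, dotProduct_smul, smul_eq_mul, smul_eq_mul]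
  linarith

/-! ### Continuity of the fluxes along fields -/

variable {X : Type*} [TopologicalSpace X] {S : Set X} {v : X → State d}

theorem continuousOn_uOf (hv : ∀ x ∈ S, v x ∈ g.Xv) (hvc : ContinuousOn v S) :
    ContinuousOn (fun x => g.uOf (v x)) S := fun x hx =>
  ContinuousAt.comp_continuousWithinAt (g.contDiffAt_uOf (hv x hx)).continuousAt (hvc x hx)

theorem continuousOn_H_uOf (hv : ∀ x ∈ S, v x ∈ g.Xv) (hvc : ContinuousOn v S) :
    ContinuousOn (fun x => g.H (g.uOf (v x))) S := fun x hx =>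
  ContinuousAt.comp_continuousWithinAt (g := fun v => g.H (g.uOf v))
    (g.contDiffAt_H_uOf (hv x hx)).continuousAt (hvc x hx)

theorem continuousOn_F (hv : ∀ x ∈ S, v x ∈ g.Xv) (hvc : ContinuousOn v S) (c : Comp d)
    (j : Fin d) : ContinuousOn (fun x => g.F (v x) c j) S := fun x hx =>
  ContinuousAt.comp_continuousWithinAt (g := fun v => g.F v c j)
    (g.contDiffAt_F (hv x hx) c j).continuousAt (hvc x hx)

theorem continuousOn_fluxPotential (hv : ∀ x ∈ S, v x ∈ g.Xv) (hvc : ContinuousOn v S)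
    (j : Fin d) : ContinuousOn (fun x => g.fluxPotential (v x) j) S := fun x hx =>
  ContinuousAt.comp_continuousWithinAt (g := fun v => g.fluxPotential v j)
    (g.contDiffAt_fluxPotential (hv x hx) j).continuousAt (hvc x hx)

/-- Needed for the projection of G to exist. The viscosities are merely continuous and the gradients
in G are derivatives taken at moving points. Replacing these by their closed forms in v and q makes
continuity visible without any regularity of the Jacobian. -/
theorem continuousOn_G (hv : ∀ x ∈ S, v x ∈ g.Xv) (hvc : ContinuousOn v S) {q : X → Grad d}
    (hq : ∀ c j, ContinuousOn (fun x => q x c j) S) (c : Comp d) (j : Fin d) :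
    ContinuousOn (fun x => g.G (v x) (q x) c j) S := by
  have hu := g.continuousOn_uOf hv hvc
  have hum : MapsTo (fun x => g.uOf (v x)) S g.Xu := fun x hx => g.uOf_mem (hv x hx)
  have hE : ContinuousOn (fun x => v x cEnergy) S := continuousOn_pi.1 hvc _
  have hE0 : ∀ x ∈ S, v x cEnergy ≠ 0 := fun x hx => (g.mem_Xv.1 (hv x hx)).ne
  have hmu := g.shearVisc_cont.comp hu hum
  have hbe := g.bulkVisc_cont.comp hu hum
  have hV : ∀ i, ContinuousOn (fun x => velocity (g.uOf (v x)) i) S := fun i x hx =>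
    ContinuousAt.comp_continuousWithinAt (g := fun u => velocity u i)
      (g.contDiffAt_velocity (hum hx) i).continuousAt (hu x hx)
  have hD : ∀ i j, ContinuousOn (fun x => velocityGrad (g.uOf (v x)) (g.A0 (v x) * q x) i j) S := by
    intro i j
    refine ContinuousOn.congr (f := fun x => -(q x (cMom i) j +
      velocity (g.uOf (v x)) i * q x cEnergy j) / v x cEnergy) ?_
      fun x hx => g.velocityGrad_A0 (hv x hx) (q x) i j
    exact (((hq _ _).add ((hV i).mul (hq _ _))).neg).div hE hE0
  have hT : ContinuousOn (fun x => g.temperatureGrad (g.uOf (v x)) (g.A0 (v x) * q x) j) S := by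
    refine ContinuousOn.congr (f := fun x => q x cEnergy j / (g.cv * v x cEnergy ^ 2)) ?_ ?_
    · exact (hq _ _).div (continuousOn_const.mul (hE.pow 2)) fun x hx =>
        mul_ne_zero g.cv_pos.ne' (pow_ne_zero _ (hE0 x hx))
    · intro x hx
      simp only
      rw [← g.temperatureGrad_A0 (hv x hx) (q x) j]
      have := hE0 x hx
      have := g.cv_pos.ne'
      field_simp
  have hS : ∀ i j, ContinuousOn (fun x => g.stress (g.uOf (v x)) (g.A0 (v x) * q x) i j) S := by
    intro i j
    have htr : ContinuousOn
        (fun x => ∑ k, velocityGrad (g.uOf (v x)) (g.A0 (v x) * q x) k k) S :=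
      continuousOn_finsetSum _ fun k _ => hD k k
    unfold stress
    refine (hmu.mul (((hD i j).add (hD j i)).sub ?_)).add ?_
    · split_ifs
      · exact continuousOn_const.mul htr
      · exact continuousOn_const
    · split_ifs
      · exact hbe.mul htr
      · exact continuousOn_const
  rcases c with c | i | c
  · exact continuousOn_const
  · exact (hS i j).neg
  · refine ContinuousOn.neg (ContinuousOn.sub (continuousOn_finsetSum _ fun i _ =>
      (hV i).mul (hS i j)) ?_)
    exact (((continuousOn_const.mul hmu).div_const g.Pr).mul hT).neg

end Gas

end EntropyHDG

/-! ### Polynomial spaces, projection and interpolation -/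

namespace EntropyHDG

section Polynomials

variable {d : ℕ}

theorem totalDegree_pderiv_le (i : Fin d) (P : MvPolynomial (Fin d) ℝ) :
    (MvPolynomial.pderiv i P).totalDegree ≤ P.totalDegree := by
  refine Finset.sup_le fun m hm => ?_
  have h : m + Finsupp.single i 1 ∈ P.support := by
    rw [MvPolynomial.mem_support_iff, MvPolynomial.coeff_pderiv] at hm
    exact MvPolynomial.mem_support_iff.2 (left_ne_zero_of_mul hm)
  refine le_trans ?_ (MvPolynomial.le_totalDegree h)
  rw [Finsupp.sum_add_index' (fun _ => rfl) fun _ _ _ => rfl]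
  exact Nat.le_add_right _ _

theorem hasDerivAt_eval_line (P : MvPolynomial (Fin d) ℝ) (x e : Fin d → ℝ) :
    HasDerivAt (fun t : ℝ => MvPolynomial.eval (x + t • e) P)
      (∑ i, e i * MvPolynomial.eval x (MvPolynomial.pderiv i P)) 0 := by
  induction P using MvPolynomial.induction_on with
  | C a => simpa using hasDerivAt_const (0 : ℝ) a
  | add p q hp hq => simpa [mul_add, Finset.sum_add_distrib] using hp.fun_add hq
  | mul_X p n hp =>
    have hX : HasDerivAt (fun t : ℝ => (x + t • e) n) (e n) 0 := by
      simpa using ((hasDerivAt_id (0 : ℝ)).mul_const (e n)).const_add (x n)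
    have h := hp.fun_mul hX
    simp only [map_mul, MvPolynomial.eval_X]
    refine h.congr_deriv ?_
    simp only [zero_smul, add_zero, MvPolynomial.pderiv_mul, map_add, map_mul,
      MvPolynomial.eval_X, mul_add, Finset.sum_add_distrib, Finset.sum_mul]
    refine congrArg₂ (· + ·) (Finset.sum_congr rfl fun i _ => by ring) ?_
    rw [Finset.sum_eq_single n]
    · simp
      ring
    · intro i _ hi
      rw [MvPolynomial.pderiv_X_of_ne hi.symm]
      simp
    · simp

/-- Polynomials of degree at most `k` in the coordinates given by an affine chart `A`. -/
noncomputable def polySpace (k : ℕ) (A : Pt d ≃ᵃ[ℝ] Pt d) : Submodule ℝ (Pt d → ℝ) :=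
  (MvPolynomial.restrictTotalDegree (Fin d) ℝ k).map
    (LinearMap.pi fun x => (MvPolynomial.aeval (A.symm x).ofLp).toLinearMap)

variable {k : ℕ} {A : Pt d ≃ᵃ[ℝ] Pt d}

instance : FiniteDimensional ℝ (polySpace k A) := Module.Finite.map _ _

theorem mem_polySpace {f : Pt d → ℝ} :
    f ∈ polySpace k A ↔ IsPolyFun k (fun y => f (A y)) := by
  simp only [polySpace, Submodule.mem_map, MvPolynomial.mem_restrictTotalDegree, IsPolyFun]
  constructor
  · rintro ⟨P, hP, rfl⟩
    exact ⟨P, hP, fun x => by simp [MvPolynomial.aeval_eq_eval]⟩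
  · rintro ⟨P, hP, h⟩
    refine ⟨P, hP, funext fun x => ?_⟩
    have := h (A.symm x)
    rw [A.apply_symm_apply] at this
    simp [this, MvPolynomial.aeval_eq_eval]

theorem const_mem_polySpace (c : ℝ) : (fun _ => c) ∈ polySpace k A :=
  mem_polySpace.2 ⟨MvPolynomial.C c, by simp, by simp⟩

theorem isPolyFun_analyticOnNhd {f : Pt d → ℝ} (hf : IsPolyFun k f) :
    AnalyticOnNhd ℝ f univ := by
  obtain ⟨P, -, h⟩ := hf
  have h2 : AnalyticOnNhd ℝ (fun x : Pt d => MvPolynomial.aeval (x.ofLp) P) univ := by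
    refine AnalyticOnNhd.aeval_mvPolynomial (f := fun x : Pt d => x.ofLp) (fun i => ?_) P
    exact (EuclideanSpace.proj (𝕜 := ℝ) i : Pt d →L[ℝ] ℝ).analyticOnNhd univ
  convert h2 using 1
  funext x
  simp [h, MvPolynomial.aeval_eq_eval]

theorem affineEquiv_eq (B : Pt d ≃ᵃ[ℝ] Pt d) : (B : Pt d → Pt d) =
    fun x => (LinearMap.toContinuousLinearMap (B.linear : Pt d →ₗ[ℝ] Pt d)) x + B 0 := by
  funext x
  exact congrFun (AffineMap.decomp B.toAffineMap) x

theorem affineEquiv_hasFDerivAt (B : Pt d ≃ᵃ[ℝ] Pt d) (x : Pt d) :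
    HasFDerivAt B (LinearMap.toContinuousLinearMap (B.linear : Pt d →ₗ[ℝ] Pt d)) x := by
  rw [affineEquiv_eq B]
  exact (ContinuousLinearMap.hasFDerivAt _).add_const _

theorem affineEquiv_analyticOnNhd (B : Pt d ≃ᵃ[ℝ] Pt d) : AnalyticOnNhd ℝ B univ := by
  rw [affineEquiv_eq B]
  exact (ContinuousLinearMap.analyticOnNhd _ _).add analyticOnNhd_const

theorem analyticOnNhd_of_mem_polySpace {f : Pt d → ℝ} (hf : f ∈ polySpace k A) :
    AnalyticOnNhd ℝ f univ := by
  have h1 := isPolyFun_analyticOnNhd (mem_polySpace.1 hf)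
  have h2 := h1.comp (affineEquiv_analyticOnNhd A.symm) (mapsTo_univ _ _)
  convert h2 using 1
  funext x
  simp

theorem contDiff_of_mem_polySpace {f : Pt d → ℝ} (hf : f ∈ polySpace k A) : ContDiff ℝ 1 f :=
  (analyticOnNhd_of_mem_polySpace hf).contDiff

theorem isPolyFun_contDiff {f : Pt d → ℝ} (hf : IsPolyFun k f) : ContDiff ℝ 1 f :=
  (isPolyFun_analyticOnNhd hf).contDiff

/-- Identity theorem for analytic functions. It justifies treating polynomials on an element as
functions on the whole space: their values on the element determine them. -/
theorem eq_zero_of_mem_polySpace {f : Pt d → ℝ} (hf : f ∈ polySpace k A) {K : Set (Pt d)}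
    (hK : (interior K).Nonempty) (h : ∀ x ∈ K, f x = 0) : f = 0 := by
  obtain ⟨z, hz⟩ := hK
  refine (analyticOnNhd_of_mem_polySpace hf).eq_of_eventuallyEq (z₀ := z) analyticOnNhd_const ?_
  filter_upwards [mem_interior_iff_mem_nhds.1 hz] with x hx
  exact h x hx

theorem isPolyFun_fderiv {f : Pt d → ℝ} (hf : IsPolyFun k f) (e : Pt d) :
    IsPolyFun k (fun x => fderiv ℝ f x e) := by
  have hd := (isPolyFun_contDiff hf).differentiable one_ne_zero
  obtain ⟨P, hP, h⟩ := hf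
  refine ⟨∑ i, MvPolynomial.C (e i) * MvPolynomial.pderiv i P, ?_, fun x => ?_⟩
  · refine MvPolynomial.totalDegree_finsetSum_le fun i _ => ?_
    refine (MvPolynomial.totalDegree_mul _ _).trans ?_
    rw [MvPolynomial.totalDegree_C, zero_add]
    exact (totalDegree_pderiv_le i P).trans hP
  · have hl : HasDerivAt (fun t : ℝ => x + t • e) e 0 := by
      simpa using ((hasDerivAt_id (0 : ℝ)).smul_const e).const_add x
    have h1 : HasFDerivAt f (fderiv ℝ f x) (x + (0 : ℝ) • e) := by
      simpa using (hd x).hasFDerivAt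
    have h2 := h1.comp_hasDerivAt (0 : ℝ) hl
    have h3 : (f ∘ fun t : ℝ => x + t • e) =
        fun t : ℝ => MvPolynomial.eval (x.ofLp + t • e.ofLp) P := by
      funext t
      simp [h]
    rw [h3] at h2
    simp [h2.unique (hasDerivAt_eval_line P x.ofLp e.ofLp)]

/-- In the chart, differentiation along e becomes differentiation along the constant vector A⁻¹e,
since A is affine. Non-curved elements are what keep gradients inside the polynomial space. -/
theorem fderiv_mem_polySpace {f : Pt d → ℝ} (hf : f ∈ polySpace k A) (e : Pt d) :
    (fun x => fderiv ℝ f x e) ∈ polySpace k A := by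
  rw [mem_polySpace]
  have hd := (contDiff_of_mem_polySpace hf).differentiable one_ne_zero
  have h := isPolyFun_fderiv (mem_polySpace.1 hf) (A.symm.linear e)
  convert h using 2 with y
  have h2 : fderiv ℝ (fun y => f (A y)) y = _ :=
    ((hd (A y)).hasFDerivAt.comp y (affineEquiv_hasFDerivAt A y)).fderiv
  rw [h2]
  simp

/-! ### Projections and interpolation in finite dimensional spaces of continuous functions -/

variable {W : Submodule ℝ (Pt d → ℝ)} [FiniteDimensional ℝ W] {K : Set (Pt d)}

/-- Existence of the `L²(K)` projection onto a finite dimensional space of continuous functions. -/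
theorem exists_L2_projection (hW : ∀ f ∈ W, Continuous f)
    (hW0 : ∀ f ∈ W, (∀ x ∈ K, f x = 0) → f = 0) (hK : IsCompact K)
    (hKi : K ⊆ closure (interior K)) {a : Pt d → ℝ} (ha : ContinuousOn a K) :
    ∃ p ∈ W, ∀ r ∈ W, ∫ x in K, p x * r x = ∫ x in K, a x * r x := by
  have hint : ∀ {f : Pt d → ℝ}, ContinuousOn f K → ∀ r ∈ W,
      IntegrableOn (fun x => f x * r x) K := fun hf r hr =>
    (hf.mul (hW r hr).continuousOn).integrableOn_compact hK
  let B : W →ₗ[ℝ] Module.Dual ℝ W := LinearMap.mk₂ ℝ (fun p r : W => ∫ x in K, p.1 x * r.1 x)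
    (fun p p' r => by
      simp only [Submodule.coe_add, Pi.add_apply, add_mul]
      exact integral_add (hint (hW _ p.2).continuousOn _ r.2)
        (hint (hW _ p'.2).continuousOn _ r.2))
    (fun c p r => by
      simp only [Submodule.coe_smul, Pi.smul_apply, smul_eq_mul, mul_assoc]
      exact integral_const_mul _ _)
    (fun p r r' => by
      simp only [Submodule.coe_add, Pi.add_apply, mul_add]
      exact integral_add (hint (hW _ p.2).continuousOn _ r.2)
        (hint (hW _ p.2).continuousOn _ r'.2))
    (fun c p r => by
      simp only [Submodule.coe_smul, Pi.smul_apply, smul_eq_mul, mul_left_comm]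
      exact integral_const_mul _ _)
  let φ : Module.Dual ℝ W :=
    { toFun := fun r => ∫ x in K, a x * r.1 x
      map_add' := fun r r' => by
        simp only [Submodule.coe_add, Pi.add_apply, mul_add]
        exact integral_add (hint ha _ r.2) (hint ha _ r'.2)
      map_smul' := fun c r => by
        simp only [Submodule.coe_smul, Pi.smul_apply, smul_eq_mul, mul_left_comm, RingHom.id_apply]
        exact integral_const_mul _ _ }
  -- The Gram form is definite: ∫ p² = 0 forces p to vanish almost everywhere on K, hence on K by
  -- continuity, hence identically. Equality of dimensions with the dual then turns injectivity into
  -- existence.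
  have hinj : Function.Injective B := by
    rw [injective_iff_map_eq_zero]
    intro p hp
    have h0 : ∫ x in K, p.1 x * p.1 x = 0 := by
      have := LinearMap.congr_fun hp p
      simpa [B] using this
    have hp2 : IntegrableOn (fun x => p.1 x * p.1 x) K := hint (hW _ p.2).continuousOn _ p.2
    rw [setIntegral_eq_zero_iff_of_nonneg_ae
      (Filter.Eventually.of_forall fun x => mul_self_nonneg _) hp2] at h0
    have h1 := Measure.eqOn_of_ae_eq h0 ((hW _ p.2).mul (hW _ p.2)).continuousOn
      continuousOn_const hKi
    exact Subtype.ext (hW0 _ p.2 fun x hx => mul_self_eq_zero.1 (h1 hx))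
  have hfr : Module.finrank ℝ W = Module.finrank ℝ (Module.Dual ℝ W) :=
    Subspace.dual_finrank_eq.symm
  obtain ⟨p, hp⟩ := (LinearMap.injective_iff_surjective_of_finrank_eq_finrank hfr).1 hinj φ
  exact ⟨p.1, p.2, fun r hr => LinearMap.congr_fun hp ⟨r, hr⟩⟩

/-- A finite dimensional space of functions determined by their values on `K` has a basis whose
coordinate functionals are combinations of evaluations at points of `K`. -/
theorem exists_interpolation (hW0 : ∀ f ∈ W, (∀ x ∈ K, f x = 0) → f = 0) :
    ∃ (N : ℕ) (b : Fin N → Pt d → ℝ) (Λ : Fin N → Module.Dual ℝ (Pt d → ℝ)),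
      (∀ l, b l ∈ W) ∧ (∀ l, Λ l ∈ Submodule.span ℝ (range fun x : K => LinearMap.proj x.1)) ∧
      ∀ f ∈ W, f = ∑ l, Λ l f • b l := by
  set E : Submodule ℝ (Module.Dual ℝ (Pt d → ℝ)) :=
    Submodule.span ℝ (range fun x : K => LinearMap.proj x.1) with hE
  -- Evaluations at points of K, restricted to W, have zero common kernel by `hW0`. In finite
  -- dimension they therefore span the dual of W.
  have htop : E.map (LinearMap.dualMap W.subtype) = ⊤ := by
    have hco : (E.map (LinearMap.dualMap W.subtype)).dualCoannihilator = ⊥ := by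
      rw [Submodule.eq_bot_iff]
      intro f hf
      rw [Submodule.mem_dualCoannihilator] at hf
      refine Subtype.ext (hW0 _ f.2 fun x hx => ?_)
      exact hf _ (Submodule.mem_map_of_mem (Submodule.subset_span ⟨⟨x, hx⟩, rfl⟩))
    have := Subspace.dualCoannihilator_dualAnnihilator_eq
      (W := E.map (LinearMap.dualMap W.subtype))
    rw [← this, hco, Submodule.dualAnnihilator_bot]
  let b := Module.finBasis ℝ W
  have hΛ : ∀ l, ∃ Λ ∈ E, LinearMap.dualMap W.subtype Λ = b.coord l := by
    intro l
    have : b.coord l ∈ E.map (LinearMap.dualMap W.subtype) := by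
      rw [htop]
      trivial
    exact this
  choose Λ hΛE hΛb using hΛ
  refine ⟨_, fun l => (b l).1, Λ, fun l => (b l).2, hΛE, fun f hf => ?_⟩
  have h1 := b.sum_repr ⟨f, hf⟩
  have h2 : ∀ l, Λ l f = b.repr ⟨f, hf⟩ l := fun l => LinearMap.congr_fun (hΛb l) ⟨f, hf⟩
  simp only [h2]
  have h3 := congrArg W.subtype h1
  rw [map_sum] at h3
  exact h3.symm

end Polynomials

end EntropyHDG

/-! ### Differentiation under the integral in time -/

namespace EntropyHDG

section TimeDerivative

variable {d : ℕ} {K : Set (Pt d)} {U : Set (State d)} {G : State d → ℝ}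

/-- Membership in U and the derivative bound are open conditions at each x. Compactness of K makes
them hold on one neighbourhood of z₀ for all x at once, and dominated differentiation applies. -/
theorem hasFDerivAt_integral_comp {Z : Type*} [NormedAddCommGroup Z] [NormedSpace ℝ Z]
    (hK : IsCompact K) {L : Pt d → Z →L[ℝ] State d} (hL : Continuous L) (hU : IsOpen U)
    (hG : ∀ v ∈ U, ContDiffAt ℝ 1 G v) {z₀ : Z} (hz : ∀ x ∈ K, L x z₀ ∈ U) :
    HasFDerivAt (fun z => ∫ x in K, G (L x z))
      (∫ x in K, (fderiv ℝ G (L x z₀)).comp (L x)) z₀ ∧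
    IntegrableOn (fun x => (fderiv ℝ G (L x z₀)).comp (L x)) K := by
  have hLj : Continuous fun p : Z × Pt d => L p.2 p.1 := (hL.comp continuous_snd).clm_apply
    continuous_fst
  have hUev : ∀ᶠ z in nhds z₀, ∀ x ∈ K, L x z ∈ U :=
    hK.eventually_forall_of_forall_eventually fun x hx =>
      hLj.continuousAt.eventually (hU.eventually_mem (hz x hx))
  have hF'c : ∀ x ∈ K, ContinuousAt
      (fun p : Z × Pt d => (fderiv ℝ G (L p.2 p.1)).comp (L p.2)) (z₀, x) := by
    intro x hx
    have h1 : ContinuousAt (fun p : Z × Pt d => fderiv ℝ G (L p.2 p.1)) (z₀, x) :=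
      ContinuousAt.comp (f := fun p : Z × Pt d => L p.2 p.1)
        ((hG _ (hz x hx)).continuousAt_fderiv one_ne_zero) hLj.continuousAt
    exact h1.clm_comp (hL.comp continuous_snd).continuousAt
  have hF'0 : ContinuousOn (fun x => (fderiv ℝ G (L x z₀)).comp (L x)) K := fun x hx =>
    (ContinuousAt.comp (f := fun x : Pt d => (z₀, x)) (hF'c x hx)
      (by fun_prop)).continuousWithinAt
  -- C bounds the derivative at z₀. The margin 1 makes the bound strict, so that it persists for
  -- nearby parameters.
  obtain ⟨C, hC⟩ := hK.exists_bound_of_continuousOn hF'0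
  have hbound : ∀ᶠ z in nhds z₀, ∀ x ∈ K, ‖(fderiv ℝ G (L x z)).comp (L x)‖ < C + 1 :=
    hK.eventually_forall_of_forall_eventually fun x hx =>
      (hF'c x hx).norm.eventually_lt_const ((hC x hx).trans_lt (lt_add_one C))
  have hcont : ∀ {z : Z}, (∀ x ∈ K, L x z ∈ U) → ContinuousOn (fun x => G (L x z)) K :=
    fun {z} hz x hx => (ContinuousAt.comp (f := fun x => L x z) (hG _ (hz x hx)).continuousAt
      (hL.clm_apply continuous_const).continuousAt).continuousWithinAt
  refine ⟨?_, hF'0.integrableOn_compact hK⟩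
  refine hasFDerivAt_integral_of_dominated_of_fderiv_le (bound := fun _ => C + 1)
    (F' := fun z x => (fderiv ℝ G (L x z)).comp (L x)) (hUev.and hbound) ?_
    ((hcont hz).integrableOn_compact hK) (hF'0.integrableOn_compact hK).aestronglyMeasurable
    ?_ (integrableOn_const hK.measure_lt_top.ne) ?_
  · exact hUev.mono fun z hz' => ((hcont hz').integrableOn_compact hK).aestronglyMeasurable
  · filter_upwards [ae_restrict_mem hK.measurableSet] with x hx z hz'
    exact (hz'.2 x hx).le
  · filter_upwards [ae_restrict_mem hK.measurableSet] with x hx z hz'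
    exact ((hG _ (hz'.1 x hx)).differentiableAt one_ne_zero).hasFDerivAt.comp z
      (L x).hasFDerivAt

/-- Transfers continuity or differentiability in time from point values to polynomial coefficients,
which are finite combinations of point values. -/
theorem span_eval_induction {Λ : Module.Dual ℝ (Pt d → ℝ)}
    (hΛ : Λ ∈ Submodule.span ℝ (range fun x : K => LinearMap.proj x.1))
    {p : (ℝ → ℝ) → Prop} (h0 : p fun _ => 0) (hadd : ∀ f g, p f → p g → p fun t => f t + g t)
    (hmul : ∀ (c : ℝ) f, p f → p fun t => c * f t) {u : ℝ → Pt d → ℝ}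
    (hu : ∀ x ∈ K, p fun t => u t x) : p fun t => Λ (u t) := by
  induction hΛ using Submodule.span_induction with
  | mem Λ h =>
    obtain ⟨x, rfl⟩ := h
    exact hu x.1 x.2
  | zero => exact h0
  | add Λ Λ' _ _ h h' => exact hadd _ _ h h'
  | smul c Λ _ h => exact hmul c _ h

/-- Differentiation in time of integrals of nonlinear functions of a field that moves in a finite
dimensional space and is differentiable in time at every point. -/
theorem hasDerivAt_integral_field {W : Submodule ℝ (Pt d → ℝ)} [FiniteDimensional ℝ W]
    (hW : ∀ f ∈ W, Continuous f) (hW0 : ∀ f ∈ W, (∀ x ∈ K, f x = 0) → f = 0) (hK : IsCompact K)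
    (hU : IsOpen U) (hG : ∀ v ∈ U, ContDiffAt ℝ 1 G v) {tf : ℝ} {v : ℝ → Pt d → State d}
    (hv : ∀ t ∈ Icc 0 tf, ∀ c, (fun x => v t x c) ∈ W)
    (hvc : ∀ x ∈ K, ContinuousOn (fun t => v t x) (Icc 0 tf))
    (hvd : ∀ x ∈ K, ∀ t ∈ Ioo 0 tf, DifferentiableAt ℝ (fun t => v t x) t)
    (hvU : ∀ t ∈ Icc 0 tf, ∀ x ∈ K, v t x ∈ U) :
    ContinuousOn (fun t => ∫ x in K, G (v t x)) (Icc 0 tf) ∧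
    ∀ t ∈ Ioo 0 tf, HasDerivAt (fun t => ∫ x in K, G (v t x))
      (∫ x in K, deriv (fun t => G (v t x)) t) t := by
  obtain ⟨N, b, Λ, hb, hΛ, hrep⟩ := exists_interpolation hW0
  set L : Pt d → (Comp d × Fin N → ℝ) →L[ℝ] State d := fun x =>
    ∑ p : Comp d × Fin N, b p.2 x • (ContinuousLinearMap.proj (R := ℝ) (φ := fun _ => ℝ) p).smulRight
      (Pi.single p.1 1 : State d) with hLdef
  have hL : Continuous L := continuous_finsetSum _ fun p _ =>
    (hW _ (hb p.2)).smul continuous_const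
  set z : ℝ → Comp d × Fin N → ℝ := fun t p => Λ p.2 (fun x => v t x p.1) with hzdef
  -- The field is linear in a finite coefficient vector z, so time dependence passes through one
  -- curve in a finite dimensional space. This holds only for times in the interval, hence the
  -- localizations to the open interval below.
  have hzv : ∀ t ∈ Icc 0 tf, ∀ x, L x (z t) = v t x := by
    intro t ht x
    funext c
    have h1 := congrFun (hrep _ (hv t ht c)) x
    simp only [Finset.sum_apply, Pi.smul_apply, smul_eq_mul] at h1
    rw [h1]
    simp [hLdef, hzdef, Fintype.sum_prod_type, Pi.single_apply, mul_comm, -Fintype.sum_sum_type]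
  have hzc : ContinuousOn z (Icc 0 tf) := by
    refine continuousOn_pi.2 fun p => ?_
    exact span_eval_induction (p := fun f => ContinuousOn f (Icc 0 tf)) (hΛ p.2)
      continuousOn_const (fun f g hf hg => hf.add hg) (fun c f hf => continuousOn_const.mul hf)
      fun x hx => continuousOn_pi.1 (hvc x hx) p.1
  have hzd : ∀ t ∈ Ioo 0 tf, DifferentiableAt ℝ z t := by
    intro t ht
    refine differentiableAt_pi.2 fun p => ?_
    exact span_eval_induction (p := fun f => DifferentiableAt ℝ f t) (hΛ p.2)
      (differentiableAt_const _) (fun f g hf hg => hf.fun_add hg) (fun c f hf => hf.const_mul c)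
      fun x hx => differentiableAt_pi.1 (hvd x hx t ht) p.1
  have hzU : ∀ t ∈ Icc 0 tf, ∀ x ∈ K, L x (z t) ∈ U := by
    intro t ht x hx
    rw [hzv t ht]
    exact hvU t ht x hx
  have hΨ : ∀ t ∈ Icc 0 tf, ∫ x in K, G (v t x) = ∫ x in K, G (L x (z t)) := by
    intro t ht
    simp only [hzv t ht]
  constructor
  · refine ContinuousOn.congr (f := fun t => ∫ x in K, G (L x (z t))) ?_ hΨ
    intro t ht
    exact ContinuousAt.comp_continuousWithinAt (g := fun z => ∫ x in K, G (L x z))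
      (hasFDerivAt_integral_comp hK hL hU hG (hzU t ht)).1.continuousAt (hzc t ht)
  · intro t ht
    have ht' := Ioo_subset_Icc_self ht
    obtain ⟨h1, h1i⟩ := hasFDerivAt_integral_comp hK hL hU hG (hzU t ht')
    have h2 := (h1.comp_hasDerivAt t (hzd t ht).hasDerivAt).congr_of_eventuallyEq
      (f₁ := fun t => ∫ x in K, G (v t x)) (by
        filter_upwards [Ioo_mem_nhds ht.1 ht.2] with s hs
        exact hΨ s (Ioo_subset_Icc_self hs))
    refine h2.congr_deriv ?_
    rw [ContinuousLinearMap.integral_apply h1i]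
    refine setIntegral_congr_fun hK.measurableSet fun x hx => ?_
    have h3 := (((hG _ (hzU t ht' x hx)).differentiableAt one_ne_zero).hasFDerivAt.comp_hasDerivAt t
      ((L x).hasFDerivAt.comp_hasDerivAt t (hzd t ht).hasDerivAt)).congr_of_eventuallyEq
      (f₁ := fun t => G (v t x)) (by
        filter_upwards [Ioo_mem_nhds ht.1 ht.2] with s hs
        simp [hzv s (Ioo_subset_Icc_self hs)])
    exact h3.deriv.symm

end TimeDerivative

end EntropyHDG

/-! ### Area on hyperplanes and its projection along a coordinate axis -/

namespace EntropyHDG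

section Hyperplane

variable {n : ℕ}

/-- The projection along the `j`-th coordinate axis. -/
noncomputable def dropCoord (j : Fin (n + 1)) : Pt (n + 1) →L[ℝ] (Fin n → ℝ) :=
  ContinuousLinearMap.pi fun i => EuclideanSpace.proj (j.succAbove i)

theorem dropCoord_apply (j : Fin (n + 1)) (x : Pt (n + 1)) (i : Fin n) :
    dropCoord j x i = x (j.succAbove i) := rfl

/-- An orthonormal basis of ν^⊥ gives the isometric parametrization φ. Projection along the axis j
then becomes a linear change of variables with determinant ±ν j, the cosine of the tilt. -/
theorem exists_hyperplane_chart {ν : Pt (n + 1)} (hν : ‖ν‖ = 1) :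
    ∃ φ : Pt n →ₗᵢ[ℝ] Pt (n + 1), (∀ z, inner ℝ ν (φ z) = 0) ∧
      (∀ x, inner ℝ ν x = 0 → ∃ z, φ z = x) ∧
      ∀ j, ν j ≠ 0 → MeasurableEmbedding (fun z => dropCoord j (φ z)) ∧
        volume.map (fun z => dropCoord j (φ z)) = ENNReal.ofReal |ν j|⁻¹ • volume := by
  have hν0 : ν ≠ 0 := by
    rintro rfl
    simp at hν
  have : Fact (Module.finrank ℝ (Pt (n + 1)) = n + 1) := ⟨by simp⟩
  let B := OrthonormalBasis.fromOrthogonalSpanSingleton (𝕜 := ℝ) n hν0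
  let φ : Pt n →ₗᵢ[ℝ] Pt (n + 1) :=
    (Submodule.subtypeₗᵢ (Submodule.span ℝ {ν})ᗮ).comp B.repr.symm.toLinearIsometry
  have hφ0 : ∀ z, inner ℝ ν (φ z) = 0 := fun z =>
    Submodule.mem_orthogonal_singleton_iff_inner_right.1 (B.repr.symm z).2
  refine ⟨φ, hφ0, ?_, ?_⟩
  · intro x hx
    refine ⟨B.repr ⟨x, Submodule.mem_orthogonal_singleton_iff_inner_right.2 hx⟩, ?_⟩
    simp [φ]
  intro j hj
  set e : Fin n → Pt n := fun b => EuclideanSpace.single b 1 with he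
  set Q : Matrix (Fin (n + 1)) (Fin (n + 1)) ℝ :=
    Matrix.of fun r s => (Fin.cons ν (fun b => φ (e b)) : Fin (n + 1) → Pt (n + 1)) s r with hQ
  have hQQ : Qᵀ * Q = 1 := by
    have hin : ∀ x y : Pt (n + 1), ∑ r, x r * y r = inner ℝ x y := by
      intro x y
      rw [PiLp.inner_apply]
      simp [mul_comm]
    ext s s'
    rw [Matrix.mul_apply]
    simp only [transpose_apply, hQ, of_apply, hin]
    refine Fin.cases ?_ (fun b => ?_) s <;> refine Fin.cases ?_ (fun b' => ?_) s'
    · simp [hν]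
    · simp only [Fin.cons_zero, Fin.cons_succ, hφ0]
      rw [Matrix.one_apply_ne (Fin.succ_ne_zero b').symm]
    · simp only [Fin.cons_zero, Fin.cons_succ]
      rw [real_inner_comm, hφ0, Matrix.one_apply_ne (Fin.succ_ne_zero b)]
    · simp only [Fin.cons_succ, φ.inner_map_map, he]
      rw [EuclideanSpace.inner_single_left]
      simp [Matrix.one_apply]
  set A : Matrix (Fin n) (Fin n) ℝ := Q.submatrix j.succAbove Fin.succ with hA
  have hQdet : |Q.det| = 1 := by
    have h := congrArg Matrix.det hQQ
    rw [det_mul, det_transpose, det_one] at h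
    rcases mul_self_eq_one_iff.1 h with h | h <;> simp [h]
  -- Q is orthogonal with first column ν, so its adjugate is det Q • Qᵀ. The entry (0, j) of the
  -- adjugate is, up to sign, the minor det A, and the entry (0, j) of Qᵀ is ν j.
  have hAdet : |A.det| = |ν j| := by
    have h1 : Q.adjugate = Q.det • Qᵀ := by
      have h2 := congrArg (Qᵀ * ·) (Matrix.mul_adjugate Q)
      simp only [← Matrix.mul_assoc, hQQ, Matrix.one_mul] at h2
      rw [h2]
      simp
    have h3 := Matrix.adjugate_fin_succ_eq_det_submatrix Q 0 j
    rw [h1] at h3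
    have h4 : (0 : Fin (n + 1)).succAbove = Fin.succ := by
      funext b
      simp
    rw [h4, ← hA] at h3
    have h5 := congrArg abs h3
    simp only [Matrix.smul_apply, transpose_apply, hQ, of_apply, Fin.cons_zero, smul_eq_mul,
      abs_mul, abs_pow, abs_neg, abs_one, one_pow, one_mul] at h5
    rw [← h5, ← hQ, hQdet, one_mul]
  have hA0 : A.det ≠ 0 := by
    rw [← abs_pos, hAdet]
    exact abs_pos.2 hj
  have hfun : (fun z : Pt n => dropCoord j (φ z)) = fun z => Matrix.toLin' A (z.ofLp) := by
    funext z i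
    have hz : z = ∑ b, z b • e b := by
      ext b
      simp [he, Pi.single_apply]
    conv_lhs => rw [hz]
    simp [dropCoord_apply, mulVec, dotProduct, hA, hQ, mul_comm]
  rw [hfun]
  constructor
  · refine Continuous.measurableEmbedding ?_ ?_
    · exact (LinearMap.continuous_of_finiteDimensional _).comp (PiLp.continuous_ofLp 2 _)
    · have hinj : Function.Injective (Matrix.toLin' A) := by
        change Function.Injective A.mulVec
        exact Matrix.mulVec_injective_of_isUnit
          ((Matrix.isUnit_iff_isUnit_det A).2 hA0.isUnit)
      exact hinj.comp (WithLp.ofLp_injective 2)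
  · have hm : Measurable (Matrix.toLin' A) :=
      (LinearMap.continuous_of_finiteDimensional _).measurable
    have h1 := Measure.map_map (μ := (volume : Measure (Pt n))) hm
      (PiLp.volume_preserving_ofLp (Fin n)).measurable
    have h2 : (fun z : Pt n => Matrix.toLin' A (z.ofLp)) = Matrix.toLin' A ∘ WithLp.ofLp := rfl
    rw [h2, ← h1, (PiLp.volume_preserving_ofLp (Fin n)).map_eq,
      Real.map_matrix_volume_pi_eq_smul_volume_pi hA0, abs_inv, hAdet]

/-- Isometries preserve `μHE`, which is normalized to agree with Lebesgue measure on Euclidean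
space. Area on a hyperplane is thus Lebesgue measure in the chart. -/
theorem map_hyperplane_chart {ν : Pt (n + 1)} {φ : Pt n →ₗᵢ[ℝ] Pt (n + 1)} (p : Pt (n + 1))
    (h0 : ∀ z, inner ℝ ν (φ z) = 0) (hs : ∀ x, inner ℝ ν x = 0 → ∃ z, φ z = x) :
    MeasurableEmbedding (fun z => p + φ z) ∧
    volume.map (fun z => p + φ z) = (μHE[n]).restrict {x | inner ℝ ν (x - p) = 0} := by
  have hiso : Isometry (fun z => p + φ z) := (isometry_add_left p).comp φ.isometry
  refine ⟨hiso.isClosedEmbedding.measurableEmbedding, ?_⟩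
  have h := hiso.map_euclideanHausdorffMeasure (d := n)
  rw [EuclideanSpace.euclideanHausdorffMeasure_eq_volume] at h
  rw [h]
  congr 1
  ext x
  constructor
  · rintro ⟨z, rfl⟩
    simp [h0]
  · intro hx
    obtain ⟨z, hz⟩ := hs _ hx
    exact ⟨z, by simp [hz]⟩

/-- A bounded part of a hyperplane has finite area. -/
theorem hausdorff_lt_top_of_subset_hyperplane {ν p : Pt (n + 1)} (hν : ‖ν‖ = 1)
    {S : Set (Pt (n + 1))} (hS : S ⊆ {x | inner ℝ ν (x - p) = 0}) (hb : Bornology.IsBounded S) :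
    μHE[n] S < ⊤ := by
  obtain ⟨φ, h0, hs, -⟩ := exists_hyperplane_chart hν
  obtain ⟨hemb, hmap⟩ := map_hyperplane_chart p h0 hs
  have h1 : μHE[n] S = (μHE[n]).restrict {x | inner ℝ ν (x - p) = 0} S :=
    (Measure.restrict_eq_self _ hS).symm
  rw [h1, ← hmap, hemb.map_apply]
  refine Bornology.IsBounded.measure_lt_top ?_
  have hiso : Isometry (fun z => p + φ z) := (isometry_add_left p).comp φ.isometry
  exact hiso.antilipschitz.isBounded_preimage hb

/-- A part of two hyperplanes that are not parallel has zero area. -/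
theorem hausdorff_eq_zero_of_subset_hyperplanes {ν ν' p : Pt (n + 1)} (hν : ‖ν‖ = 1)
    (hν' : ‖ν'‖ = 1) (hne : ν' ≠ ν) (hne' : ν' ≠ -ν)
    {S : Set (Pt (n + 1))} (hS : S ⊆ {x | inner ℝ ν (x - p) = 0})
    (hS' : S ⊆ {x | inner ℝ ν' (x - p) = 0}) : μHE[n] S = 0 := by
  obtain ⟨φ, h0, hs, -⟩ := exists_hyperplane_chart hν
  obtain ⟨hemb, hmap⟩ := map_hyperplane_chart p h0 hs
  have h1 : μHE[n] S = (μHE[n]).restrict {x | inner ℝ ν (x - p) = 0} S :=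
    (Measure.restrict_eq_self _ hS).symm
  rw [h1, ← hmap, hemb.map_apply]
  set ℓ : Pt n →ₗ[ℝ] ℝ := (innerₛₗ ℝ ν').comp φ.toLinearMap with hℓ
  -- If ν' vanished on ν^⊥ it would be a multiple of ν, hence ±ν by the norms. So S lies, in the
  -- chart, in a proper subspace.
  have hker : LinearMap.ker ℓ ≠ ⊤ := by
    intro htop
    have hz : ∀ x, inner ℝ ν x = 0 → inner ℝ ν' x = 0 := by
      intro x hx
      obtain ⟨z, rfl⟩ := hs x hx
      have : z ∈ LinearMap.ker ℓ := by
        rw [htop]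
        trivial
      simpa [hℓ] using this
    set a := inner ℝ ν ν' with ha
    have h2 : inner ℝ ν (ν' - a • ν) = 0 := by
      rw [inner_sub_right, inner_smul_right, real_inner_self_eq_norm_sq, hν, ← ha]
      ring
    have h3 := hz _ h2
    have h4 : ν' - a • ν = 0 := by
      rw [← inner_self_eq_zero (𝕜 := ℝ)]
      rw [inner_sub_left, h3, inner_smul_left, h2]
      simp
    have h5 : ν' = a • ν := sub_eq_zero.1 h4
    have h6 : |a| = 1 := by
      have := congrArg norm h5
      rw [norm_smul, hν, hν', mul_one] at this
      exact this.symm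
    rcases eq_or_eq_neg_of_abs_eq h6 with h | h
    · exact hne (by rw [h5, h, one_smul])
    · exact hne' (by rw [h5, h, neg_one_smul])
  refine measure_mono_null ?_ (Measure.addHaar_submodule volume _ hker)
  intro z hz
  have := hS' hz
  simpa [hℓ] using this

/-- Area and projected area of a part of a hyperplane. -/
theorem setIntegral_image_dropCoord {ν p : Pt (n + 1)} (hν : ‖ν‖ = 1) {j : Fin (n + 1)}
    (hj : ν j ≠ 0) {S : Set (Pt (n + 1))} (hS : S ⊆ {x | inner ℝ ν (x - p) = 0})
    {f : Pt (n + 1) → ℝ} (hf : IntegrableOn f S μHE[n]) {h : (Fin n → ℝ) → ℝ}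
    (hfh : ∀ x ∈ S, h (dropCoord j x) = f x) (hSm : MeasurableSet S) :
    IntegrableOn h (dropCoord j '' S) ∧
      ∫ y in dropCoord j '' S, h y = |ν j| * ∫ x in S, f x ∂μHE[n] := by
  obtain ⟨φ, h0, hs, hproj⟩ := exists_hyperplane_chart hν
  obtain ⟨hemb, hmap⟩ := map_hyperplane_chart p h0 hs
  obtain ⟨hpemb, hpmap⟩ := hproj j hj
  set Φ : Pt n → Pt (n + 1) := fun z => p + φ z with hΦ
  set P : Set (Pt (n + 1)) := {x | inner ℝ ν (x - p) = 0} with hP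
  set π : Pt n → Fin n → ℝ := fun z => dropCoord j p + dropCoord j (φ z) with hπ
  have hπΦ : ∀ z, dropCoord j (Φ z) = π z := fun z => by simp [hΦ, hπ]
  have hπemb : MeasurableEmbedding π := (measurableEmbedding_addLeft _).comp hpemb
  have hπmap : volume.map π = ENNReal.ofReal |ν j|⁻¹ • volume := by
    have h1 := Measure.map_map (μ := (volume : Measure (Pt n)))
      (measurable_const_add (dropCoord j p)) hpemb.measurable
    have h2 : π = (fun y => dropCoord j p + y) ∘ fun z => dropCoord j (φ z) := rfl
    rw [h2, ← h1, hpmap, Measure.map_smul, map_add_left_eq_self]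
  have hvol : (volume : Measure (Fin n → ℝ)) = ENNReal.ofReal |ν j| • volume.map π := by
    rw [hπmap, smul_smul, ← ENNReal.ofReal_mul (abs_nonneg _), mul_inv_cancel₀ (abs_pos.2 hj).ne',
      ENNReal.ofReal_one, one_smul]
  have hpre : π ⁻¹' (dropCoord j '' S) = Φ ⁻¹' S := by
    ext z
    constructor
    · rintro ⟨x, hx, hxz⟩
      obtain ⟨w, hw⟩ := hs _ (hS hx)
      have hxw : x = Φ w := by simp [hΦ, hw]
      rw [hxw, hπΦ] at hxz
      have := hπemb.injective hxz
      rw [← this, mem_preimage, ← hxw]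
      exact hx
    · intro hz
      exact ⟨Φ z, hz, hπΦ z⟩
  have hSrestrict : (μHE[n]).restrict S = ((volume.map Φ).restrict S) := by
    rw [hmap, Measure.restrict_restrict hSm, inter_eq_self_of_subset_left hS]
  have hcongr : EqOn (h ∘ π) (f ∘ Φ) (Φ ⁻¹' S) := by
    intro z hz
    simp only [Function.comp]
    rw [← hπΦ]
    exact hfh _ hz
  have hmeas : MeasurableSet (Φ ⁻¹' S) := hemb.measurable hSm
  constructor
  · rw [hvol]
    refine IntegrableOn.mono_measure (ν := ENNReal.ofReal |ν j| • volume.map π) ?_ le_rfl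
    unfold IntegrableOn
    rw [Measure.restrict_smul]
    refine Integrable.smul_measure ?_ ENNReal.ofReal_ne_top
    change IntegrableOn h (dropCoord j '' S) (volume.map π)
    rw [hπemb.integrableOn_map_iff, hpre, integrableOn_congr_fun hcongr hmeas,
      ← hemb.integrableOn_map_iff]
    rw [IntegrableOn, ← hSrestrict]
    exact hf
  · rw [hSrestrict, hemb.setIntegral_map]
    conv_lhs => rw [hvol]
    rw [Measure.restrict_smul, integral_smul_measure, hπemb.setIntegral_map, hpre,
      ENNReal.toReal_ofReal (abs_nonneg _), smul_eq_mul]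
    congr 1
    exact setIntegral_congr_fun hmeas hcongr

/-- Projections of null sets of a hypersurface are null sets. -/
theorem volume_image_dropCoord_eq_zero (j : Fin (n + 1)) {S : Set (Pt (n + 1))}
    (hS : μHE[n] S = 0) : volume (dropCoord j '' S) = 0 := by
  -- The target carries the sup norm, for which dropping a coordinate is 1-Lipschitz and the
  -- n-dimensional Hausdorff measure is Lebesgue measure.
  have hlip : LipschitzWith 1 (dropCoord j : Pt (n + 1) → Fin n → ℝ) := by
    refine LipschitzWith.of_dist_le_mul fun x y => ?_
    rw [NNReal.coe_one, one_mul, dist_pi_le_iff dist_nonneg]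
    intro i
    simp only [dropCoord_apply]
    rw [dist_eq_norm, dist_eq_norm, ← PiLp.sub_apply]
    exact PiLp.norm_apply_le _ _
  have hS0 : μH[n] S = 0 := by
    rw [Measure.euclideanHausdorffMeasure_def, Measure.smul_apply] at hS
    have := Measure.addHaarScalarFactor_volume_hausdorffMeasure_ne_zero n
    simpa [this, ENNReal.smul_def] using hS
  have h := hlip.hausdorffMeasure_image_le (d := (n : ℝ)) (Nat.cast_nonneg n) S
  rw [hS0, mul_zero] at h
  have h2 := hausdorffMeasure_pi_real (ι := Fin n)
  rw [Fintype.card_fin] at h2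
  rw [← h2]
  exact nonpos_iff_eq_zero.1 h

end Hyperplane

end EntropyHDG

/-! ### Convex bodies cut by lines parallel to a coordinate axis -/

namespace EntropyHDG

section Fubini

variable {n : ℕ}

/-- The point with `j`-th coordinate `t` and other coordinates `y`. -/
noncomputable def insertCoord (j : Fin (n + 1)) (y : Fin n → ℝ) (t : ℝ) : Pt (n + 1) :=
  WithLp.toLp 2 (j.insertNth t y)

@[simp]
theorem insertCoord_same (j : Fin (n + 1)) (y : Fin n → ℝ) (t : ℝ) : insertCoord j y t j = t := by
  simp [insertCoord]

@[simp]
theorem dropCoord_insertCoord (j : Fin (n + 1)) (y : Fin n → ℝ) (t : ℝ) :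
    dropCoord j (insertCoord j y t) = y := by
  funext i
  simp [dropCoord_apply, insertCoord]

theorem insertCoord_dropCoord (j : Fin (n + 1)) (x : Pt (n + 1)) :
    insertCoord j (dropCoord j x) (x j) = x := by
  ext i
  refine Fin.succAboveCases j ?_ (fun i => ?_) i
  · simp
  · simp [insertCoord, dropCoord_apply]

theorem insertCoord_eq_add (j : Fin (n + 1)) (y : Fin n → ℝ) (s t : ℝ) :
    insertCoord j y t = insertCoord j y s + (t - s) • EuclideanSpace.single j 1 := by
  ext i
  refine Fin.succAboveCases j ?_ (fun i => ?_) i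
  · simp
  · simp [insertCoord]

theorem hasDerivAt_insertCoord (j : Fin (n + 1)) (y : Fin n → ℝ) (t : ℝ) :
    HasDerivAt (insertCoord j y) (EuclideanSpace.single j 1) t := by
  have h : insertCoord j y =
      fun t => insertCoord j y 0 + (t - 0) • (EuclideanSpace.single j 1 : Pt (n + 1)) :=
    funext fun t => insertCoord_eq_add j y 0 t
  rw [h]
  simpa using (((hasDerivAt_id t).sub_const 0).smul_const
    (EuclideanSpace.single j 1 : Pt (n + 1))).const_add (insertCoord j y 0)

theorem continuous_insertCoord (j : Fin (n + 1)) (y : Fin n → ℝ) : Continuous (insertCoord j y) :=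
  continuous_iff_continuousAt.2 fun t => (hasDerivAt_insertCoord j y t).continuousAt

theorem measurePreserving_insertCoord (j : Fin (n + 1)) :
    MeasurePreserving (fun p : ℝ × (Fin n → ℝ) => insertCoord j p.2 p.1) ∧
    MeasurableEmbedding (fun p : ℝ × (Fin n → ℝ) => insertCoord j p.2 p.1) := by
  have h1 := (volume_preserving_piFinSuccAbove (fun _ : Fin (n + 1) => ℝ) j).symm
  have h2 := (PiLp.volume_preserving_toLp (Fin (n + 1))).comp h1
  refine ⟨h2, ?_⟩
  exact (MeasurableEquiv.toLp 2 (Fin (n + 1) → ℝ)).measurableEmbedding.comp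
    (MeasurableEquiv.piFinSuccAbove (fun _ : Fin (n + 1) => ℝ) j).symm.measurableEmbedding

/-- The intersection of a set with a line parallel to a coordinate axis. -/
def lineSection (j : Fin (n + 1)) (K : Set (Pt (n + 1))) (y : Fin n → ℝ) : Set ℝ :=
  {t | insertCoord j y t ∈ K}

variable {K : Set (Pt (n + 1))} {j : Fin (n + 1)} {y : Fin n → ℝ}

theorem lineSection_nonempty : (lineSection j K y).Nonempty ↔ y ∈ dropCoord j '' K := by
  constructor
  · rintro ⟨t, ht⟩
    exact ⟨_, ht, by simp⟩
  · rintro ⟨x, hx, rfl⟩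
    exact ⟨x j, by rwa [lineSection, mem_ofPred_eq, insertCoord_dropCoord]⟩

theorem lineSection_isCompact (hK : IsCompact K) : IsCompact (lineSection j K y) := by
  have hcl : IsClosed (lineSection j K y) := hK.isClosed.preimage (continuous_insertCoord j y)
  refine (hK.image (EuclideanSpace.proj (𝕜 := ℝ) j).continuous).of_isClosed_subset hcl ?_
  intro t ht
  exact ⟨_, ht, by simp⟩

theorem lineSection_eq_Icc (hK : IsCompact K) (hc : Convex ℝ K) (hy : y ∈ dropCoord j '' K) :
    lineSection j K y = Icc (sInf (lineSection j K y)) (sSup (lineSection j K y)) := by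
  have hcomp := lineSection_isCompact (j := j) (y := y) hK
  have hne := lineSection_nonempty.2 hy
  refine Subset.antisymm (fun t ht => ⟨csInf_le hcomp.bddBelow ht, le_csSup hcomp.bddAbove ht⟩) ?_
  have hconv : Convex ℝ (lineSection j K y) := by
    intro s hs t ht a b ha hb hab
    have h := hc hs ht ha hb hab
    have : a • insertCoord j y s + b • insertCoord j y t = insertCoord j y (a • s + b • t) := by
      rw [insertCoord_eq_add j y s t, insertCoord_eq_add j y s (a • s + b • t)]
      obtain rfl : a = 1 - b := by linarith
      simp only [smul_eq_mul]
      module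
    rwa [this] at h
  exact hconv.ordConnected.out (hcomp.sInf_mem hne) (hcomp.sSup_mem hne)

/-- Integration of a partial derivative over a convex body, by Fubini's theorem and the
fundamental theorem of calculus on lines. -/
theorem integral_fderiv_single (hK : IsCompact K) (hc : Convex ℝ K) {f : Pt (n + 1) → ℝ}
    (hf : ∀ x ∈ K, DifferentiableAt ℝ f x)
    (hf' : ContinuousOn (fun x => fderiv ℝ f x (EuclideanSpace.single j 1)) K) :
    ∫ x in K, fderiv ℝ f x (EuclideanSpace.single j 1) =
      ∫ y in dropCoord j '' K, (f (insertCoord j y (sSup (lineSection j K y))) -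
        f (insertCoord j y (sInf (lineSection j K y)))) := by
  set D : Pt (n + 1) → ℝ := fun x => fderiv ℝ f x (EuclideanSpace.single j 1) with hD
  obtain ⟨hmp, hme⟩ := measurePreserving_insertCoord j
  have hint : Integrable (K.indicator D) :=
    (hf'.integrableOn_compact hK).integrable_indicator hK.measurableSet
  have hint' : Integrable (fun p : ℝ × (Fin n → ℝ) => K.indicator D (insertCoord j p.2 p.1))
      (volume.prod volume) := (hmp.integrable_comp_emb hme).2 hint
  have hπ : MeasurableSet (dropCoord j '' K) := (hK.image (dropCoord j).continuous).measurableSet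
  rw [← integral_indicator hK.measurableSet, ← hmp.integral_comp hme,
    ← integral_indicator hπ]
  refine (integral_prod_symm _ hint').trans ?_
  congr 1
  funext y
  by_cases hy : y ∈ dropCoord j '' K
  · rw [indicator_of_mem hy]
    set a := sInf (lineSection j K y) with ha
    set b := sSup (lineSection j K y) with hb
    have hsec : lineSection j K y = Icc a b := lineSection_eq_Icc hK hc hy
    have hab : a ≤ b := by
      have := lineSection_nonempty.2 hy
      rw [hsec] at this
      exact nonempty_Icc.1 this
    have h1 : (fun t => K.indicator D (insertCoord j y t)) =
        (Icc a b).indicator (fun t => D (insertCoord j y t)) := by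
      rw [← hsec]
      rfl
    rw [h1, integral_indicator measurableSet_Icc, integral_Icc_eq_integral_Ioc,
      ← intervalIntegral.integral_of_le hab]
    have hmem : ∀ t ∈ Icc a b, insertCoord j y t ∈ K := fun t ht => by
      rw [← hsec] at ht
      exact ht
    rw [intervalIntegral.integral_eq_sub_of_hasDerivAt (f := fun t => f (insertCoord j y t))]
    · intro t ht
      rw [uIcc_of_le hab] at ht
      exact (hf _ (hmem t ht)).hasFDerivAt.comp_hasDerivAt t (hasDerivAt_insertCoord j y t)
    · refine ContinuousOn.intervalIntegrable ?_
      rw [uIcc_of_le hab]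
      exact hf'.comp (continuous_insertCoord j y).continuousOn hmem
  · rw [indicator_of_notMem hy]
    have h0 : (fun t => K.indicator D (insertCoord j y t)) = fun _ => 0 := by
      funext t
      refine indicator_of_notMem (fun h => hy ?_) _
      exact ⟨_, h, by simp⟩
    rw [h0]
    simp

/-- Points of the shadow of a convex body come from interior points, up to a null set. -/
theorem exists_interior_of_mem_interior_image (hc : Convex ℝ K) (hi : (interior K).Nonempty)
    (hy : y ∈ interior (dropCoord j '' K)) : ∃ t, insertCoord j y t ∈ interior K := by
  -- The shadow of the interior is open and convex, and dense in the shadow of K. It therefore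
  -- equals the interior of its closure and contains the interior of the shadow of K.
  have hopen : IsOpen (dropCoord j '' interior K) := by
    refine (ContinuousLinearMap.isOpenMap (dropCoord j) fun y => ?_) _ isOpen_interior
    exact ⟨insertCoord j y 0, by simp⟩
  have hconv : Convex ℝ (dropCoord j '' interior K) :=
    hc.interior.linear_image (dropCoord j).toLinearMap
  have hsub : dropCoord j '' K ⊆ closure (dropCoord j '' interior K) := by
    have h1 : K ⊆ closure (interior K) := by
      rw [hc.closure_interior_eq_closure_of_nonempty_interior hi]
      exact subset_closure
    exact (image_mono h1).trans (image_closure_subset_closure_image (dropCoord j).continuous)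
  have h2 := interior_mono hsub hy
  rw [hconv.interior_closure_eq_interior_of_nonempty_interior
    (by rw [hopen.interior_eq]; exact hi.image _), hopen.interior_eq] at h2
  obtain ⟨x, hx, rfl⟩ := h2
  exact ⟨x j, by rwa [insertCoord_dropCoord]⟩

/-! ### Convex sets with disjoint interiors on a line -/

variable {T T' T'' : Set (Pt (n + 1))} {x e : Pt (n + 1)} {α β γ : ℝ}

theorem not_disjoint_interior_of_mem (hc' : Convex ℝ T') (hi' : (interior T').Nonempty)
    (hx : x ∈ interior T) (hx' : x ∈ T') : ¬ Disjoint (interior T) (interior T') := by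
  rw [not_disjoint_iff]
  have h1 : x ∈ closure (interior T') := by
    rw [hc'.closure_interior_eq_closure_of_nonempty_interior hi']
    exact subset_closure hx'
  obtain ⟨z, hz1, hz2⟩ := mem_closure_iff.1 h1 _ isOpen_interior hx
  exact ⟨z, hz1, hz2⟩

/-- Two convex bodies through x with disjoint interiors, both met in their interior by the same line
through x, must lie on opposite sides of x. -/
theorem mul_neg_of_disjoint_interior (hc : Convex ℝ T) (hc' : Convex ℝ T')
    (hd : Disjoint (interior T) (interior T')) (hx : x ∈ T) (hx' : x ∈ T')
    (hα : x + α • e ∈ interior T) (hβ : x + β • e ∈ interior T') : α * β < 0 := by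
  by_contra hcon
  rw [not_lt] at hcon
  rcases eq_or_ne α 0 with rfl | hα0
  · rw [zero_smul, add_zero] at hα
    exact not_disjoint_interior_of_mem hc' ⟨_, hβ⟩ hα hx' hd
  rcases eq_or_ne β 0 with rfl | hβ0
  · rw [zero_smul, add_zero] at hβ
    exact not_disjoint_interior_of_mem hc ⟨_, hα⟩ hβ hx hd.symm
  have hs : 0 < α * β := lt_of_le_of_ne hcon (mul_ne_zero hα0 hβ0).symm
  have hsum : α + β ≠ 0 := by
    intro h
    have : β = -α := by linarith
    rw [this] at hs
    nlinarith [sq_nonneg α]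
  -- If α and β had the same sign, the parameter αβ/(α + β) would lie strictly beyond 0 and no
  -- further than α or β. The corresponding point would be interior to both bodies.
  have h1 : β / (α + β) ∈ Ioc (0 : ℝ) 1 := by
    have e1 : β / (α + β) = (β * β + α * β) / (α + β) ^ 2 := by field_simp; ring
    have e2 : 1 - β / (α + β) = (α * α + α * β) / (α + β) ^ 2 := by field_simp; ring
    constructor
    · rw [e1]
      have := mul_self_nonneg β
      positivity
    · have : 0 ≤ 1 - β / (α + β) := by
        rw [e2]
        have := mul_self_nonneg α
        positivity
      linarith
  have h2 : α / (α + β) ∈ Ioc (0 : ℝ) 1 := by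
    have e1 : α / (α + β) = (α * α + α * β) / (α + β) ^ 2 := by field_simp
    have e2 : 1 - α / (α + β) = (β * β + α * β) / (α + β) ^ 2 := by field_simp; ring
    constructor
    · rw [e1]
      have := mul_self_nonneg α
      positivity
    · have : 0 ≤ 1 - α / (α + β) := by
        rw [e2]
        have := mul_self_nonneg β
        positivity
      linarith
  have k1 := hc.add_smul_sub_mem_interior hx hα h1
  have k2 := hc'.add_smul_sub_mem_interior hx' hβ h2
  rw [add_sub_cancel_left, smul_smul] at k1 k2
  rw [show α / (α + β) * β = β / (α + β) * α by ring] at k2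
  exact disjoint_left.1 hd k1 k2

/-- Three reals cannot have pairwise negative products, so at most two tiles can meet at a point of
such a line. This will give uniqueness of the face through which a generic line leaves an element.
-/
theorem not_three_disjoint_interior (hc : Convex ℝ T) (hc' : Convex ℝ T') (hc'' : Convex ℝ T'')
    (hd : Disjoint (interior T) (interior T')) (hd' : Disjoint (interior T) (interior T''))
    (hx : x ∈ T) (hx' : x ∈ T') (hx'' : x ∈ T'')
    (hα : x + α • e ∈ interior T) (hβ : x + β • e ∈ interior T') (hγ : x + γ • e ∈ interior T'') :
    ¬ Disjoint (interior T') (interior T'') := by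
  intro hd''
  have h1 := mul_neg_of_disjoint_interior hc hc' hd hx hx' hα hβ
  have h2 := mul_neg_of_disjoint_interior hc hc'' hd' hx hx'' hα hγ
  have h3 := mul_neg_of_disjoint_interior hc' hc'' hd'' hx' hx'' hβ hγ
  have h4 := mul_pos_of_neg_of_neg h1 h2
  have h5 : α * β * (α * γ) = α ^ 2 * (β * γ) := by ring
  rw [h5] at h4
  exact absurd (mul_nonpos_of_nonneg_of_nonpos (sq_nonneg α) h3.le) (not_le.2 h4)

end Fubini

end EntropyHDG

/-! ### Geometry of the periodic mesh: tiles, sides and normals -/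

namespace EntropyHDG

namespace PeriodicMesh

variable {ι : Type*} {n : ℕ} (M : PeriodicMesh ι (n + 1))

theorem refElem_isCompact : IsCompact M.refElem := by
  obtain ⟨hb, -, S, hS⟩ := M.refElem_polytope
  refine Metric.isCompact_of_isClosed_isBounded ?_ hb
  have : M.refElem = ⋂ h ∈ S, {x | inner ℝ h.1 x ≤ h.2} := by
    rw [hS]
    ext x
    simp
  rw [this]
  exact isClosed_biInter fun h _ => isClosed_le (by fun_prop) continuous_const

theorem refElem_convex : Convex ℝ M.refElem := by
  obtain ⟨-, -, S, hS⟩ := M.refElem_polytope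
  have : M.refElem = ⋂ h ∈ S, {x | inner ℝ h.1 x ≤ h.2} := by
    rw [hS]
    ext x
    simp
  rw [this]
  exact convex_iInter₂ fun h _ =>
    convex_halfSpace_le (innerSL ℝ h.1).toLinearMap.isLinear h.2

theorem ψ_continuous (i : ι) : Continuous (M.ψ i) :=
  (affineEquiv_analyticOnNhd (M.ψ i)).continuous

theorem K_isCompact (i : ι) : IsCompact (M.K i) := M.refElem_isCompact.image (M.ψ_continuous i)

theorem K_convex (i : ι) : Convex ℝ (M.K i) :=
  M.refElem_convex.affine_image (M.ψ i).toAffineMap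

theorem K_interior_nonempty (i : ι) : (interior (M.K i)).Nonempty := by
  have h : interior (M.K i) = M.ψ i '' interior M.refElem :=
    ((AffineEquiv.toContinuousAffineEquiv (M.ψ i)).toHomeomorph.image_interior M.refElem).symm
  rw [h]
  exact M.refElem_polytope.2.1.image _

theorem K_subset_closure_interior (i : ι) : M.K i ⊆ closure (interior (M.K i)) := by
  rw [(M.K_convex i).closure_interior_eq_closure_of_nonempty_interior (M.K_interior_nonempty i)]
  exact subset_closure

theorem tile_isCompact (i : ι) (a : Pt (n + 1)) : IsCompact (a +ᵥ M.K i) :=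
  (M.K_isCompact i).image (continuous_const_vadd a)

theorem tile_convex (i : ι) (a : Pt (n + 1)) : Convex ℝ (a +ᵥ M.K i) := (M.K_convex i).vadd a

theorem tile_interior_nonempty (i : ι) (a : Pt (n + 1)) : (interior (a +ᵥ M.K i)).Nonempty := by
  rw [interior_vadd]
  exact (M.K_interior_nonempty i).image _

theorem disjoint_tiles {i j : ι} {a b : Pt (n + 1)} (ha : a ∈ M.lattice) (hb : b ∈ M.lattice)
    (h : ¬ (j = i ∧ b = a)) : Disjoint (interior (a +ᵥ M.K i)) (interior (b +ᵥ M.K j)) := by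
  have h1 := M.disjoint_interiors i j (b - a) (M.lattice.sub_mem hb ha)
    (fun h' => h ⟨h'.1, sub_eq_zero.1 h'.2⟩)
  rw [interior_vadd, interior_vadd]
  rw [disjoint_left] at h1 ⊢
  rintro _ ⟨x, hx, rfl⟩ ⟨y, hy, hxy⟩
  refine h1 hx ⟨y, hy, ?_⟩
  simp only [vadd_eq_add] at hxy ⊢
  rw [sub_add_eq_add_sub, hxy, add_sub_cancel_left]

theorem disjoint_K_tile {i j : ι} {a : Pt (n + 1)} (ha : a ∈ M.lattice)
    (h : ¬ (j = i ∧ a = 0)) : Disjoint (interior (M.K i)) (interior (a +ᵥ M.K j)) := by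
  have := M.disjoint_tiles (zero_mem M.lattice) ha h
  rwa [zero_vadd] at this

/-- A translate a + K_i that meets B has a in the bounded set B - K_i, and a discrete lattice is
closed and so meets a bounded set in finitely many points. -/
theorem finite_tiles [Finite ι] {B : Set (Pt (n + 1))} (hB : Bornology.IsBounded B) :
    {p : ι × Pt (n + 1) | p.2 ∈ M.lattice ∧ (B ∩ (p.2 +ᵥ M.K p.1)).Nonempty}.Finite := by
  have := M.lattice_discrete
  have hclosed : IsClosed (M.lattice : Set (Pt (n + 1))) := AddSubgroup.isClosed_of_discrete
  have h1 : ∀ i, ((B - M.K i) ∩ (M.lattice : Set (Pt (n + 1)))).Finite := fun i =>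
    Metric.finite_isBounded_inter_isClosed
      (isDiscrete_iff_discreteTopology.2 M.lattice_discrete)
      (hB.sub (M.K_isCompact i).isBounded) hclosed
  refine (finite_iUnion fun i => (h1 i).image (fun a => (i, a))).subset ?_
  rintro ⟨i, a⟩ ⟨ha, x, hx, y, hy, hxy⟩
  refine mem_iUnion.2 ⟨i, a, ⟨⟨x, hx, y, hy, ?_⟩, ha⟩, rfl⟩
  rw [← hxy]
  simp

theorem mem_vadd_frontier {i j : ι} {a : Pt (n + 1)} (ha : a ∈ M.lattice)
    (h : ¬ (j = i ∧ a = 0)) {x : Pt (n + 1)} (hx : x ∈ M.K i) (hx' : x ∈ a +ᵥ M.K j) :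
    x ∈ a +ᵥ frontier (M.K j) := by
  obtain ⟨z, hz, rfl⟩ := hx'
  refine ⟨z, ⟨subset_closure hz, fun hzi => ?_⟩, rfl⟩
  refine not_disjoint_interior_of_mem (M.K_convex i) (M.K_interior_nonempty i) ?_ hx
    (M.disjoint_K_tile ha h).symm
  rw [interior_vadd]
  exact ⟨z, hzi, rfl⟩

/-- Near x only finitely many tiles occur, so the union of those other than K_i is closed. If x were
outside it, K_i alone would cover a neighbourhood of x, which would then be interior. -/
theorem exists_neighbour [Finite ι] {i : ι} {x : Pt (n + 1)} (hx : x ∈ frontier (M.K i)) :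
    ∃ j, ∃ a ∈ M.lattice, ¬ (j = i ∧ a = 0) ∧ x ∈ a +ᵥ frontier (M.K j) := by
  have hxK : x ∈ M.K i := (M.K_isCompact i).isClosed.frontier_subset hx
  set S := {p : ι × Pt (n + 1) | p.2 ∈ M.lattice ∧
    (Metric.closedBall x 1 ∩ (p.2 +ᵥ M.K p.1)).Nonempty} \ {(i, 0)} with hS
  have hfin : S.Finite := (M.finite_tiles Metric.isBounded_closedBall).sdiff
  have hclosed : IsClosed (⋃ p ∈ S, p.2 +ᵥ M.K p.1) :=
    hfin.isClosed_biUnion fun p _ => (M.tile_isCompact p.1 p.2).isClosed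
  by_cases hxS : x ∈ ⋃ p ∈ S, p.2 +ᵥ M.K p.1
  · simp only [mem_iUnion] at hxS
    obtain ⟨⟨j, a⟩, ⟨⟨ha, -⟩, hne⟩, hxa⟩ := hxS
    have hne' : ¬ (j = i ∧ a = 0) := fun h => hne (by simp [h.1, h.2])
    exact ⟨j, a, ha, hne', M.mem_vadd_frontier ha hne' hxK hxa⟩
  · exfalso
    refine hx.2 (mem_interior_iff_mem_nhds.2 ?_)
    filter_upwards [hclosed.isOpen_compl.mem_nhds hxS, Metric.closedBall_mem_nhds x one_pos]
      with y hy hyb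
    obtain ⟨j, a, ha, hya⟩ := M.covers y
    by_cases h : (j, a) = (i, 0)
    · obtain ⟨rfl, rfl⟩ := Prod.mk.inj h
      rwa [zero_vadd] at hya
    · exact absurd (mem_biUnion (show (j, a) ∈ S from ⟨⟨ha, y, hyb, hya⟩, h⟩) hya) hy

/-! ### Sides -/

theorem face_subset_K (s : Side ι (n + 1)) : M.face s ⊆ M.K s.elem := fun _ hx =>
  (M.K_isCompact _).isClosed.frontier_subset hx.1

theorem face_subset_tile (s : Side ι (n + 1)) : M.face s ⊆ s.shift +ᵥ M.K s.nbr := by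
  rintro x ⟨-, z, hz, rfl⟩
  exact ⟨z, (M.K_isCompact _).isClosed.frontier_subset hz, rfl⟩

theorem face_isCompact (s : Side ι (n + 1)) : IsCompact (M.face s) := by
  refine (M.K_isCompact s.elem).of_isClosed_subset ?_ (M.face_subset_K s)
  exact isClosed_frontier.inter (isClosed_frontier.vadd _)

theorem face_nonempty {s : Side ι (n + 1)} (hs : s ∈ M.sides) : (M.face s).Nonempty := by
  by_contra h
  rw [not_nonempty_iff_eq_empty] at h
  exact hs.2.2 (by rw [h]; exact measure_empty)

theorem sides_finite [Finite ι] : M.sides.Finite := by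
  have h := finite_iUnion fun i => (M.finite_tiles (M.K_isCompact i).isBounded).image
    (fun p => (⟨i, p.1, p.2⟩ : Side ι (n + 1)))
  refine h.subset fun s hs => ?_
  obtain ⟨x, hx⟩ := M.face_nonempty hs
  exact mem_iUnion.2 ⟨s.elem, (s.nbr, s.shift),
    ⟨hs.1, x, M.face_subset_K s hx, M.face_subset_tile s hx⟩, rfl⟩

theorem swap_swap (s : Side ι (n + 1)) : s.swap.swap = s := by
  simp [Side.swap]

theorem face_swap (s : Side ι (n + 1)) : M.face s.swap = (-s.shift) +ᵥ M.face s := by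
  ext x
  simp only [face, Side.swap, mem_inter_iff, mem_vadd_set_iff_neg_vadd_mem, neg_neg]
  simp [and_comm]

theorem swap_mem_sides {s : Side ι (n + 1)} (hs : s ∈ M.sides) : s.swap ∈ M.sides := by
  refine ⟨neg_mem hs.1, fun h => hs.2.1 ⟨h.1.symm, neg_eq_zero.1 h.2⟩, ?_⟩
  rw [face_swap, measure_vadd]
  exact hs.2.2

theorem sides_disjoint {s : Side ι (n + 1)} (hs : s ∈ M.sides) :
    Disjoint (interior (M.K s.elem)) (interior (s.shift +ᵥ M.K s.nbr)) :=
  M.disjoint_K_tile hs.1 hs.2.1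

/-- A hyperplane separating the interiors of the two tiles contains their common face. Producing one
vector for both sides makes the opposite orientation of the two normals available later. -/
theorem exists_outwardNormal {s : Side ι (n + 1)} (hs : s ∈ M.sides) :
    ∃ ν, M.IsOutwardNormal s ν ∧ M.IsOutwardNormal s.swap (-ν) := by
  obtain ⟨f, u, hf1, hf2⟩ := geometric_hahn_banach_open_open (M.K_convex s.elem).interior
    isOpen_interior (M.tile_convex s.nbr s.shift).interior isOpen_interior (M.sides_disjoint hs)
  have hK : ∀ y ∈ M.K s.elem, f y ≤ u := fun y hy =>
    closure_minimal (fun a ha => (hf1 a ha).le) (isClosed_le f.continuous continuous_const)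
      (M.K_subset_closure_interior _ hy)
  have hT : ∀ y ∈ s.shift +ᵥ M.K s.nbr, u ≤ f y := fun y hy => by
    have h1 : y ∈ closure (interior (s.shift +ᵥ M.K s.nbr)) := by
      rw [(M.tile_convex _ _).closure_interior_eq_closure_of_nonempty_interior
        (M.tile_interior_nonempty _ _)]
      exact subset_closure hy
    exact closure_minimal (fun a ha => (hf2 a ha).le)
      (isClosed_le continuous_const f.continuous) h1
  have hface : ∀ x ∈ M.face s, f x = u := fun x hx =>
    le_antisymm (hK x (M.face_subset_K s hx)) (hT x (M.face_subset_tile s hx))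
  set w := (InnerProductSpace.toDual ℝ (Pt (n + 1))).symm f with hw
  have hwf : ∀ y, inner ℝ w y = f y := fun y => InnerProductSpace.toDual_symm_apply
  have hw0 : w ≠ 0 := by
    intro h0
    obtain ⟨a, ha⟩ := M.K_interior_nonempty s.elem
    obtain ⟨b, hb⟩ := M.tile_interior_nonempty s.nbr s.shift
    have h1 := (hf1 a ha).trans (hf2 b hb)
    rw [← hwf, ← hwf, h0] at h1
    simp at h1
  have hnorm : 0 < ‖w‖ := norm_pos_iff.2 hw0
  refine ⟨‖w‖⁻¹ • w, ⟨?_, ?_⟩, ?_, ?_⟩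
  · rw [norm_smul, norm_inv, norm_norm, inv_mul_cancel₀ hnorm.ne']
  · intro x hx y hy
    rw [inner_smul_left, hwf, map_sub, hface x hx]
    exact mul_nonpos_of_nonneg_of_nonpos (by simp) (sub_nonpos.2 (hK y hy))
  · rw [norm_neg, norm_smul, norm_inv, norm_norm, inv_mul_cancel₀ hnorm.ne']
  · intro x hx y hy
    rw [face_swap, mem_vadd_set_iff_neg_vadd_mem, neg_neg] at hx
    have h1 := hface _ hx
    have h2 := hT (s.shift +ᵥ y) ⟨y, hy, rfl⟩
    rw [vadd_eq_add, map_add] at h1 h2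
    rw [inner_neg_left, inner_smul_left, hwf, map_sub]
    have h3 : 0 ≤ ‖w‖⁻¹ * (f y - f x) := mul_nonneg (by positivity) (by linarith)
    simpa using h3

variable {M}

/-- From an interior point one can still move a little along ν within the element, so the supporting
inequality has room to spare. -/
theorem IsOutwardNormal.inner_lt {s : Side ι (n + 1)} {ν : Pt (n + 1)}
    (hν : M.IsOutwardNormal s ν) {x z : Pt (n + 1)} (hx : x ∈ M.face s)
    (hz : z ∈ interior (M.K s.elem)) : inner ℝ ν (z - x) < 0 := by
  have h1 : ∀ᶠ t : ℝ in nhds 0, z + t • ν ∈ M.K s.elem := by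
    have hc : ContinuousAt (fun t : ℝ => z + t • ν) 0 := by fun_prop
    refine hc.eventually_mem ?_
    simpa using mem_interior_iff_mem_nhds.1 hz
  obtain ⟨ε, hε, hball⟩ := Metric.eventually_nhds_iff.1 h1
  have h2 := hν.2 x hx _ (hball (y := ε / 2) (by
    rw [Real.dist_eq, sub_zero, abs_of_pos (by linarith)]
    linarith))
  rw [add_sub_right_comm, inner_add_right, inner_smul_right, real_inner_self_eq_norm_sq,
    hν.1] at h2
  linarith

theorem IsOutwardNormal.face_subset {s : Side ι (n + 1)} {ν : Pt (n + 1)}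
    (hν : M.IsOutwardNormal s ν) {p : Pt (n + 1)} (hp : p ∈ M.face s) :
    M.face s ⊆ {x | inner ℝ ν (x - p) = 0} := by
  intro x hx
  refine le_antisymm (hν.2 p hp x (M.face_subset_K s hx)) ?_
  have := hν.2 x hx p (M.face_subset_K s hp)
  rw [← neg_sub, inner_neg_right] at this
  linarith

/-- Two non-parallel normals would confine the face to two transversal hyperplanes and its area
would vanish. Opposite normals are excluded by an interior point. Hence the choice in `normal` is
harmless. -/
theorem IsOutwardNormal.eq {s : Side ι (n + 1)} (hs : s ∈ M.sides) {ν ν' : Pt (n + 1)}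
    (hν : M.IsOutwardNormal s ν) (hν' : M.IsOutwardNormal s ν') : ν' = ν := by
  obtain ⟨p, hp⟩ := M.face_nonempty hs
  by_contra hne
  refine hs.2.2 (hausdorff_eq_zero_of_subset_hyperplanes hν.1 hν'.1 hne ?_
    (hν.face_subset hp) (hν'.face_subset hp))
  intro h
  obtain ⟨z, hz⟩ := M.K_interior_nonempty s.elem
  have h1 := hν.inner_lt hp hz
  have h2 := hν'.inner_lt hp hz
  rw [h, inner_neg_left] at h2
  linarith

variable (M)

theorem normal_spec {s : Side ι (n + 1)} (hs : s ∈ M.sides) : M.IsOutwardNormal s (M.normal s) := by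
  have h : ∃ ν, M.IsOutwardNormal s ν := (M.exists_outwardNormal hs).imp fun _ h => h.1
  rw [normal, dif_pos h]
  exact h.choose_spec

theorem normal_swap {s : Side ι (n + 1)} (hs : s ∈ M.sides) : M.normal s.swap = -M.normal s := by
  obtain ⟨ν, h1, h2⟩ := M.exists_outwardNormal hs
  rw [IsOutwardNormal.eq hs h1 (M.normal_spec hs),
    IsOutwardNormal.eq (M.swap_mem_sides hs) h2 (M.normal_spec (M.swap_mem_sides hs))]

theorem face_measure_lt_top {s : Side ι (n + 1)} (hs : s ∈ M.sides) : μHE[n] (M.face s) < ⊤ := by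
  obtain ⟨p, hp⟩ := M.face_nonempty hs
  exact hausdorff_lt_top_of_subset_hyperplane (M.normal_spec hs).1
    ((M.normal_spec hs).face_subset hp) (M.face_isCompact s).isBounded

theorem integrableOn_face {s : Side ι (n + 1)} (hs : s ∈ M.sides) {f : Pt (n + 1) → ℝ}
    (hf : ContinuousOn f (M.face s)) : IntegrableOn f (M.face s) μHE[n] := by
  obtain ⟨C, hC⟩ := (M.face_isCompact s).exists_bound_of_continuousOn hf
  have hm := (M.face_isCompact s).measurableSet
  exact IntegrableOn.of_bound (M.face_measure_lt_top hs) (hf.aestronglyMeasurable hm) C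
    ((ae_restrict_iff' hm).2 (Filter.Eventually.of_forall hC))

theorem K_frontier_null (i : ι) : volume (frontier (M.K i)) = 0 :=
  (M.K_convex i).addHaar_frontier volume

end PeriodicMesh

end EntropyHDG

/-! ### The divergence theorem on an element -/

namespace EntropyHDG

namespace PeriodicMesh

variable {ι : Type*} [Finite ι] {n : ℕ} (M : PeriodicMesh ι (n + 1))

/-- The sides of the mesh on the boundary of one element. -/
noncomputable def elemSides (i : ι) : Finset (Side ι (n + 1)) :=
  (M.sides_finite.subset fun s (hs : s ∈ {s | s ∈ M.sides ∧ s.elem = i}) => hs.1).toFinset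

theorem mem_elemSides {i : ι} {s : Side ι (n + 1)} :
    s ∈ M.elemSides i ↔ s ∈ M.sides ∧ s.elem = i := by
  simp [elemSides]

/-- Almost every line parallel to a coordinate axis that meets an element passes through its
interior, and leaves it through exactly one face. -/
theorem ae_existsUnique_side (i : ι) (j : Fin (n + 1)) :
    ∀ᵐ y : Fin n → ℝ, y ∈ dropCoord j '' M.K i →
      (∃ t, insertCoord j y t ∈ interior (M.K i)) ∧
      ∀ t, insertCoord j y t ∈ frontier (M.K i) →
        ∃ s ∈ M.elemSides i, insertCoord j y t ∈ M.face s ∧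
          ∀ s' ∈ M.elemSides i, insertCoord j y t ∈ M.face s' → s' = s := by
  set P := {p : ι × Pt (n + 1) | p.2 ∈ M.lattice ∧ (M.K i ∩ (p.2 +ᵥ M.K p.1)).Nonempty} with hP
  have hPfin : P.Finite := M.finite_tiles (M.K_isCompact i).isBounded
  -- Lines over the boundary of the shadow of a tile may graze it without entering its interior.
  -- Shadows are convex, so these lines form a null set for each of the finitely many tiles.
  have h1 : ∀ᵐ y : Fin n → ℝ, ∀ p ∈ P, y ∉ frontier (dropCoord j '' (p.2 +ᵥ M.K p.1)) := by
    refine (ae_ball_iff hPfin.countable).2 fun p _ => ?_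
    refine measure_eq_zero_iff_ae_notMem.1 (Convex.addHaar_frontier volume ?_)
    exact (M.tile_convex p.1 p.2).linear_image (dropCoord j).toLinearMap
  -- Contacts of zero area, such as edges and corners, are not sides. Their shadows are null, so
  -- almost every line misses them.
  have h2 : ∀ᵐ y : Fin n → ℝ, ∀ p ∈ P, μHE[n] (M.face ⟨i, p.1, p.2⟩) = 0 →
      y ∉ dropCoord j '' M.face ⟨i, p.1, p.2⟩ := by
    refine (ae_ball_iff hPfin.countable).2 fun p _ => ?_
    by_cases h0 : μHE[n] (M.face ⟨i, p.1, p.2⟩) = 0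
    · filter_upwards [measure_eq_zero_iff_ae_notMem.1 (volume_image_dropCoord_eq_zero j h0)]
        with y hy _ using hy
    · exact Filter.Eventually.of_forall fun y h => absurd h h0
  filter_upwards [h1, h2] with y hy1 hy2 hy
  have hint : ∀ p ∈ P, y ∈ dropCoord j '' (p.2 +ᵥ M.K p.1) →
      ∃ t, insertCoord j y t ∈ interior (p.2 +ᵥ M.K p.1) := by
    intro p hp hyp
    refine exists_interior_of_mem_interior_image (M.tile_convex _ _)
      (M.tile_interior_nonempty _ _) ?_
    rw [← self_sdiff_frontier]
    exact ⟨hyp, hy1 p hp⟩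
  have h0P : (i, (0 : Pt (n + 1))) ∈ P := by
    refine ⟨zero_mem _, ?_⟩
    obtain ⟨x, hx⟩ := M.K_interior_nonempty i
    exact ⟨x, interior_subset hx, by simpa using interior_subset hx⟩
  have hK : ∃ t, insertCoord j y t ∈ interior (M.K i) := by
    have := hint _ h0P (by simpa using hy)
    simpa using this
  refine ⟨hK, fun t ht => ?_⟩
  set x := insertCoord j y t with hx
  have hxK : x ∈ M.K i := (M.K_isCompact i).isClosed.frontier_subset ht
  have hxy : dropCoord j x = y := dropCoord_insertCoord j y t
  obtain ⟨k, a, ha, hne, hxa⟩ := M.exists_neighbour ht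
  have hface : x ∈ M.face ⟨i, k, a⟩ := ⟨ht, hxa⟩
  have hP' : ∀ s : Side ι (n + 1), s.shift ∈ M.lattice → s.elem = i → x ∈ M.face s →
      (s.nbr, s.shift) ∈ P := fun s hs _ hxs => ⟨hs, x, hxK, M.face_subset_tile s hxs⟩
  have hline : ∀ (T : Set (Pt (n + 1))) (r : ℝ), insertCoord j y r ∈ T →
      x + (r - t) • (EuclideanSpace.single j 1 : Pt (n + 1)) ∈ T := by
    intro T r hr
    rwa [hx, ← insertCoord_eq_add]
  refine ⟨⟨i, k, a⟩, M.mem_elemSides.2 ⟨⟨ha, hne, fun h0 => ?_⟩, rfl⟩, hface, ?_⟩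
  · exact hy2 (k, a) (hP' ⟨i, k, a⟩ ha rfl hface) h0 ⟨x, hface, hxy⟩
  · intro s' hs' hxs'
    rw [mem_elemSides] at hs'
    obtain ⟨⟨hs'l, hs'ne, -⟩, hs'i⟩ := hs'
    -- Two different sides through x would give three distinct tiles through x, each with an
    -- interior point on the same line.
    by_contra hss
    have hne' : ¬ (s'.nbr = k ∧ s'.shift = a) := by
      rintro ⟨e1, e2⟩
      apply hss
      cases s'
      simp_all
    rw [hs'i] at hs'ne
    have hxT := M.face_subset_tile _ hface
    have hxT' := M.face_subset_tile _ hxs'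
    obtain ⟨r0, hr0⟩ := hK
    obtain ⟨r1, hr1⟩ := hint _ (hP' ⟨i, k, a⟩ ha rfl hface) ⟨x, hxT, hxy⟩
    obtain ⟨r2, hr2⟩ := hint _ (hP' s' hs'l hs'i hxs') ⟨x, hxT', hxy⟩
    exact not_three_disjoint_interior (M.K_convex i) (M.tile_convex k a)
      (M.tile_convex s'.nbr s'.shift) (M.disjoint_K_tile ha hne)
      (M.disjoint_K_tile hs'l hs'ne) hxK hxT hxT' (hline _ _ hr0) (hline _ _ hr1)
      (hline _ _ hr2) (M.disjoint_tiles ha hs'l hne')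

theorem inner_insertCoord_sub (ν : Pt (n + 1)) (j : Fin (n + 1)) (y : Fin n → ℝ) (r t : ℝ) :
    inner ℝ ν (insertCoord j y r - insertCoord j y t) = ν j * (r - t) := by
  rw [insertCoord_eq_add j y t r, add_sub_cancel_left, inner_smul_right,
    EuclideanSpace.inner_single_right]
  simp [mul_comm]

/-- The divergence theorem on an element, one partial derivative at a time. -/
theorem integral_fderiv_eq_sum_faces (i : ι) (j : Fin (n + 1)) {f : Pt (n + 1) → ℝ}
    (hf : ∀ x ∈ M.K i, DifferentiableAt ℝ f x)
    (hf' : ContinuousOn (fun x => fderiv ℝ f x (EuclideanSpace.single j 1)) (M.K i)) :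
    ∫ x in M.K i, fderiv ℝ f x (EuclideanSpace.single j 1) =
      ∑ s ∈ M.elemSides i, M.normal s j * ∫ x in M.face s, f x ∂μHE[n] := by
  classical
  have hKc := M.K_isCompact i
  rw [integral_fderiv_single hKc (M.K_convex i) hf hf']
  have hfc : ContinuousOn f (M.K i) := fun x hx => (hf x hx).continuousAt.continuousWithinAt
  have hsides : ∀ s ∈ M.elemSides i, s ∈ M.sides ∧ M.face s ⊆ M.K i ∧
      M.face s ⊆ frontier (M.K i) ∧ M.IsOutwardNormal s (M.normal s) := by
    intro s hs
    obtain ⟨h1, h2⟩ := M.mem_elemSides.1 hs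
    refine ⟨h1, ?_, ?_, M.normal_spec h1⟩
    · rw [← h2]
      exact M.face_subset_K s
    · rw [← h2]
      exact inter_subset_left
  -- the contribution of one side
  set Fs : Side ι (n + 1) → (Fin n → ℝ) → ℝ := fun s =>
    if M.normal s j = 0 then fun _ => 0 else (dropCoord j '' M.face s).indicator
      (fun y => (M.normal s j / |M.normal s j|) *
        f (Function.invFunOn (dropCoord j) (M.face s) y)) with hFs
  have hline : ∀ s ∈ M.elemSides i, ∀ y r t, insertCoord j y t ∈ M.face s →
      insertCoord j y r ∈ M.K i → M.normal s j * (r - t) ≤ 0 := by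
    intro s hs y r t hx hz
    obtain ⟨-, h2⟩ := M.mem_elemSides.1 hs
    rw [← inner_insertCoord_sub]
    exact (hsides s hs).2.2.2.2 _ hx _ (by rwa [h2])
  have hline' : ∀ s ∈ M.elemSides i, ∀ y r t, insertCoord j y t ∈ M.face s →
      insertCoord j y r ∈ interior (M.K i) → M.normal s j * (r - t) < 0 := by
    intro s hs y r t hx hz
    obtain ⟨-, h2⟩ := M.mem_elemSides.1 hs
    rw [← inner_insertCoord_sub]
    exact (hsides s hs).2.2.2.inner_lt hx (by rwa [h2])
  -- A face that is not parallel to the axis j is a graph over its shadow, so the integrand can be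
  -- carried to the shadow.
  have hinj : ∀ s ∈ M.elemSides i, M.normal s j ≠ 0 → InjOn (dropCoord j) (M.face s) := by
    intro s hs h0 x hx x' hx' hxx'
    have e1 := insertCoord_dropCoord j x
    have e2 : insertCoord j (dropCoord j x) (x' j) = x' := by rw [hxx', insertCoord_dropCoord]
    have h1 := hline s hs (dropCoord j x) (x' j) (x j) (by rwa [e1])
      (by rw [e2]; exact (hsides s hs).2.1 hx')
    have h2 := hline s hs (dropCoord j x) (x j) (x' j) (by rwa [e2])
      (by rw [e1]; exact (hsides s hs).2.1 hx)
    have h3 : M.normal s j * (x' j - x j) = 0 := by linarith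
    have h4 := (mul_eq_zero.1 h3).resolve_left h0
    rw [← e1, ← e2, sub_eq_zero.1 h4]
  have hFint : ∀ s ∈ M.elemSides i, IntegrableOn (Fs s) (dropCoord j '' M.K i) ∧
      ∫ y in dropCoord j '' M.K i, Fs s y = M.normal s j * ∫ x in M.face s, f x ∂μHE[n] := by
    intro s hs
    obtain ⟨h1, h2, h3, h4⟩ := hsides s hs
    by_cases h0 : M.normal s j = 0
    · simp [hFs, h0]
    · simp only [hFs, if_neg h0]
      obtain ⟨p, hp⟩ := M.face_nonempty h1
      have hmeas : MeasurableSet (dropCoord j '' M.face s) :=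
        ((M.face_isCompact s).image (dropCoord j).continuous).measurableSet
      -- The sign ν_j/|ν_j| times the projection factor |ν_j| gives back ν_j, the weight required on
      -- the face.
      have hfi := (M.integrableOn_face h1 (hfc.mono h2)).const_mul
        (M.normal s j / |M.normal s j|)
      obtain ⟨k1, k2⟩ := setIntegral_image_dropCoord h4.1 h0 (h4.face_subset hp) hfi
        (h := fun y => (M.normal s j / |M.normal s j|) *
          f (Function.invFunOn (dropCoord j) (M.face s) y))
        (fun x hx => by
          rw [(hinj s hs h0).leftInvOn_invFunOn hx]) (M.face_isCompact s).measurableSet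
      constructor
      · exact (k1.integrable_indicator hmeas).integrableOn
      · rw [setIntegral_indicator hmeas,
          inter_eq_self_of_subset_right (image_mono h2), k2, integral_const_mul]
        have := (abs_pos.2 h0).ne'
        field_simp
  rw [← Finset.sum_congr rfl fun s hs => (hFint s hs).2,
    ← integral_finsetSum _ fun s hs => (hFint s hs).1]
  have hπm : MeasurableSet (dropCoord j '' M.K i) :=
    (hKc.image (dropCoord j).continuous).measurableSet
  refine setIntegral_congr_ae hπm ?_
  filter_upwards [M.ae_existsUnique_side i j] with y hy hyK
  obtain ⟨⟨r, hr⟩, hside⟩ := hy hyK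
  set a := sInf (lineSection j (M.K i) y) with ha
  set b := sSup (lineSection j (M.K i) y) with hb
  have hsec : lineSection j (M.K i) y = Icc a b := lineSection_eq_Icc hKc (M.K_convex i) hyK
  have hmem : ∀ t, insertCoord j y t ∈ M.K i ↔ t ∈ Icc a b := fun t => by
    rw [← hsec]
    rfl
  have hrab := (hmem r).1 (interior_subset hr)
  have haK : insertCoord j y a ∈ M.K i := (hmem a).2 ⟨le_rfl, hrab.1.trans hrab.2⟩
  have hbK : insertCoord j y b ∈ M.K i := (hmem b).2 ⟨hrab.1.trans hrab.2, le_rfl⟩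
  have hnot : ∀ t, insertCoord j y t ∈ interior (M.K i) → a < t ∧ t < b := by
    intro t ht
    have hc := (continuous_insertCoord j y).continuousAt (x := t)
    have hev : ∀ᶠ t' in nhds t, insertCoord j y t' ∈ M.K i :=
      hc.eventually_mem (mem_interior_iff_mem_nhds.1 ht)
    obtain ⟨ε, hε, hball⟩ := Metric.eventually_nhds_iff.1 hev
    have e1 := (hmem _).1 (hball (y := t - ε / 2) (by
      rw [Real.dist_eq, abs_lt]
      constructor <;> linarith))
    have e2 := (hmem _).1 (hball (y := t + ε / 2) (by
      rw [Real.dist_eq, abs_lt]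
      constructor <;> linarith))
    exact ⟨by linarith [e1.1], by linarith [e2.2]⟩
  have hr' := hnot r hr
  have hfr : ∀ t, (t = a ∨ t = b) → insertCoord j y t ∈ frontier (M.K i) := by
    rintro t ht
    refine ⟨subset_closure ?_, fun hti => ?_⟩
    · rcases ht with rfl | rfl
      exacts [haK, hbK]
    · have := hnot t hti
      rcases ht with rfl | rfl
      exacts [lt_irrefl _ this.1, lt_irrefl _ this.2]
  obtain ⟨sa, hsa, hsaf, hsau⟩ := hside a (hfr a (Or.inl rfl))
  obtain ⟨sb, hsb, hsbf, hsbu⟩ := hside b (hfr b (Or.inr rfl))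
  have hna : M.normal sa j < 0 := by
    have := hline' sa hsa y r a hsaf hr
    by_contra hcon
    exact absurd (mul_nonneg (not_lt.1 hcon) (sub_pos.2 hr'.1).le) (not_le.2 this)
  have hnb : 0 < M.normal sb j := by
    have := hline' sb hsb y r b hsbf hr
    by_contra hcon
    exact absurd (mul_nonneg_of_nonpos_of_nonpos (not_lt.1 hcon) (sub_neg.2 hr'.2).le)
      (not_le.2 this)
  -- The line passes through the interior, so it crosses the hyperplane of a side only at the end b
  -- if the normal component is positive, at a if it is negative, and never if it is zero. By
  -- uniqueness only `sb` and `sa` contribute, with opposite signs: this is the difference of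
  -- endpoint values from the fundamental theorem of calculus.
  have hval : ∀ s ∈ M.elemSides i, Fs s y =
      (if s = sb then f (insertCoord j y b) else 0) -
        (if s = sa then f (insertCoord j y a) else 0) := by
    intro s hs
    have hcase : ∀ t, insertCoord j y t ∈ M.face s →
        (0 < M.normal s j ∧ t = b) ∨ (M.normal s j < 0 ∧ t = a) := by
      intro t ht
      have htab := (hmem t).1 ((hsides s hs).2.1 ht)
      have h1 := hline' s hs y r t ht hr
      rcases lt_trichotomy (M.normal s j) 0 with h | h | h
      · right
        refine ⟨h, le_antisymm ?_ htab.1⟩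
        have := hline s hs y a t ht haK
        by_contra hcon
        exact absurd (mul_pos_of_neg_of_neg h (sub_neg.2 (not_le.1 hcon))) (not_lt.2 this)
      · rw [h, zero_mul] at h1
        exact absurd h1 (lt_irrefl _)
      · left
        refine ⟨h, le_antisymm htab.2 ?_⟩
        have := hline s hs y b t ht hbK
        by_contra hcon
        exact absurd (mul_pos h (sub_pos.2 (not_le.1 hcon))) (not_lt.2 this)
    by_cases hyf : y ∈ dropCoord j '' M.face s
    · obtain ⟨x, hx, hxy⟩ := hyf
      have hxeq : x = insertCoord j y (x j) := by rw [← hxy, insertCoord_dropCoord]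
      have hx' : insertCoord j y (x j) ∈ M.face s := by rwa [← hxeq]
      have hn0 : M.normal s j ≠ 0 := by
        rcases hcase _ hx' with h | h
        exacts [h.1.ne', h.1.ne]
      have hFv : Fs s y = (M.normal s j / |M.normal s j|) * f x := by
        simp only [hFs, if_neg hn0]
        rw [indicator_of_mem (show y ∈ dropCoord j '' M.face s from ⟨x, hx, hxy⟩), ← hxy, (hinj s hs hn0).leftInvOn_invFunOn hx]
      rw [hFv]
      rcases hcase _ hx' with ⟨h, ht⟩ | ⟨h, ht⟩
      · have e1 : s = sb := hsbu s hs (by rwa [← ht])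
        have e2 : s ≠ sa := by
          rintro rfl
          exact lt_asymm h hna
        rw [if_pos e1, if_neg e2, abs_of_pos h, div_self h.ne', hxeq, ht]
        ring
      · have e1 : s = sa := hsau s hs (by rwa [← ht])
        have e2 : s ≠ sb := by
          rintro rfl
          exact lt_asymm h hnb
        rw [if_pos e1, if_neg e2, abs_of_neg h, div_neg, div_self h.ne, hxeq, ht]
        ring
    · have e1 : s ≠ sb := by
        rintro rfl
        exact hyf ⟨_, hsbf, by simp⟩
      have e2 : s ≠ sa := by
        rintro rfl
        exact hyf ⟨_, hsaf, by simp⟩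
      have hFv : Fs s y = 0 := by
        simp only [hFs]
        split_ifs
        · rfl
        · exact indicator_of_notMem hyf _
      rw [hFv, if_neg e1, if_neg e2, sub_zero]
  rw [Finset.sum_congr rfl hval, Finset.sum_sub_distrib, Finset.sum_ite_eq', Finset.sum_ite_eq',
    if_pos hsb, if_pos hsa]

end PeriodicMesh

end EntropyHDG

/-! ### Cancellation over faces, broken spaces and integration by parts -/

namespace EntropyHDG

theorem trace_transpose_mul {d : ℕ} (A B : Grad d) :
    (Aᵀ * B).trace = ∑ j, ∑ c, A c j * B c j := by
  simp only [Matrix.trace, Matrix.diag, Matrix.mul_apply, transpose_apply]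

theorem fderiv_line {d : ℕ} {f : Pt d → ℝ} {x e : Pt d} (hf : DifferentiableAt ℝ f x) {f' : ℝ}
    (h : HasDerivAt (fun t : ℝ => f (x + t • e)) f' 0) : fderiv ℝ f x e = f' := by
  have hl : HasDerivAt (fun t : ℝ => x + t • e) e 0 := by
    simpa using ((hasDerivAt_id (0 : ℝ)).smul_const e).const_add x
  have h1 : HasFDerivAt f (fderiv ℝ f x) (x + (0 : ℝ) • e) := by
    simpa using hf.hasFDerivAt
  exact (h1.comp_hasDerivAt (0 : ℝ) hl).unique h

namespace PeriodicMesh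

section Sums

variable {ι : Type*} {n : ℕ} (M : PeriodicMesh ι (n + 1))

/-- Area is invariant under translation by the period that identifies the two copies of the face. -/
theorem integral_face_swap (s : Side ι (n + 1)) (h : Pt (n + 1) → ℝ) :
    ∫ x in M.face s.swap, h x ∂μHE[n] = ∫ x in M.face s, h (x - s.shift) ∂μHE[n] := by
  have hiso : (fun x : Pt (n + 1) => x - s.shift) = fun x => (-s.shift) +ᵥ x := by
    funext x
    rw [vadd_eq_add, sub_eq_neg_add]
  have hmp : MeasurePreserving (fun x : Pt (n + 1) => x - s.shift) μHE[n] μHE[n] := by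
    rw [hiso]
    exact measurePreserving_vadd _ _
  have hemb : MeasurableEmbedding (fun x : Pt (n + 1) => x - s.shift) :=
    (MeasurableEquiv.subRight s.shift).measurableEmbedding
  rw [← hmp.setIntegral_preimage_emb hemb]
  congr 2
  ext x
  rw [mem_preimage, face_swap, mem_vadd_set_iff_neg_vadd_mem]
  simp

variable [Fintype ι]

theorem sum_elemSides (F : Side ι (n + 1) → ℝ) :
    ∑ i, ∑ s ∈ M.elemSides i, F s = ∑ s ∈ M.sides_finite.toFinset, F s := by
  classical
  rw [← Finset.sum_fiberwise M.sides_finite.toFinset Side.elem F]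
  refine Finset.sum_congr rfl fun i _ => Finset.sum_congr ?_ fun _ _ => rfl
  ext s
  simp [mem_elemSides]

theorem ipBdry_eq_sum (a b : Side ι (n + 1) → Pt (n + 1) → State (n + 1)) :
    M.ipBdry a b = ∑ s ∈ M.sides_finite.toFinset, ∫ x in M.face s, a s x ⬝ᵥ b s x ∂μHE[n] :=
  finsum_mem_eq_finite_toFinset_sum _ M.sides_finite

/-- Single-valued quantities cancel on the two sides of every face. -/
theorem sum_sides_eq_zero {F : Side ι (n + 1) → ℝ} (hF : ∀ s ∈ M.sides, F s.swap = -F s) :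
    ∑ s ∈ M.sides_finite.toFinset, F s = 0 := by
  have h : ∑ s ∈ M.sides_finite.toFinset, F s = ∑ s ∈ M.sides_finite.toFinset, F s.swap := by
    refine Finset.sum_nbij' Side.swap Side.swap ?_ ?_ (fun s _ => swap_swap s)
      (fun s _ => swap_swap s) (fun s _ => by rw [swap_swap])
    · intro s hs
      exact M.sides_finite.mem_toFinset.2 (M.swap_mem_sides (M.sides_finite.mem_toFinset.1 hs))
    · intro s hs
      exact M.sides_finite.mem_toFinset.2 (M.swap_mem_sides (M.sides_finite.mem_toFinset.1 hs))
  rw [Finset.sum_congr rfl fun s hs => hF s (M.sides_finite.mem_toFinset.1 hs),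
    Finset.sum_neg_distrib] at h
  linarith

/-- The divergence theorem on an element. -/
theorem integral_div_eq (i : ι) {f : Fin (n + 1) → Pt (n + 1) → ℝ}
    (hf : ∀ j, ∀ x ∈ M.K i, DifferentiableAt ℝ (f j) x)
    (hf' : ∀ j, ContinuousOn (fun x => fderiv ℝ (f j) x (EuclideanSpace.single j 1)) (M.K i)) :
    ∫ x in M.K i, ∑ j, fderiv ℝ (f j) x (EuclideanSpace.single j 1) =
      ∑ s ∈ M.elemSides i, ∫ x in M.face s, (fun j => f j x) ⬝ᵥ (M.normal s).ofLp ∂μHE[n] := by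
  rw [integral_finsetSum _ fun j _ => (hf' j).integrableOn_compact (M.K_isCompact i),
    Finset.sum_congr rfl fun j _ => M.integral_fderiv_eq_sum_faces i j (hf j) (hf' j),
    Finset.sum_comm]
  refine Finset.sum_congr rfl fun s hs => ?_
  obtain ⟨h1, rfl⟩ := M.mem_elemSides.1 hs
  have hfc : ∀ j, ContinuousOn (f j) (M.face s) := fun j x hx =>
    (hf j x (M.face_subset_K s hx)).continuousAt.continuousWithinAt
  simp only [dotProduct]
  rw [integral_finsetSum _ fun j _ => (M.integrableOn_face h1 (hfc j)).mul_const _]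
  refine Finset.sum_congr rfl fun j _ => ?_
  rw [integral_mul_const, mul_comm]

end Sums

section Spaces

variable {ι : Type*} {n : ℕ} (M : PeriodicMesh ι (n + 1)) {k : ℕ}

theorem mem_Q {r : ι → Pt (n + 1) → Grad (n + 1)} :
    r ∈ M.Q k ↔ ∀ i c j, (fun x => r i x c j) ∈ polySpace k (M.ψ i) :=
  forall_congr' fun i => forall_congr' fun c => forall_congr' fun j =>
    (mem_polySpace (f := fun x => r i x c j)).symm

theorem mem_V {w : ι → Pt (n + 1) → State (n + 1)} :
    w ∈ M.V k ↔ ∀ i c, (fun x => w i x c) ∈ polySpace k (M.ψ i) :=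
  forall_congr' fun i => forall_congr' fun c =>
    (mem_polySpace (f := fun x => w i x c)).symm

/-- Makes ∇v_h a legitimate test for the projection, so that G can be replaced by its projection in
the volume term. -/
theorem gradient_mem_Q {w : ι → Pt (n + 1) → State (n + 1)} (hw : w ∈ M.V k) :
    (fun i => gradient (w i)) ∈ M.Q k :=
  M.mem_Q.2 fun i c j => fderiv_mem_polySpace (M.mem_V.1 hw i c) (EuclideanSpace.single j 1)

theorem Q_contDiff {r : ι → Pt (n + 1) → Grad (n + 1)} (hr : r ∈ M.Q k) (i : ι)
    (c : Comp (n + 1)) (j : Fin (n + 1)) : ContDiff ℝ 1 (fun x => r i x c j) :=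
  contDiff_of_mem_polySpace (M.mem_Q.1 hr i c j)

theorem V_contDiff {w : ι → Pt (n + 1) → State (n + 1)} (hw : w ∈ M.V k) (i : ι)
    (c : Comp (n + 1)) : ContDiff ℝ 1 (fun x => w i x c) :=
  contDiff_of_mem_polySpace (M.mem_V.1 hw i c)

theorem V_continuous {w : ι → Pt (n + 1) → State (n + 1)} (hw : w ∈ M.V k) (i : ι) :
    Continuous (w i) := continuous_pi fun c => (M.V_contDiff hw i c).continuous

theorem Mspace_continuousOn {EE : Set (Side ι (n + 1))}
    {μ : Side ι (n + 1) → Pt (n + 1) → State (n + 1)} (hμ : μ ∈ M.Mspace k EE)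
    {s : Side ι (n + 1)} (hs : s ∈ M.sides) : ContinuousOn (μ s) (M.face s) := by
  refine continuousOn_pi.2 fun c => ?_
  obtain ⟨f, hf, hfx⟩ := hμ.1 s hs c
  exact (isPolyFun_contDiff hf).continuous.continuousOn.congr hfx

theorem const_mem_V (c : State (n + 1)) : (fun _ _ => c) ∈ M.V k :=
  M.mem_V.2 fun _ a => const_mem_polySpace (c a)

theorem const_mem_Mspace (EE : Set (Side ι (n + 1))) (c : State (n + 1)) :
    (fun _ _ => c) ∈ M.Mspace k EE :=
  ⟨fun _ _ a => ⟨fun _ => c a, ⟨MvPolynomial.C (c a), by simp, by simp⟩, fun _ _ => rfl⟩,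
    fun _ _ _ _ => rfl, fun _ _ _ _ _ _ _ _ _ => rfl⟩

theorem polySpace_eq_zero (i : ι) {f : Pt (n + 1) → ℝ} (hf : f ∈ polySpace k (M.ψ i))
    (h : ∀ x ∈ M.K i, f x = 0) : f = 0 :=
  eq_zero_of_mem_polySpace hf (M.K_interior_nonempty i) h

theorem integrableOn_trace {i : ι} {A B : Pt (n + 1) → Grad (n + 1)}
    (hA : ∀ c j, ContinuousOn (fun x => A x c j) (M.K i))
    (hB : ∀ c j, ContinuousOn (fun x => B x c j) (M.K i)) :
    IntegrableOn (fun x => ((A x)ᵀ * B x).trace) (M.K i) := by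
  simp only [trace_transpose_mul]
  exact (continuousOn_finsetSum _ fun j _ => continuousOn_finsetSum _ fun c _ =>
    (hA c j).mul (hB c j)).integrableOn_compact (M.K_isCompact i)

theorem integral_trace_eq {i : ι} {A B : Pt (n + 1) → Grad (n + 1)}
    (hA : ∀ c j, ContinuousOn (fun x => A x c j) (M.K i))
    (hB : ∀ c j, ContinuousOn (fun x => B x c j) (M.K i)) :
    ∫ x in M.K i, ((A x)ᵀ * B x).trace = ∑ j, ∑ c, ∫ x in M.K i, A x c j * B x c j := by
  have hAB : ∀ c j, IntegrableOn (fun x => A x c j * B x c j) (M.K i) := fun c j =>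
    ((hA c j).mul (hB c j)).integrableOn_compact (M.K_isCompact i)
  simp only [trace_transpose_mul]
  rw [integral_finsetSum _ fun j _ => integrable_finsetSum _ fun c _ => hAB c j]
  exact Finset.sum_congr rfl fun j _ => integral_finsetSum _ fun c _ => hAB c j

variable [Fintype ι]

theorem ipGrad_comm (A B : ι → Pt (n + 1) → Grad (n + 1)) : M.ipGrad A B = M.ipGrad B A := by
  unfold ipGrad
  simp only [trace_transpose_mul, mul_comm]

theorem ipGrad_add_left {A A' B : ι → Pt (n + 1) → Grad (n + 1)}
    (hA : ∀ i c j, ContinuousOn (fun x => A i x c j) (M.K i))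
    (hA' : ∀ i c j, ContinuousOn (fun x => A' i x c j) (M.K i))
    (hB : ∀ i c j, ContinuousOn (fun x => B i x c j) (M.K i)) :
    M.ipGrad (fun i x => A i x + A' i x) B = M.ipGrad A B + M.ipGrad A' B := by
  unfold ipGrad
  rw [← Finset.sum_add_distrib]
  refine Finset.sum_congr rfl fun i _ => ?_
  rw [← integral_add (M.integrableOn_trace (hA i) (hB i)) (M.integrableOn_trace (hA' i) (hB i))]
  simp only [transpose_add, Matrix.add_mul, Matrix.trace_add]

/-- The projection decouples into scalar projections for each element and each entry. Its existence
must be shown because the assumption on ĝ speaks only about a given P. -/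
theorem exists_isProjQ (k : ℕ) {A : ι → Pt (n + 1) → Grad (n + 1)}
    (hA : ∀ i c j, ContinuousOn (fun x => A i x c j) (M.K i)) : ∃ P, M.IsProjQ k A P := by
  have h := fun i c j => exists_L2_projection (W := polySpace k (M.ψ i)) (K := M.K i)
    (fun f hf => (contDiff_of_mem_polySpace hf).continuous)
    (fun f hf => M.polySpace_eq_zero i hf) (M.K_isCompact i) (M.K_subset_closure_interior i)
    (hA i c j)
  choose p hp hpr using h
  refine ⟨fun i x => Matrix.of fun c j => p i c j x, M.mem_Q.2 fun i c j => hp i c j, ?_⟩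
  intro r hr
  unfold ipGrad
  refine Finset.sum_congr rfl fun i _ => ?_
  have hrc := fun c j => (M.Q_contDiff hr i c j).continuous.continuousOn (s := M.K i)
  rw [M.integral_trace_eq (A := fun x => Matrix.of fun c j => p i c j x) (fun c j =>
    (contDiff_of_mem_polySpace (hp i c j)).continuous.continuousOn) hrc,
    M.integral_trace_eq (hA i) hrc]
  exact Finset.sum_congr rfl fun j _ => Finset.sum_congr rfl fun c _ =>
    hpr i c j _ (M.mem_Q.1 hr i c j)

/-- Integration by parts of broken polynomials. -/
theorem ip_divergence {v : ι → Pt (n + 1) → State (n + 1)} (hv : v ∈ M.V k)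
    {r : ι → Pt (n + 1) → Grad (n + 1)} (hr : r ∈ M.Q k) :
    M.ip v (fun i => divergence (r i)) + M.ipGrad r (fun i => gradient (v i)) =
      ∑ s ∈ M.sides_finite.toFinset, ∫ x in M.face s,
        v s.elem x ⬝ᵥ (r s.elem x *ᵥ (M.normal s).ofLp) ∂μHE[n] := by
  rw [← M.sum_elemSides, ip, ipGrad, ← Finset.sum_add_distrib]
  refine Finset.sum_congr rfl fun i _ => ?_
  have hvd := fun c => M.V_contDiff hv i c
  have hrd := fun c j => M.Q_contDiff hr i c j
  have hvg := fun c j => (M.Q_contDiff (M.gradient_mem_Q hv) i c j).continuous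
  have hrg : ∀ c j, Continuous fun x =>
      fderiv ℝ (fun y => r i y c j) x (EuclideanSpace.single j 1) := fun c j =>
    ((hrd c j).continuous_fderiv one_ne_zero).clm_apply continuous_const
  have hdiff : ∀ j x, HasFDerivAt (fun x => ∑ c, v i x c * r i x c j)
      (∑ c, (v i x c • fderiv ℝ (fun y => r i y c j) x +
        r i x c j • fderiv ℝ (fun y => v i y c) x)) x := fun j x =>
    HasFDerivAt.fun_sum fun c _ =>
      ((hvd c).differentiable one_ne_zero x).hasFDerivAt.mul
        ((hrd c j).differentiable one_ne_zero x).hasFDerivAt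
  have hder : ∀ j x, fderiv ℝ (fun x => ∑ c, v i x c * r i x c j) x (EuclideanSpace.single j 1) =
      ∑ c, (v i x c * fderiv ℝ (fun y => r i y c j) x (EuclideanSpace.single j 1) +
        r i x c j * gradient (v i) x c j) := by
    intro j x
    rw [(hdiff j x).fderiv]
    simp [gradient]
  have hdiv := M.integral_div_eq i (f := fun j x => ∑ c, v i x c * r i x c j)
    (fun j x _ => (hdiff j x).differentiableAt) (fun j => by
      simp only [hder]
      exact (continuous_finsetSum _ fun c _ => ((hvd c).continuous.mul (hrg c j)).add
        ((hrd c j).continuous.mul (hvg c j))).continuousOn)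
  have hface : ∀ s ∈ M.elemSides i, ∫ x in M.face s,
      (fun j => ∑ c, v i x c * r i x c j) ⬝ᵥ (M.normal s).ofLp ∂μHE[n] =
      ∫ x in M.face s, v s.elem x ⬝ᵥ (r s.elem x *ᵥ (M.normal s).ofLp) ∂μHE[n] := by
    intro s hs
    obtain ⟨-, rfl⟩ := M.mem_elemSides.1 hs
    congr 1
    funext x
    simp only [dotProduct, mulVec, Finset.mul_sum, Finset.sum_mul]
    rw [Finset.sum_comm]
    exact Finset.sum_congr rfl fun c _ => Finset.sum_congr rfl fun j _ => by ring
  rw [← Finset.sum_congr rfl hface, ← hdiv, ← integral_add]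
  · congr 1
    funext x
    simp only [hder, trace_transpose_mul, divergence, dotProduct, Finset.sum_add_distrib,
      Finset.mul_sum]
    rw [Finset.sum_comm]
  · have hc : Continuous fun x => v i x ⬝ᵥ divergence (r i) x :=
      continuous_finsetSum _ fun c _ => (hvd c).continuous.mul
        (continuous_finsetSum _ fun j _ => hrg c j)
    exact hc.continuousOn.integrableOn_compact (M.K_isCompact i)
  · exact M.integrableOn_trace (fun c j => (hrd c j).continuous.continuousOn)
      (fun c j => (hvg c j).continuousOn)

/-- The inviscid volume term is a boundary term. -/
theorem ipGrad_F (g : Gas (n + 1)) {v : ι → Pt (n + 1) → State (n + 1)} (hv : v ∈ M.V k)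
    (hphys : M.PhysV g v) :
    M.ipGrad (fun i x => g.F (v i x)) (fun i => gradient (v i)) =
      ∑ s ∈ M.sides_finite.toFinset, ∫ x in M.face s,
        g.fluxPotential (v s.elem x) ⬝ᵥ (M.normal s).ofLp ∂μHE[n] := by
  rw [← M.sum_elemSides, ipGrad]
  refine Finset.sum_congr rfl fun i _ => ?_
  have hvc := M.V_continuous hv i
  have hvd := fun c => M.V_contDiff hv i c
  have hvd' : Differentiable ℝ (v i) := differentiable_pi.2 fun c =>
    (hvd c).differentiable one_ne_zero
  have hvg := fun c j => (M.Q_contDiff (M.gradient_mem_Q hv) i c j).continuous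
  have hdiff : ∀ j, ∀ x ∈ M.K i, DifferentiableAt ℝ (fun x => g.fluxPotential (v i x) j) x :=
    fun j x hx => DifferentiableAt.comp (g := fun v => g.fluxPotential v j) x
      ((g.contDiffAt_fluxPotential (hphys i x hx) j).differentiableAt one_ne_zero) (hvd' x)
  -- This is ∂_j ψ_j(v_h) = F_j · ∂_j v_h: the flux is the gradient of the potential, so the volume
  -- term is a pure divergence although F(v_h) is not a polynomial.
  have hder : ∀ j, ∀ x ∈ M.K i, fderiv ℝ (fun x => g.fluxPotential (v i x) j) x
      (EuclideanSpace.single j 1) = ∑ a, g.F (v i x) a j * gradient (v i) x a j := by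
    intro j x hx
    refine fderiv_line (hdiff j x hx) ?_
    have hl : HasDerivAt (fun t : ℝ => x + t • (EuclideanSpace.single j 1 : Pt (n + 1)))
        (EuclideanSpace.single j 1) 0 := by
      simpa using ((hasDerivAt_id (0 : ℝ)).smul_const
        (EuclideanSpace.single j 1 : Pt (n + 1))).const_add x
    have hc : HasDerivAt (fun t : ℝ => v i (x + t • (EuclideanSpace.single j 1 : Pt (n + 1))))
        (fun a => gradient (v i) x a j) 0 := by
      refine hasDerivAt_pi.2 fun a => ?_
      have h1 : HasFDerivAt (fun y => v i y a) (fderiv ℝ (fun y => v i y a) x)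
          (x + (0 : ℝ) • (EuclideanSpace.single j 1 : Pt (n + 1))) := by
        simpa using ((hvd a).differentiable one_ne_zero x).hasFDerivAt
      exact h1.comp_hasDerivAt (0 : ℝ) hl
    refine (g.hasDerivAt_fluxPotential hc (by simpa using hphys i x hx) j).congr_deriv ?_
    exact Finset.sum_congr rfl fun a _ => by simp [mul_comm]
  have hF := fun c j => g.continuousOn_F (hphys i) hvc.continuousOn c j
  have hdiv := M.integral_div_eq i (f := fun j x => g.fluxPotential (v i x) j) hdiff
    (fun j => ContinuousOn.congr (continuousOn_finsetSum _ fun a _ =>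
      (hF a j).mul (hvg a j).continuousOn) (hder j))
  have hface : ∀ s ∈ M.elemSides i, ∫ x in M.face s,
      (fun j => g.fluxPotential (v i x) j) ⬝ᵥ (M.normal s).ofLp ∂μHE[n] =
      ∫ x in M.face s, g.fluxPotential (v s.elem x) ⬝ᵥ (M.normal s).ofLp ∂μHE[n] := by
    intro s hs
    obtain ⟨-, rfl⟩ := M.mem_elemSides.1 hs
    rfl
  rw [← Finset.sum_congr rfl hface, ← hdiv]
  refine setIntegral_congr_fun (M.K_isCompact i).measurableSet fun x hx => ?_
  simp only [trace_transpose_mul]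
  exact Finset.sum_congr rfl fun j _ => (hder j x hx).symm

end Spaces

end PeriodicMesh

end EntropyHDG

/-! ### The entropy inequality at a fixed time -/

namespace EntropyHDG

namespace PeriodicMesh

section EntropyInequality

variable {ι : Type*} {n : ℕ} (M : PeriodicMesh ι (n + 1)) {k : ℕ}

theorem integrableOn_dotProduct {s : Side ι (n + 1)} {a b : Pt (n + 1) → State (n + 1)}
    (ha : IntegrableOn a (M.face s) μHE[n]) (hb : ContinuousOn b (M.face s)) :
    IntegrableOn (fun x => a x ⬝ᵥ b x) (M.face s) μHE[n] :=
  integrable_finsetSum _ fun c _ =>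
    IntegrableOn.mul_continuousOn (Integrable.eval ha c) (continuousOn_pi.1 hb c)
      (M.face_isCompact s)

theorem continuous_normalComponent {r : ι → Pt (n + 1) → Grad (n + 1)} (hr : r ∈ M.Q k) (i : ι)
    (ν : Fin (n + 1) → ℝ) (c : Comp (n + 1)) : Continuous fun x => (r i x *ᵥ ν) c := by
  simp only [mulVec, dotProduct]
  exact continuous_finsetSum _ fun j _ => (M.Q_contDiff hr i c j).continuous.mul continuous_const

variable [Fintype ι]

/-- The flux potential of a single-valued trace has no net boundary contribution. -/
theorem sum_fluxPotential_skeleton (g : Gas (n + 1)) {EE : Set (Side ι (n + 1))}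
    {vhat : Side ι (n + 1) → Pt (n + 1) → State (n + 1)} (hvhat : vhat ∈ M.Mspace k EE) :
    ∑ s ∈ M.sides_finite.toFinset, ∫ x in M.face s,
      g.fluxPotential (vhat s x) ⬝ᵥ (M.normal s).ofLp ∂μHE[n] = 0 := by
  refine M.sum_sides_eq_zero fun s hs => ?_
  rw [M.integral_face_swap s (fun x => g.fluxPotential (vhat s.swap x) ⬝ᵥ (M.normal s.swap).ofLp),
    M.normal_swap hs, ← integral_neg]
  refine setIntegral_congr_fun (M.face_isCompact s).measurableSet fun x hx => ?_
  simp only [← hvhat.2.1 s hs x hx, WithLp.ofLp_neg, dotProduct_neg]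

/-- The viscous volume term is bounded by the jumps against the projected viscous flux. -/
theorem exists_ipGrad_G_le (hd : n + 1 ≤ 3) (g : Gas (n + 1)) {EE : Set (Side ι (n + 1))}
    {q : ι → Pt (n + 1) → Grad (n + 1)} (hq : q ∈ M.Q k)
    {v : ι → Pt (n + 1) → State (n + 1)} (hv : v ∈ M.V k) (hvX : M.PhysV g v)
    {vhat : Side ι (n + 1) → Pt (n + 1) → State (n + 1)} (hvhat : vhat ∈ M.Mspace k EE)
    (hgrad : ∀ r ∈ M.Q k, M.ipGrad q r + M.ip v (fun i => divergence (r i))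
      - M.ipBdry vhat (fun s x => r s.elem x *ᵥ (M.normal s).ofLp) = 0) :
    ∃ P, M.IsProjQ k (fun i x => g.G (v i x) (q i x)) P ∧
      M.ipGrad (fun i x => g.G (v i x) (q i x)) (fun i => gradient (v i)) ≤
        ∑ s ∈ M.sides_finite.toFinset, ∫ x in M.face s,
          (v s.elem x - vhat s x) ⬝ᵥ (P s.elem x *ᵥ (M.normal s).ofLp) ∂μHE[n] := by
  obtain ⟨P, hP⟩ := M.exists_isProjQ k (A := fun i x => g.G (v i x) (q i x)) fun i =>
    g.continuousOn_G (hvX i) (M.V_continuous hv i).continuousOn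
      (fun c j => (M.Q_contDiff hq i c j).continuous.continuousOn)
  refine ⟨P, hP, ?_⟩
  -- Both identities are used with r = P. They combine to (P, ∇v) = ⟨v - v̂, P n⟩ + (q, P), and here
  -- P may be traded for G in both volume products since ∇v and q lie in the space projected onto.
  have hparts := M.ip_divergence hv hP.1
  have hlift := hgrad P hP.1
  have hneg : M.ipGrad (fun i x => g.G (v i x) (q i x)) q ≤ 0 := by
    rw [ipGrad_comm]
    exact Finset.sum_nonpos fun i _ => setIntegral_nonpos (M.K_isCompact i).measurableSet
      fun x hx => g.trace_transpose_mul_G_nonpos hd (hvX i x hx) (q i x)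
  rw [← hP.2 q hq, ipGrad_comm] at hneg
  have hsum : ∑ s ∈ M.sides_finite.toFinset, ∫ x in M.face s,
      (v s.elem x - vhat s x) ⬝ᵥ (P s.elem x *ᵥ (M.normal s).ofLp) ∂μHE[n] =
      (∑ s ∈ M.sides_finite.toFinset, ∫ x in M.face s,
        v s.elem x ⬝ᵥ (P s.elem x *ᵥ (M.normal s).ofLp) ∂μHE[n]) -
      M.ipBdry vhat (fun s x => P s.elem x *ᵥ (M.normal s).ofLp) := by
    rw [ipBdry_eq_sum, ← Finset.sum_sub_distrib]
    refine Finset.sum_congr rfl fun s hs => ?_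
    have hs := M.sides_finite.mem_toFinset.1 hs
    have hPn : ∀ c, ContinuousOn (fun x => (P s.elem x *ᵥ (M.normal s).ofLp) c) (M.face s) :=
      fun c => (M.continuous_normalComponent hP.1 s.elem _ c).continuousOn
    have hvc := continuousOn_pi.1 ((M.V_continuous hv s.elem).continuousOn (s := M.face s))
    have hvhc := continuousOn_pi.1 (M.Mspace_continuousOn hvhat hs)
    rw [← integral_sub]
    · simp only [sub_dotProduct]
    · exact M.integrableOn_face hs (continuousOn_finsetSum _ fun c _ => (hvc c).mul (hPn c))
    · exact M.integrableOn_face hs (continuousOn_finsetSum _ fun c _ => (hvhc c).mul (hPn c))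
  rw [hsum, ← hP.2 _ (M.gradient_mem_Q hv)]
  linarith

/-- The semi-discrete entropy balance at a fixed time: fluxes do not produce entropy. -/
theorem entropy_production_nonpos (hd : n + 1 ≤ 3) (g : Gas (n + 1))
    {EE : Set (Side ι (n + 1))}
    {σ : State (n + 1) → State (n + 1) → Pt (n + 1) →
      Matrix (Comp (n + 1)) (Comp (n + 1)) ℝ} (hσ : g.EntropyStableStab σ)
    {ghat : ViscNumFlux ι (n + 1)} (hghat : M.EntropyStableVisc g k EE ghat)
    {q : ι → Pt (n + 1) → Grad (n + 1)} (hq : q ∈ M.Q k)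
    {v : ι → Pt (n + 1) → State (n + 1)} (hv : v ∈ M.V k) (hvX : M.PhysV g v)
    {vhat : Side ι (n + 1) → Pt (n + 1) → State (n + 1)} (hvhat : vhat ∈ M.Mspace k EE)
    (hvhatX : M.PhysM g vhat)
    (hint : ∀ s ∈ M.sides, IntegrableOn (M.numFlux g σ ghat q v vhat s) (M.face s) μHE[n])
    (hgrad : ∀ r ∈ M.Q k, M.ipGrad q r + M.ip v (fun i => divergence (r i))
      - M.ipBdry vhat (fun s x => r s.elem x *ᵥ (M.normal s).ofLp) = 0)
    (hflux : M.ipBdry (M.numFlux g σ ghat q v vhat) vhat = 0) :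
    M.ipGrad (fun i x => g.F (v i x) + g.G (v i x) (q i x)) (fun i => gradient (v i)) -
      M.ipBdry (M.numFlux g σ ghat q v vhat) (fun s => v s.elem) ≤ 0 := by
  obtain ⟨P, hP, hG⟩ := M.exists_ipGrad_G_le hd g hq hv hvX hvhat hgrad
  have hvc := fun i => (M.V_continuous hv i).continuousOn (s := M.K i)
  rw [M.ipGrad_add_left (A := fun i x => g.F (v i x)) (A' := fun i x => g.G (v i x) (q i x))
    (fun i => g.continuousOn_F (hvX i) (hvc i))
    (fun i => g.continuousOn_G (hvX i) (hvc i)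
      (fun c j => (M.Q_contDiff hq i c j).continuous.continuousOn))
    (fun i c j => (M.Q_contDiff (M.gradient_mem_Q hv) i c j).continuous.continuousOn),
    M.ipGrad_F g hv hvX]
  have h0 := M.sum_fluxPotential_skeleton g hvhat
  rw [ipBdry_eq_sum] at hflux ⊢
  -- The sums of ψ(v̂) · n and of the total flux against v̂ vanish, so they may be subtracted. The
  -- global inequality then reduces to one for the jumps on each side, where the two flux
  -- assumptions apply pointwise.
  suffices h : ∀ s ∈ M.sides_finite.toFinset,
      (∫ x in M.face s, g.fluxPotential (v s.elem x) ⬝ᵥ (M.normal s).ofLp ∂μHE[n]) -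
        (∫ x in M.face s, g.fluxPotential (vhat s x) ⬝ᵥ (M.normal s).ofLp ∂μHE[n]) +
        (∫ x in M.face s, (v s.elem x - vhat s x) ⬝ᵥ
          (P s.elem x *ᵥ (M.normal s).ofLp) ∂μHE[n]) ≤
        (∫ x in M.face s, M.numFlux g σ ghat q v vhat s x ⬝ᵥ v s.elem x ∂μHE[n]) -
        ∫ x in M.face s, M.numFlux g σ ghat q v vhat s x ⬝ᵥ vhat s x ∂μHE[n] by
    have := Finset.sum_le_sum h
    simp only [Finset.sum_add_distrib, Finset.sum_sub_distrib] at this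
    linarith
  intro s hs
  have hs := M.sides_finite.mem_toFinset.1 hs
  have hPn : ∀ c, ContinuousOn (fun x => (P s.elem x *ᵥ (M.normal s).ofLp) c) (M.face s) :=
    fun c => (M.continuous_normalComponent hP.1 s.elem _ c).continuousOn
  have hvs := (M.V_continuous hv s.elem).continuousOn (s := M.face s)
  have hvh := M.Mspace_continuousOn hvhat hs
  have hvX' : ∀ x ∈ M.face s, v s.elem x ∈ g.Xv := fun x hx => hvX _ x (M.face_subset_K s hx)
  have i1 : IntegrableOn (fun x => g.fluxPotential (v s.elem x) ⬝ᵥ (M.normal s).ofLp)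
      (M.face s) μHE[n] := M.integrableOn_face hs (continuousOn_finsetSum _ fun j _ =>
    (g.continuousOn_fluxPotential hvX' hvs j).mul continuousOn_const)
  have i2 : IntegrableOn (fun x => g.fluxPotential (vhat s x) ⬝ᵥ (M.normal s).ofLp)
      (M.face s) μHE[n] := M.integrableOn_face hs (continuousOn_finsetSum _ fun j _ =>
    (g.continuousOn_fluxPotential (hvhatX s hs) hvh j).mul continuousOn_const)
  have i3 : IntegrableOn (fun x => (v s.elem x - vhat s x) ⬝ᵥ
      (P s.elem x *ᵥ (M.normal s).ofLp)) (M.face s) μHE[n] :=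
    M.integrableOn_face hs (continuousOn_finsetSum _ fun c _ =>
      ((continuousOn_pi.1 hvs c).sub (continuousOn_pi.1 hvh c)).mul (hPn c))
  have i4 := M.integrableOn_dotProduct (hint s hs) hvs
  have i5 := M.integrableOn_dotProduct (hint s hs) hvh
  rw [← integral_sub i1 i2, ← integral_sub i4 i5]
  refine (integral_add (i1.sub i2) i3).symm.trans_le ?_
  refine setIntegral_mono_on ((i1.sub i2).add i3) (i4.sub i5)
    (M.face_isCompact s).measurableSet fun x hx => ?_
  have e1 := g.fluxPotential_sub_le hσ (hvhatX s hs x hx) (hvX' x hx) (M.normal_spec hs).1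
  have e2 := hghat q hq v hv vhat hvhat hvX hvhatX P hP s hs x hx
  simp only [Pi.sub_apply]
  rw [← dotProduct_sub, dotProduct_comm (M.numFlux g σ ghat q v vhat s x), numFlux,
    dotProduct_add]
  linarith

end EntropyInequality

end PeriodicMesh

end EntropyHDG

/-! ### Mean state and the minimum of the total entropy -/

namespace EntropyHDG

namespace PeriodicMesh

section Volume

variable {ι : Type*} {n : ℕ} (M : PeriodicMesh ι (n + 1))

theorem aedisjoint_K {i j : ι} (hij : i ≠ j) : AEDisjoint volume (M.K i) (M.K j) := by
  refine measure_mono_null (t := frontier (M.K i) ∪ frontier (M.K j)) ?_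
    (measure_union_null (M.K_frontier_null i) (M.K_frontier_null j))
  rintro x ⟨hi, hj⟩
  by_contra hx
  rw [mem_union, not_or] at hx
  have hdisj := M.disjoint_K_tile (i := i) (j := j) (zero_mem M.lattice) fun h => hij h.1.symm
  rw [zero_vadd] at hdisj
  have hint : ∀ l, x ∈ M.K l → x ∉ frontier (M.K l) → x ∈ interior (M.K l) := fun l h1 h2 =>
    not_not.1 fun h => h2 ⟨subset_closure h1, h⟩
  exact disjoint_left.1 hdisj (hint i hi hx.1) (hint j hj hx.2)

theorem volume_K_lt_top (i : ι) : volume (M.K i) < ⊤ := (M.K_isCompact i).measure_lt_top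

theorem volume_K_pos (i : ι) : 0 < volume (M.K i) :=
  Measure.measure_pos_of_nonempty_interior volume (M.K_interior_nonempty i)

variable [Fintype ι]

/-- Elements overlap only in their frontiers, and passing to the interior of the union loses only
frontier points; frontiers of convex sets are null. -/
theorem volume_domain : volume M.domain = ∑ i, volume (M.K i) := by
  have h1 : volume (⋃ i, M.K i) = ∑ i, volume (M.K i) := by
    rw [measure_iUnion₀ (fun i j hij => M.aedisjoint_K hij)
      fun i => (M.K_isCompact i).measurableSet.nullMeasurableSet, tsum_fintype]
  rw [← h1, domain]
  refine le_antisymm (measure_mono interior_subset) ?_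
  have hsub : (⋃ i, M.K i) ⊆ interior (⋃ i, M.K i) ∪ ⋃ i, frontier (M.K i) := by
    intro x hx
    obtain ⟨i, hi⟩ := mem_iUnion.1 hx
    by_cases h : x ∈ interior (M.K i)
    · exact Or.inl (interior_mono (subset_iUnion M.K i) h)
    · exact Or.inr (mem_iUnion.2 ⟨i, subset_closure hi, h⟩)
  calc volume (⋃ i, M.K i) ≤ volume (interior (⋃ i, M.K i)) + volume (⋃ i, frontier (M.K i)) :=
        (measure_mono hsub).trans (measure_union_le _ _)
    _ = volume (interior (⋃ i, M.K i)) := by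
        rw [measure_iUnion_null M.K_frontier_null, add_zero]

theorem volume_real_domain : volume.real M.domain = ∑ i, volume.real (M.K i) := by
  rw [Measure.real, volume_domain, ENNReal.toReal_sum fun i _ => (M.volume_K_lt_top i).ne]
  rfl

theorem volume_real_domain_pos : 0 < volume.real M.domain := by
  obtain ⟨i, -⟩ := M.covers 0
  rw [volume_real_domain]
  exact Finset.sum_pos (fun i _ => ENNReal.toReal_pos (M.volume_K_pos i).ne'
    (M.volume_K_lt_top i).ne) ⟨i, Finset.mem_univ i⟩

end Volume

section MeanState

variable {ι : Type*} {n : ℕ} (M : PeriodicMesh ι (n + 1)) (g : Gas (n + 1))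
  {v : ι → Pt (n + 1) → State (n + 1)}

theorem integrableOn_uOf (hvc : ∀ i, ContinuousOn (v i) (M.K i)) (hvX : M.PhysV g v) (i : ι)
    (c : Comp (n + 1)) : IntegrableOn (fun x => g.uOf (v i x) c) (M.K i) :=
  (continuousOn_pi.1 (g.continuousOn_uOf (hvX i) (hvc i)) c).integrableOn_compact (M.K_isCompact i)

theorem integrableOn_dotProduct_uOf (hvc : ∀ i, ContinuousOn (v i) (M.K i))
    (hvX : M.PhysV g v) (a : State (n + 1)) (i : ι) :
    IntegrableOn (fun x => a ⬝ᵥ g.uOf (v i x)) (M.K i) :=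
  integrable_finsetSum _ fun c _ => (M.integrableOn_uOf g hvc hvX i c).const_mul (a c)

variable [Fintype ι]

theorem meanState_dotProduct (hvc : ∀ i, ContinuousOn (v i) (M.K i)) (hvX : M.PhysV g v)
    (a : State (n + 1)) : a ⬝ᵥ M.meanState g v =
      (volume.real M.domain)⁻¹ * ∑ i, ∫ x in M.K i, a ⬝ᵥ g.uOf (v i x) := by
  have h : ∀ i, ∫ x in M.K i, a ⬝ᵥ g.uOf (v i x) =
      ∑ c, a c * ∫ x in M.K i, g.uOf (v i x) c := by
    intro i
    simp only [dotProduct]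
    rw [integral_finsetSum _ fun c _ => (M.integrableOn_uOf g hvc hvX i c).const_mul (a c)]
    exact Finset.sum_congr rfl fun c _ => integral_const_mul _ _
  rw [Finset.sum_congr rfl fun i _ => h i, Finset.sum_comm, Finset.mul_sum]
  refine Finset.sum_congr rfl fun c _ => ?_
  rw [meanState, ← Finset.mul_sum]
  ring

/-- Averages preserve strict linear inequalities. Physicality of the mean is derived by choosing a
suitable functional for density and one for pressure. -/
theorem meanState_dotProduct_pos (hvc : ∀ i, ContinuousOn (v i) (M.K i)) (hvX : M.PhysV g v)
    {a : State (n + 1)} (ha : ∀ u ∈ g.Xu, 0 < a ⬝ᵥ u) : 0 < a ⬝ᵥ M.meanState g v := by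
  rw [M.meanState_dotProduct g hvc hvX]
  obtain ⟨i, -⟩ := M.covers 0
  refine mul_pos (inv_pos.2 M.volume_real_domain_pos)
    (Finset.sum_pos (fun i _ => ?_) ⟨i, Finset.mem_univ i⟩)
  have hpos : ∀ x ∈ M.K i, 0 < a ⬝ᵥ g.uOf (v i x) := fun x hx => ha _ (g.uOf_mem (hvX i x hx))
  rw [setIntegral_pos_iff_support_of_nonneg_ae
    ((ae_restrict_iff' (M.K_isCompact i).measurableSet).2
      (Filter.Eventually.of_forall fun x hx => (hpos x hx).le))
    (M.integrableOn_dotProduct_uOf g hvc hvX a i)]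
  exact (M.volume_K_pos i).trans_le (measure_mono fun x hx => ⟨(hpos x hx).ne', hx⟩)

/-- The mean of a physical solution is physical. -/
theorem meanState_mem (hvc : ∀ i, ContinuousOn (v i) (M.K i)) (hvX : M.PhysV g v) :
    M.meanState g v ∈ g.Xu := by
  set u := M.meanState g v with hu
  have hρ : 0 < u cMass := by
    have := M.meanState_dotProduct_pos g hvc hvX (a := Pi.single cMass 1) fun u hu => by
      simpa using hu.1
    simpa using this
  refine ⟨hρ, ?_⟩
  -- With W the velocity of the mean state itself, the affine bound on the pressure is an equality
  -- at the mean and an upper bound on positive pressures elsewhere.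
  set W := velocity u with hW
  let a : State (n + 1) := fun c => (g.γ - 1) * match c with
    | Sum.inl _ => (∑ i, W i ^ 2) / 2
    | Sum.inr (Sum.inl i) => -W i
    | Sum.inr (Sum.inr _) => 1
  have ha : ∀ u : State (n + 1), a ⬝ᵥ u =
      (g.γ - 1) * (u cEnergy - ∑ i, W i * u (cMom i) + u cMass * (∑ i, W i ^ 2) / 2) := by
    intro u
    rw [dotProduct_comp]
    simp only [a, mul_neg, neg_mul, Finset.sum_neg_distrib, mul_assoc, ← Finset.mul_sum]
    ring
  rw [pressure_eq_affine hρ, ← hW, ← ha]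
  refine M.meanState_dotProduct_pos g hvc hvX fun w hw => ?_
  rw [ha]
  exact hw.2.trans_le (pressure_le_affine g.one_lt_γ hw.1 W)

/-- Among all states with the same mean, the constant one minimizes the total entropy. -/
theorem entropy_meanState_le (hvc : ∀ i, ContinuousOn (v i) (M.K i)) (hvX : M.PhysV g v) :
    ∑ i, ∫ _x in M.K i, g.H (M.meanState g v) ≤ M.totalEntropy g v := by
  set u := M.meanState g v with hu
  have hmem : u ∈ g.Xu := M.meanState_mem g hvc hvX
  set a := g.vOf u with ha
  have hmean := M.meanState_dotProduct g hvc hvX a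
  rw [← hu, eq_inv_mul_iff_mul_eq₀ M.volume_real_domain_pos.ne'] at hmean
  have hconst : ∀ (i : ι) (r : ℝ), ∫ _x in M.K i, r = volume.real (M.K i) * r := fun i r => by
    rw [setIntegral_const, smul_eq_mul]
  have hic : ∀ (i : ι) (r : ℝ), IntegrableOn (fun _ => r) (M.K i) := fun i r =>
    continuousOn_const.integrableOn_compact (M.K_isCompact i)
  have hle : ∀ i, (∫ _x in M.K i, g.H u) + ((∫ x in M.K i, a ⬝ᵥ g.uOf (v i x)) -
      ∫ _x in M.K i, a ⬝ᵥ u) ≤ ∫ x in M.K i, g.H (g.uOf (v i x)) := by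
    intro i
    have i1 := M.integrableOn_dotProduct_uOf g hvc hvX a i
    rw [← integral_sub i1 (hic i _)]
    refine (integral_add (hic i _) (i1.sub (hic i _))).symm.trans_le ?_
    refine setIntegral_mono_on ((hic i _).add (i1.sub (hic i _)))
      ((g.continuousOn_H_uOf (hvX i) (hvc i)).integrableOn_compact (M.K_isCompact i))
      (M.K_isCompact i).measurableSet fun x hx => ?_
    simp only [Pi.sub_apply]
    rw [← dotProduct_sub]
    exact genEntropy_tangent_le g.one_lt_γ g.s₀ (g.uOf_mem (hvX i x hx)) hmem
  have hsum := Finset.sum_le_sum fun i (_ : i ∈ Finset.univ) => hle i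
  simp only [Finset.sum_add_distrib, Finset.sum_sub_distrib] at hsum
  have hvol : ∑ i, ∫ _x in M.K i, a ⬝ᵥ u = volume.real M.domain * (a ⬝ᵥ u) := by
    rw [volume_real_domain, Finset.sum_mul]
    exact Finset.sum_congr rfl fun i _ => hconst i _
  -- The linear term of the tangent plane integrates to zero because u is the mean.
  rw [hvol, ← hmean, sub_self, add_zero] at hsum
  exact hsum

end MeanState

/-! ### Conservation and entropy decay along a solution -/

section Evolution

variable {ι : Type*} [Fintype ι] {n : ℕ} {M : PeriodicMesh ι (n + 1)} {g : Gas (n + 1)} {k : ℕ}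
  {EE : Set (Side ι (n + 1))}
  {σ : State (n + 1) → State (n + 1) → Pt (n + 1) → Matrix (Comp (n + 1)) (Comp (n + 1)) ℝ}
  {ghat : ViscNumFlux ι (n + 1)} {u₀ : Pt (n + 1) → State (n + 1)} {tf : ℝ}
  {q : ℝ → ι → Pt (n + 1) → Grad (n + 1)} {v : ℝ → ι → Pt (n + 1) → State (n + 1)}
  {vhat : ℝ → Side ι (n + 1) → Pt (n + 1) → State (n + 1)}

namespace IsSolution

theorem hasDerivAt_sum_integral (hsol : M.IsSolution g k EE σ ghat u₀ tf q v vhat)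
    (hphys : ∀ t ∈ Icc 0 tf, M.PhysV g (v t))
    {G : State (n + 1) → ℝ} (hG : ∀ v ∈ g.Xv, ContDiffAt ℝ 1 G v) :
    ContinuousOn (fun t => ∑ i, ∫ x in M.K i, G (v t i x)) (Icc 0 tf) ∧
    ∀ t ∈ Ioo 0 tf, HasDerivAt (fun t => ∑ i, ∫ x in M.K i, G (v t i x))
      (∑ i, ∫ x in M.K i, deriv (fun t => G (v t i x)) t) t := by
  have h := fun i => hasDerivAt_integral_field (W := polySpace k (M.ψ i)) (K := M.K i)
    (fun f hf => (contDiff_of_mem_polySpace hf).continuous)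
    (fun f hf => M.polySpace_eq_zero i hf) (M.K_isCompact i) g.isOpen_Xv hG
    (v := fun t => v t i) (fun t ht c => M.mem_V.1 (hsol.v_mem t ht) i c) (hsol.v_cont i)
    (hsol.v_diff i) (fun t ht => hphys t ht i)
  exact ⟨continuousOn_finsetSum _ fun i _ => (h i).1,
    fun t ht => HasDerivAt.fun_sum fun i _ => (h i).2 t ht⟩

/-- The total amounts of mass, momentum and energy are conserved. -/
theorem hasDerivAt_total (hsol : M.IsSolution g k EE σ ghat u₀ tf q v vhat)
    (hphys : ∀ t ∈ Icc 0 tf, M.PhysV g (v t))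
    {t : ℝ} (ht : t ∈ Ioo 0 tf) (c : Comp (n + 1)) :
    HasDerivAt (fun t => ∑ i, ∫ x in M.K i, g.uOf (v t i x) c) 0 t := by
  have huc : ∀ v ∈ g.Xv, ContDiffAt ℝ 1 (fun v => g.uOf v c) v := fun v hv =>
    contDiffAt_pi.1 (g.contDiffAt_uOf hv) c
  refine ((hasDerivAt_sum_integral hsol hphys huc).2 t ht).congr_deriv ?_
  -- A constant test has zero gradient, and it is also admissible in the skeleton space, so the flux
  -- equation removes the boundary term too.
  have h1 := hsol.eq_conservation t ht _ (M.const_mem_V (Pi.single c 1))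
  have h2 := hsol.eq_flux t ht _ (M.const_mem_Mspace EE (Pi.single c 1))
  have hgrad : gradient (fun _ : Pt (n + 1) => (Pi.single c 1 : State (n + 1))) = 0 := by
    funext x
    ext a j
    simp [gradient]
  have h3 : M.ipGrad (fun i x => g.F (v t i x) + g.G (v t i x) (q t i x))
      (fun _ => gradient fun _ => Pi.single c 1) = 0 := by
    simp [ipGrad, hgrad]
  rw [h2, h3, sub_zero, add_zero, ip] at h1
  rw [← h1]
  refine Finset.sum_congr rfl fun i _ => setIntegral_congr_fun (M.K_isCompact i).measurableSet
    fun x hx => ?_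
  have hd : DifferentiableAt ℝ (fun t => g.uOf (v t i x)) t := DifferentiableAt.comp t
    ((g.contDiffAt_uOf (hphys t (Ioo_subset_Icc_self ht) i x hx)).differentiableAt one_ne_zero)
    (hsol.v_diff i x hx t ht)
  simp only [dotProduct_single_one]
  exact (hasDerivAt_pi.1 hd.hasDerivAt c).deriv

/-- Derivatives vanish only in the open time interval; continuity up to the endpoints extends
constancy to t = 0, where the lower bound is anchored. -/
theorem meanState_eq (hsol : M.IsSolution g k EE σ ghat u₀ tf q v vhat)
    (hphys : ∀ t ∈ Icc 0 tf, M.PhysV g (v t))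
    {t : ℝ} (ht : t ∈ Icc 0 tf) : M.meanState g (v t) = M.meanState g (v 0) := by
  funext c
  have huc : ∀ v ∈ g.Xv, ContDiffAt ℝ 1 (fun v => g.uOf v c) v := fun v hv =>
    contDiffAt_pi.1 (g.contDiffAt_uOf hv) c
  have hcont := (hasDerivAt_sum_integral hsol hphys huc).1
  have hder := fun s (hs : s ∈ interior (Icc 0 tf)) =>
    hasDerivAt_total hsol hphys (interior_Icc (a := (0 : ℝ)) ▸ hs) c
  have hdiff : DifferentiableOn ℝ (fun t => ∑ i, ∫ x in M.K i, g.uOf (v t i x) c)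
      (interior (Icc 0 tf)) := fun s hs => (hder s hs).differentiableAt.differentiableWithinAt
  have h0 : (0 : ℝ) ∈ Icc 0 tf := ⟨le_rfl, ht.1.trans ht.2⟩
  simp only [meanState]
  congr 1
  exact le_antisymm
    (antitoneOn_of_deriv_nonpos (convex_Icc 0 tf) hcont hdiff
      (fun s hs => (hder s hs).deriv.le) h0 ht ht.1)
    (monotoneOn_of_deriv_nonneg (convex_Icc 0 tf) hcont hdiff
      (fun s hs => (hder s hs).deriv.ge) h0 ht ht.1)

theorem continuousOn_totalEntropy (hsol : M.IsSolution g k EE σ ghat u₀ tf q v vhat)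
    (hphys : ∀ t ∈ Icc 0 tf, M.PhysV g (v t)) :
    ContinuousOn (fun t => M.totalEntropy g (v t)) (Icc 0 tf) :=
  (hasDerivAt_sum_integral hsol hphys fun _ hv => g.contDiffAt_H_uOf hv).1

/-- The rate of change of the total entropy is the production by the fluxes. -/
theorem hasDerivAt_totalEntropy (hsol : M.IsSolution g k EE σ ghat u₀ tf q v vhat)
    (hphys : ∀ t ∈ Icc 0 tf, M.PhysV g (v t))
    {t : ℝ} (ht : t ∈ Ioo 0 tf) :
    HasDerivAt (fun t => M.totalEntropy g (v t))
      (M.ipGrad (fun i x => g.F (v t i x) + g.G (v t i x) (q t i x))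
          (fun i => gradient (v t i)) -
        M.ipBdry (M.numFlux g σ ghat (q t) (v t) (vhat t)) (fun s => v t s.elem)) t := by
  refine ((hasDerivAt_sum_integral hsol hphys
    (fun _ hv => g.contDiffAt_H_uOf hv)).2 t ht).congr_deriv ?_
  have ht' := Ioo_subset_Icc_self ht
  -- The unknown is the entropy variable itself, so v_h is an admissible test function and dH = v ·
  -- du identifies the time term with the entropy rate.
  have h1 := hsol.eq_conservation t ht _ (hsol.v_mem t ht')
  have h2 : ∑ i, ∫ x in M.K i, deriv (fun t => g.H (g.uOf (v t i x))) t =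
      M.ip (fun i x => deriv (fun t' => g.uOf (v t' i x)) t) (v t) :=
    Finset.sum_congr rfl fun i _ => setIntegral_congr_fun (M.K_isCompact i).measurableSet
      fun x hx => (g.hasDerivAt_H_uOf (hsol.v_diff i x hx t ht).hasDerivAt
        (hphys t ht' i x hx)).deriv
  rw [h2]
  linarith

end IsSolution

end Evolution

end PeriodicMesh

end EntropyHDG

theorem theorem2 {ι : Type*} [Fintype ι] {d : ℕ} (hd1 : 1 ≤ d) (hd3 : d ≤ 3)
    (M : EntropyHDG.PeriodicMesh ι d) (g : EntropyHDG.Gas d) (k : ℕ)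
    (EE : Set (EntropyHDG.Side ι d))
    (σ : EntropyHDG.State d → EntropyHDG.State d → EntropyHDG.Pt d →
      Matrix (EntropyHDG.Comp d) (EntropyHDG.Comp d) ℝ)
    (hσ : g.EntropyStableStab σ)
    (ghat : EntropyHDG.PeriodicMesh.ViscNumFlux ι d)
    (hghat : M.EntropyStableVisc g k EE ghat)
    (u₀ : EntropyHDG.Pt d → EntropyHDG.State d)
    (hu₀ : ∀ x ∈ M.domain, u₀ x ∈ g.Xu)
    (hu₀L2 : MemLp (fun x => g.vOf (u₀ x)) 2 (volume.restrict M.domain))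
    (tf : ℝ) (htf : 0 < tf)
    (q : ℝ → ι → EntropyHDG.Pt d → EntropyHDG.Grad d)
    (v : ℝ → ι → EntropyHDG.Pt d → EntropyHDG.State d)
    (vhat : ℝ → EntropyHDG.Side ι d → EntropyHDG.Pt d → EntropyHDG.State d)
    (hsol : M.IsSolution g k EE σ ghat u₀ tf q v vhat)
    (hphys : ∀ t ∈ Set.Icc 0 tf, M.PhysV g (v t))
    (hphyshat : ∀ t ∈ Set.Ioo 0 tf, M.PhysM g (vhat t)) :
    (∀ t ∈ Set.Ioo 0 tf, DifferentiableAt ℝ (fun t' => M.totalEntropy g (v t')) t ∧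
        deriv (fun t' => M.totalEntropy g (v t')) t ≤ 0) ∧
      AntitoneOn (fun t => M.totalEntropy g (v t)) (Set.Icc 0 tf) ∧
      (∀ t ∈ Set.Icc 0 tf,
        (∑ i, ∫ _x in M.K i, g.H (M.meanState g (v 0))) ≤ M.totalEntropy g (v t) ∧
          M.totalEntropy g (v t) ≤ M.totalEntropy g (v 0)) := by
  -- Writing d = n + 1 makes the face dimension d - 1 reduce to n.
  obtain ⟨n, rfl⟩ : ∃ n, d = n + 1 := ⟨d - 1, by omega⟩
  have hd : ∀ t ∈ Set.Ioo 0 tf, HasDerivAt (fun t => M.totalEntropy g (v t)) _ t :=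
    fun t ht => hsol.hasDerivAt_totalEntropy hphys ht
  have hle : ∀ t ∈ Set.Ioo 0 tf, deriv (fun t => M.totalEntropy g (v t)) t ≤ 0 := by
    intro t ht
    have ht' := Set.Ioo_subset_Icc_self ht
    rw [(hd t ht).deriv]
    exact M.entropy_production_nonpos hd3 g hσ hghat (hsol.q_mem t ht) (hsol.v_mem t ht')
      (hphys t ht') (hsol.vhat_mem t ht) (hphyshat t ht) (hsol.flux_integrable t ht)
      (hsol.eq_gradient t ht) (hsol.eq_flux t ht _ (hsol.vhat_mem t ht))
  have hanti : AntitoneOn (fun t => M.totalEntropy g (v t)) (Set.Icc 0 tf) := by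
    refine antitoneOn_of_deriv_nonpos (convex_Icc 0 tf) (hsol.continuousOn_totalEntropy hphys)
      ?_ ?_ <;> rw [interior_Icc]
    · exact fun t ht => (hd t ht).differentiableAt.differentiableWithinAt
    · exact hle
  refine ⟨fun t ht => ⟨(hd t ht).differentiableAt, hle t ht⟩, hanti, fun t ht => ⟨?_, ?_⟩⟩
  · rw [← hsol.meanState_eq hphys ht]
    exact M.entropy_meanState_le g (fun i => (M.V_continuous (hsol.v_mem t ht) i).continuousOn)
      (hphys t ht)
  · exact hanti ⟨le_rfl, htf.le⟩ ht ht.1
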